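/- Let $k>1$ be an integer. A figure is a finite set of unit tiles of the square grid. It is *admissible* (for $k$) if it is the union of a finite nonempty sequence of $k\times(k+1)$ and/or $(k+1)\times k$ rectangles of tiles in which every rectangle after the first overlaps the union of the previous ones in at least one tile if $k$ is even, and in at least two adjacent tiles (tiles sharing an edge) if $k$ is odd. The *puzzle group* $G$ of a figure with $n$ tiles is the group of permutations of its $n$ tiles generated by the $90^\circ$ rotations of all the $k\times k$ blocks of tiles contained in the figure. For every admissible figure with $n$ tiles the puzzle group $G$ is as follows. 1. If $k$ is even and $n\neq 6$, then $G=A_n$ if $k\equiv 0 \pmod 4$, and $G=S_n$ if $k\equiv 2\pmod 4$. 2. If $k$ is odd and $n\neq 12$, shade the figure as a checkerboard, with $m$ black tiles and $n-m$ white tiles, and let $S_m\times S_{n-m}$ be the group of permutations of the tiles that preserve the colors. Then $G=A_m\times A_{n-m}$ if $k\equiv 1,7\pmod 8$, and $G=\mathrm{Even}(S_m\times S_{n-m})$ if $k\equiv 3,5\pmod 8$, where $\mathrm{Even}(S_m\times S_{n-m})=(A_m\times A_{n-m})\cup\big((S_m\setminus A_m)\times(S_{n-m}\setminus A_{n-m})\big)$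 is the group of all even permutations in $S_m\times S_{n-m}$. 3. If $n=6$, then for a suitable labeling of the six tiles by the points of the projective line $\mathbb{Z}_5\cup\{\infty\}$, $G$ equals the group $PGL_2(5)$ of all transformations $z\mapsto\frac{az+b}{cz+d}$ with $a,b,c,d\in\mathbb{Z}_5$ and $ad-bc\neq0$; moreover $G\cong S_5$. If $k=3$ and $n=12$, then $G\cong S_6$; its orbits on the tiles are the two color classes of the checkerboard shading, each with six tiles, and the projection of $G$ onto each orbit (the group of permutations of the orbit induced by $G$) is the full symmetric group $S_6$ of that orbit. -/

import Mathlib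

namespace RotatingSquares

/-- A unit tile of the square grid, given by its (row, column) coordinates. -/
abbrev Tile : Type := ℤ × ℤ

/-- The tiles of the rectangle with `h` rows and `w` columns whose upper left tile is `c`. -/
noncomputable def rect (h w : ℕ) (c : Tile) : Finset Tile :=
  Finset.Ico c.1 (c.1 + h) ×ˢ Finset.Ico c.2 (c.2 + w)

theorem mem_rect {h w : ℕ} {c x : Tile} :
    x ∈ rect h w c ↔ (c.1 ≤ x.1 ∧ x.1 < c.1 + h) ∧ (c.2 ≤ x.2 ∧ x.2 < c.2 + w) := by
  simp [rect]

/-- `R` is a `k × (k+1)` rectangle or a `(k+1) × k` rectangle of tiles. -/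
def IsBasicRect (k : ℕ) (R : Finset Tile) : Prop :=
  ∃ c : Tile, R = rect k (k + 1) c ∨ R = rect (k + 1) k c

/-- Two tiles are adjacent when they share an edge. -/
def Adjacent (x y : Tile) : Prop :=
  |x.1 - y.1| + |x.2 - y.2| = 1

/-- The overlap required of a new rectangle `R` with the previous arrangement `F`: at least one
tile if `k` is even, at least two adjacent tiles if `k` is odd. -/
def Overlaps (k : ℕ) (F R : Finset Tile) : Prop :=
  (Even k → (F ∩ R).Nonempty) ∧
  (Odd k → ∃ x ∈ F ∩ R, ∃ y ∈ F ∩ R, Adjacent x y)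

/-- Admissible figures: built from `k × (k+1)` and `(k+1) × k` rectangles in a sequence in which
each new rectangle overlaps the previous arrangement. -/
inductive Admissible (k : ℕ) : Finset Tile → Prop
  | single (R : Finset Tile) (hR : IsBasicRect k R) : Admissible k R
  | attach (F R : Finset Tile) (hF : Admissible k F) (hR : IsBasicRect k R)
      (hFR : Overlaps k F R) : Admissible k (F ∪ R)

/-- The clockwise rotation by 90 degrees of the `k × k` block whose upper left tile is `c`, as a
permutation of the grid that fixes every tile outside the block. Inside the block, the tile in
row `i` and column `j` (counted from `0`) goes to row `j` and column `k - 1 - i`. -/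
noncomputable def blockRotation (k : ℕ) (c : Tile) : Equiv.Perm Tile where
  toFun x := if x ∈ rect k k c then (c.1 + (x.2 - c.2), c.2 + (k - 1 - (x.1 - c.1))) else x
  invFun x := if x ∈ rect k k c then (c.1 + (k - 1 - (x.2 - c.2)), c.2 + (x.1 - c.1)) else x
  left_inv x := by
    by_cases h : x ∈ rect k k c
    · have h' : (c.1 + (x.2 - c.2), c.2 + ((k : ℤ) - 1 - (x.1 - c.1))) ∈ rect k k c := by
        rw [mem_rect] at h ⊢
        dsimp only
        omega
      simp only [h, h', if_true]
      ext <;> dsimp only <;> ring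
    · simp [h]
  right_inv x := by
    by_cases h : x ∈ rect k k c
    · have h' : (c.1 + ((k : ℤ) - 1 - (x.2 - c.2)), c.2 + (x.1 - c.1)) ∈ rect k k c := by
        rw [mem_rect] at h ⊢
        dsimp only
        omega
      simp only [h, h', if_true]
      ext <;> dsimp only <;> ring
    · simp [h]

theorem blockRotation_mem_iff {k : ℕ} {c : Tile} {F : Finset Tile} (h : rect k k c ⊆ F) (x : Tile) :
    blockRotation k c x ∈ F ↔ x ∈ F := by
  by_cases hx : x ∈ rect k k c
  · have h' : blockRotation k c x ∈ rect k k c := by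
      simp only [blockRotation, Equiv.coe_fn_mk, hx, if_true]
      rw [mem_rect] at hx ⊢
      dsimp only
      omega
    exact ⟨fun _ => h hx, fun _ => h h'⟩
  · simp [blockRotation, hx]

/-- The rotation of a `k × k` block contained in the figure `F`, as a permutation of the tiles
of `F`. -/
noncomputable def rotationOn {k : ℕ} {c : Tile} {F : Finset Tile} (h : rect k k c ⊆ F) : Equiv.Perm F :=
  (blockRotation k c).subtypePerm (blockRotation_mem_iff h)

/-- The puzzle group of the figure `F`: the group of permutations of the tiles of `F` generated by
the rotations of all `k × k` blocks contained in `F`. -/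
def puzzleGroup (k : ℕ) (F : Finset Tile) : Subgroup (Equiv.Perm F) :=
  Subgroup.closure {g | ∃ (c : Tile) (h : rect k k c ⊆ F), g = rotationOn h}

/-- The black tiles of the checkerboard shading of `F`. -/
def Black (F : Finset Tile) (x : F) : Prop := Even (x.1.1 + x.1.2)

instance (F : Finset Tile) : DecidablePred (Black F) :=
  fun x => inferInstanceAs (Decidable (Even (x.1.1 + x.1.2)))

/-- `S_m × S_{n-m}`, as a group of permutations of the tiles of `F`: the first factor permutes the
black tiles and the second factor permutes the white tiles. -/
def symProd (F : Finset Tile) : Subgroup (Equiv.Perm F) :=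
  (Equiv.Perm.subtypeCongrHom (Black F)).range

/-- `A_m × A_{n-m}`, as a group of permutations of the tiles of `F`. -/
def altProd (F : Finset Tile) : Subgroup (Equiv.Perm F) :=
  ((alternatingGroup {x // Black F x}).prod (alternatingGroup {x // ¬ Black F x})).map
    (Equiv.Perm.subtypeCongrHom (Black F))

/-- `Even(S_m × S_{n-m})`: the even permutations in `S_m × S_{n-m}`. -/
def evenSymProd (F : Finset Tile) : Subgroup (Equiv.Perm F) :=
  symProd F ⊓ alternatingGroup F

/-- `(S_m - A_m) × (S_{n-m} - A_{n-m})`: the permutations of the tiles of `F` that preserve the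
colors and act by an odd permutation on the black tiles and on the white tiles. -/
def oddOddProd (F : Finset Tile) : Set (Equiv.Perm F) :=
  Equiv.Perm.subtypeCongrHom (Black F) ''
    {p | p.1 ∉ alternatingGroup {x // Black F x} ∧ p.2 ∉ alternatingGroup {x // ¬ Black F x}}

instance fact_prime_five : Fact (Nat.Prime 5) := ⟨Nat.prime_five⟩

/-- `PGL_2(5)` as a permutation group of the projective line `ℤ/5 ∪ {∞}`: the group of all
transformations `z ↦ (a z + b) / (c z + d)` with `a d - b c ≠ 0`. -/
def PGL25 : Subgroup (Equiv.Perm (OnePoint (ZMod 5))) :=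
  (MulAction.toPermHom (Matrix.GeneralLinearGroup (Fin 2) (ZMod 5)) (OnePoint (ZMod 5))).range

end RotatingSquares

/-! A permutation group that contains all three-cycles on a set contains the alternating group of
that set. The core of the proof is therefore `IsLinked`: any two tiles, of one color if k is odd
because rotations then preserve colors, are joined by a three-cycle of the puzzle group. Being
linked is an invariant equivalence relation (`Linked.map`, `Linked.trans`), and every three-cycle
inside a class lies in the group (`threeCyc_mem_of_linked`). For a linked figure the group thus
contains A_n or A_m × A_{n-m}. A rotation is a product of k²/4 four-cycles if k is even, and of
(k²-1)/8 four-cycles in each color if k is odd; the parity of these numbers decides the rest.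

Links spread over overlaps, so for k ≥ 4 one rectangle is enough. Its group is generated by the
rotations A and B of its left and right blocks. By `rel_of_invariant` one link between the first and
the last column is enough (one per color if k is odd). For k ≥ 5 the permutation (AB)² moves only
three sides of the rectangle, suitable conjugates of it move sets that meet these sides in a single
tile, and the commutator of two permutations whose supports share exactly one point is a
three-cycle. For k = 4 an explicit word gives a three-cycle.

For k = 2 and k = 3 one rectangle is not linked. Its group is PGL_2(5) on six tiles, respectively
S_6 acting on the two color classes in two ways that differ by an outer automorphism. Two distinct
overlapping rectangles are linked (`isLinked_union_two`, `isLinked_union_three`), and further ones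
are attached using transitivity alone (`IsLinked.attach`). The exceptional groups are identified in
explicit coordinates, by means of partitions of six tiles into pairs. -/

namespace RotatingSquares
open Equiv Equiv.Perm

/-! ### Three-cycles and the equivalence relation they generate -/

section Linked

variable {α : Type*} [DecidableEq α]

/-- The permutation `x ↦ y ↦ z ↦ x`, for distinct `x`, `y`, `z`. -/
def threeCyc (x y z : α) : Perm α := swap x y * swap y z

theorem threeCyc_conj (g : Perm α) (x y z : α) :
    g * threeCyc x y z * g⁻¹ = threeCyc (g x) (g y) (g z) := by
  simp only [threeCyc, swap_apply_apply]
  group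

theorem threeCyc_rotate {x y z : α} (hxy : x ≠ y) (hyz : y ≠ z) (hzx : z ≠ x) :
    threeCyc y z x = threeCyc x y z := by
  ext w
  simp only [threeCyc, Perm.mul_apply, swap_apply_def]
  split_ifs <;> simp_all

theorem threeCyc_inv (x y z : α) : (threeCyc x y z)⁻¹ = threeCyc z y x := by
  simp [threeCyc, swap_comm]

theorem threeCyc_apply_left {x y z : α} (hxy : x ≠ y) (hzx : z ≠ x) :
    threeCyc x y z x = y := by
  simp [threeCyc, swap_apply_of_ne_of_ne hxy hzx.symm]

theorem threeCyc_apply_mid {x y z : α} (hyz : y ≠ z) (hzx : z ≠ x) :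
    threeCyc x y z y = z := by
  simp [threeCyc, swap_apply_of_ne_of_ne hzx hyz.symm]

theorem threeCyc_apply_right (x y z : α) : threeCyc x y z z = x := by
  simp [threeCyc]

theorem threeCyc_apply_of_ne {x y z w : α} (hx : w ≠ x) (hy : w ≠ y) (hz : w ≠ z) :
    threeCyc x y z w = w := by
  simp [threeCyc, swap_apply_of_ne_of_ne, hx, hy, hz]

theorem threeCyc_mul_inv {x y z u : α} (hxy : x ≠ y) (hux : u ≠ x) (huy : u ≠ y) :
    threeCyc x y u * (threeCyc z y u)⁻¹ = threeCyc x y z := by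
  rw [threeCyc_inv]
  ext w
  simp only [threeCyc, Perm.mul_apply, swap_apply_def]
  grind

theorem inv_threeCyc_mul {x y z u : α} (hxy : x ≠ y) (hyz : y ≠ z) (hzx : z ≠ x)
    (hux : u ≠ x) (huy : u ≠ y) (huz : u ≠ z) :
    (threeCyc x z u)⁻¹ * threeCyc x y u = threeCyc x y z := by
  rw [threeCyc_inv]
  ext w
  simp only [threeCyc, Perm.mul_apply, swap_apply_def]
  grind

/-- Two points are linked by a permutation group when they coincide or lie in the support of a
common three-cycle of the group. -/
def Linked (H : Subgroup (Perm α)) (x y : α) : Prop :=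
  x = y ∨ ∃ z, x ≠ y ∧ y ≠ z ∧ z ≠ x ∧ threeCyc x y z ∈ H

variable {H K : Subgroup (Perm α)} {x y z : α}

theorem Linked.refl (H : Subgroup (Perm α)) (x : α) : Linked H x x := Or.inl rfl

theorem Linked.of_mem (hxy : x ≠ y) (hyz : y ≠ z) (hzx : z ≠ x) (h : threeCyc x y z ∈ H) :
    Linked H x y :=
  Or.inr ⟨z, hxy, hyz, hzx, h⟩

theorem Linked.mono (hHK : H ≤ K) (h : Linked H x y) : Linked K x y := by
  rcases h with rfl | ⟨z, h1, h2, h3, h4⟩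
  · exact Linked.refl K x
  · exact .of_mem h1 h2 h3 (hHK h4)

theorem Linked.symm (h : Linked H x y) : Linked H y x := by
  rcases h with rfl | ⟨z, h1, h2, h3, h4⟩
  · exact Linked.refl H x
  · refine .of_mem h1.symm h3.symm h2.symm ?_
    have h5 := H.inv_mem h4
    rw [threeCyc_inv] at h5
    rwa [threeCyc_rotate h2.symm h1.symm h3.symm] 

theorem Linked.map (h : Linked H x y) {g : Perm α} (hg : g ∈ H) : Linked H (g x) (g y) := by
  rcases h with rfl | ⟨z, h1, h2, h3, h4⟩
  · exact Linked.refl H _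
  · refine .of_mem (z := g z) (by simpa) (by simpa) (by simpa) ?_
    rw [← threeCyc_conj]
    exact H.mul_mem (H.mul_mem hg h4) (H.inv_mem hg)

/-- The inverse of a three-cycle x ↦ y ↦ u ↦ x sends y to x and fixes any z outside it, so it
carries a link between y and z to one between x and z. If z = u, the three-cycle itself joins x and
z. -/
theorem Linked.trans (h : Linked H x y) (h' : Linked H y z) : Linked H x z := by
  rcases h with rfl | ⟨u, h1, h2, h3, h4⟩
  · exact h'
  rcases h' with rfl | ⟨v, k1, k2, k3, k4⟩
  · exact .of_mem h1 h2 h3 h4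
  by_cases hxz : x = z
  · subst hxz; exact .refl H _
  by_cases huz : u = z
  · subst huz
    refine Linked.symm (.of_mem h3 h1 h2 ?_)
    rwa [← threeCyc_rotate h3 h1 h2]
  have h5 : threeCyc x y u x = y := threeCyc_apply_left h1 h3
  have h6 : threeCyc x y u z = z := threeCyc_apply_of_ne (Ne.symm hxz) k1.symm (Ne.symm huz)
  have h7 := Linked.map (.of_mem k1 k2 k3 k4) (H.inv_mem h4)
  rwa [Perm.inv_eq_iff_eq.2 h5.symm, Perm.inv_eq_iff_eq.2 h6.symm] at h7

theorem Linked.equivalence (H : Subgroup (Perm α)) : Equivalence (Linked H) :=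
  ⟨.refl H, .symm, .trans⟩

/-- The links provide three-cycles (x y u) and (x z v) with uncontrolled third points. In the
generic case, conjugating the first by the second gives (z y u), and (x y u)(z y u)⁻¹ = (x y z). -/
theorem threeCyc_mem_of_linked (hxy : x ≠ y) (hyz : y ≠ z) (hzx : z ≠ x) (h : Linked H x y)
    (h' : Linked H x z) : threeCyc x y z ∈ H := by
  obtain ⟨u, -, h2, h3, h4⟩ := h.resolve_left hxy
  obtain ⟨v, -, k2, k3, k4⟩ := h'.resolve_left hzx.symm
  by_cases huz : u = z
  · rwa [← huz]
  by_cases hvy : v = y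
  · subst hvy
    have := H.inv_mem k4
    rwa [threeCyc_inv, threeCyc_rotate hxy hyz hzx] at this
  by_cases huv : u = v
  · subst huv
    rw [← inv_threeCyc_mul hxy hyz hzx h3 h2.symm huz]
    exact H.mul_mem (H.inv_mem k4) h4
  · rw [← threeCyc_mul_inv hxy h3 h2.symm]
    refine H.mul_mem h4 (H.inv_mem ?_)
    have := H.mul_mem (H.mul_mem k4 h4) (H.inv_mem k4)
    rwa [threeCyc_conj, threeCyc_apply_left hzx.symm k3,
      threeCyc_apply_of_ne hxy.symm hyz (Ne.symm hvy), threeCyc_apply_of_ne h3 huz huv] at this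

/-- Two permutations whose supports have exactly one point in common have a three-cycle as their
commutator. -/
theorem commutator_eq_threeCyc {f g : Perm α} (hf : f x ≠ x) (hg : g x ≠ x)
    (h : ∀ y, f y ≠ y → g y ≠ y → y = x) : f * g * f⁻¹ * g⁻¹ = threeCyc x (f x) (g x) := by
  have hfg : f x ≠ g x := fun h' =>
    hf (h (f x) (fun h2 => hf (f.injective h2)) (fun h2 => hg (g.injective (by rw [← h', h2]))))
  have hgf : ∀ w, f w ≠ w → w ≠ x → g w = w := fun w h1 h2 => by_contra fun h3 => h2 (h w h1 h3)
  have hfg' : ∀ w, g w ≠ w → w ≠ x → f w = w := fun w h1 h2 => by_contra fun h3 => h2 (h w h3 h1)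
  -- Away from x each permutation fixes the support of the other, so f g and (x, f x, g x) g f can
  -- be compared tile by tile.
  have key : f * g * f⁻¹ = threeCyc x (f x) (g x) * g := by
    rw [mul_inv_eq_iff_eq_mul]
    ext w
    simp only [Perm.mul_apply]
    by_cases hw : w = x
    · rw [hw, hgf (f x) (by simpa) hf, hfg' (g x) (by simpa) hg, threeCyc_apply_mid hfg hg]
    by_cases hfw : f w = w
    · rw [hfw]
      by_cases hgw : g w = w
      · rw [hgw, hfw, threeCyc_apply_of_ne hw]
        · exact fun h' => hw (f.injective (hfw.trans h'))
        · exact fun h' => hw (g.injective (hgw.trans h'))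
      by_cases hgx : g w = x
      · rw [hgx, threeCyc_apply_left hf.symm hg]
      · rw [hfg' (g w) (by simpa) hgx, threeCyc_apply_of_ne hgx]
        · intro h'
          rw [← hgf (f x) (by simpa) hf] at h'
          exact hw (f.injective (hfw.trans (g.injective h')))
        · exact fun h' => hw (g.injective h')
    · rw [hgf w hfw hw]
      by_cases hfx : f w = x
      · rw [hfx, threeCyc_apply_right]
      · rw [hgf (f w) (by simpa) hfx, threeCyc_apply_of_ne hfx]
        · exact fun h' => hw (f.injective h')
        · exact fun h' => hg (by simpa [h'] using hgf (f w) (by simpa) hfx)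
  rw [key, mul_inv_cancel_right]

theorem Linked.of_supports {f g : Perm α} (hfH : f ∈ H) (hgH : g ∈ H) (hf : f x ≠ x)
    (hg : g x ≠ x) (h : ∀ y, f y ≠ y → g y ≠ y → y = x) : Linked H x (f x) := by
  refine .of_mem hf.symm (z := g x) (fun h' => ?_) hg ?_
  · refine hf (h (f x) (fun h2 => hf (f.injective h2)) (fun h2 => hg (g.injective ?_)))
    rw [← h', h2]
  · rw [← commutator_eq_threeCyc hf hg h]
    exact H.mul_mem (H.mul_mem (H.mul_mem hfH hgH) (H.inv_mem hfH)) (H.inv_mem hgH)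

end Linked

/-! ### The puzzle group as a group of permutations of the whole grid -/

section GridGroup

variable {k : ℕ} {c d x y : Tile} {F F' : Finset Tile} {g : Perm Tile}

theorem blockRotation_apply (h : x ∈ rect k k c) :
    blockRotation k c x = (c.1 + (x.2 - c.2), c.2 + (k - 1 - (x.1 - c.1))) := by
  simp [blockRotation, h]

theorem blockRotation_apply_of_notMem (h : x ∉ rect k k c) : blockRotation k c x = x := by
  simp [blockRotation, h]

/-- The group of permutations of the grid generated by the rotations of the `k × k` blocks
contained in `F`. -/
def gridGroup (k : ℕ) (F : Finset Tile) : Subgroup (Perm Tile) :=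
  Subgroup.closure {g | ∃ c, rect k k c ⊆ F ∧ g = blockRotation k c}

theorem blockRotation_mem_gridGroup (h : rect k k c ⊆ F) : blockRotation k c ∈ gridGroup k F :=
  Subgroup.subset_closure ⟨c, h, rfl⟩

theorem gridGroup_mono (h : F ⊆ F') : gridGroup k F ≤ gridGroup k F' :=
  Subgroup.closure_mono fun _ ⟨c, hc, hg⟩ => ⟨c, hc.trans h, hg⟩

theorem gridGroup_apply_of_notMem (hg : g ∈ gridGroup k F) (hx : x ∉ F) : g x = x := by
  have h : gridGroup k F ≤ MulAction.stabilizer (Perm Tile) x := by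
    refine (Subgroup.closure_le _).2 ?_
    rintro _ ⟨c, hc, rfl⟩
    exact blockRotation_apply_of_notMem fun h => hx (hc h)
  exact h hg

theorem gridGroup_apply_mem_iff (hg : g ∈ gridGroup k F) : g x ∈ F ↔ x ∈ F := by
  by_cases hx : x ∈ F
  · refine iff_of_true (by_contra fun h => h ?_) hx
    rw [g.injective (gridGroup_apply_of_notMem hg h)]
    exact hx
  · rw [gridGroup_apply_of_notMem hg hx]

/-- Two tiles have the same color in the checkerboard shading. -/
def SameColor (x y : Tile) : Prop := Even (x.1 + x.2) ↔ Even (y.1 + y.2)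

theorem sameColor_iff : SameColor x y ↔ (x.1 + x.2 - (y.1 + y.2)) % 2 = 0 := by
  simp only [SameColor, Int.even_iff]
  omega

theorem SameColor.refl (x : Tile) : SameColor x x := Iff.rfl

theorem SameColor.symm (h : SameColor x y) : SameColor y x := Iff.symm h

theorem SameColor.trans {z : Tile} (h : SameColor x y) (h' : SameColor y z) : SameColor x z :=
  Iff.trans h h'

theorem SameColor.of_not {z : Tile} (h : ¬ SameColor x y) (h' : ¬ SameColor x z) :
    SameColor y z := by
  unfold SameColor at *; tauto

theorem blockRotation_sameColor (hk : Odd k) : SameColor (blockRotation k c x) x := by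
  by_cases h : x ∈ rect k k c
  · obtain ⟨m, rfl⟩ := hk
    rw [blockRotation_apply h, sameColor_iff]
    push_cast
    omega
  · rw [blockRotation_apply_of_notMem h]
    exact .refl x

theorem gridGroup_sameColor (hk : Odd k) (hg : g ∈ gridGroup k F) (x : Tile) :
    SameColor (g x) x := by
  induction hg using Subgroup.closure_induction generalizing x with
  | mem g hg =>
    obtain ⟨c, -, rfl⟩ := hg
    exact blockRotation_sameColor hk
  | one => exact .refl x
  | mul g h _ _ ihg ihh => exact (ihg (h x)).trans (ihh x)
  | inv g _ ih => simpa using (ih (g⁻¹ x)).symm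

/-- Permutation groups of nested figures live on different types. Extending by the identity to the
grid makes them comparable, and this is the way back. -/
theorem map_ofSubtype_puzzleGroup (k : ℕ) (F : Finset Tile) :
    (puzzleGroup k F).map (Perm.ofSubtype : Perm F →* Perm Tile) = gridGroup k F := by
  rw [puzzleGroup, MonoidHom.map_closure, gridGroup]
  congr 1
  have key : ∀ (c : Tile) (h : rect k k c ⊆ F),
      (Perm.ofSubtype : Perm F →* Perm Tile) (rotationOn h) = blockRotation k c := fun c h =>
    ofSubtype_subtypePerm _ fun x hx => by
      by_contra h'
      exact hx (blockRotation_apply_of_notMem fun h'' => h' (h h''))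
  ext g
  constructor
  · rintro ⟨_, ⟨c, h, rfl⟩, rfl⟩
    exact ⟨c, h, key c h⟩
  · rintro ⟨c, h, rfl⟩
    exact ⟨_, ⟨c, h, rfl⟩, key c h⟩

theorem ofSubtype_mem_gridGroup {g : Perm F} :
    (Perm.ofSubtype : Perm F →* Perm Tile) g ∈ gridGroup k F ↔ g ∈ puzzleGroup k F := by
  rw [← map_ofSubtype_puzzleGroup, Subgroup.mem_map_iff_mem ofSubtype_injective]

theorem exists_puzzleGroup_of_mem (hg : g ∈ gridGroup k F) :
    ∃ g' ∈ puzzleGroup k F, ∀ x : F, ((g' x : F) : Tile) = g x := by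
  rw [← map_ofSubtype_puzzleGroup] at hg
  obtain ⟨g', h, rfl⟩ := hg
  exact ⟨g', h, fun x => (ofSubtype_apply_coe g' x).symm⟩

end GridGroup

/-! ### Symmetries of the grid and reduction to one base rectangle -/

section GridIso

variable {k : ℕ} {ψ φ : Perm Tile} {F F' R : Finset Tile} {g : Perm Tile}

/-- A permutation of the grid that maps `k × k` blocks to such blocks, and rotations to
rotations, possibly reversing their direction. -/
def GridIso (k : ℕ) (ψ : Perm Tile) : Prop :=
  ∀ d, ∃ d', (∀ x, ψ x ∈ rect k k d' ↔ x ∈ rect k k d) ∧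
    (ψ * blockRotation k d * ψ⁻¹ = blockRotation k d' ∨
      ψ * blockRotation k d * ψ⁻¹ = (blockRotation k d')⁻¹)

theorem GridIso.mul (hψ : GridIso k ψ) (hφ : GridIso k φ) : GridIso k (ψ * φ) := by
  intro d
  obtain ⟨d', h1, h2⟩ := hφ d
  obtain ⟨e, h3, h4⟩ := hψ d'
  refine ⟨e, fun x => (h3 _).trans (h1 x), ?_⟩
  have h5 : ψ * φ * blockRotation k d * (ψ * φ)⁻¹ = ψ * (φ * blockRotation k d * φ⁻¹) * ψ⁻¹ := by
    group
  rw [h5]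
  rcases h2 with h2 | h2 <;> rcases h4 with h4 | h4 <;> rw [h2]
  · exact .inl h4
  · exact .inr h4
  · right; rw [← h4]; group
  · left; rw [← inv_inj, ← h4]; group

theorem gridIso_addLeft (k : ℕ) (c : Tile) : GridIso k (Equiv.addLeft c) := by
  intro d
  have h : ∀ x, Equiv.addLeft c x ∈ rect k k (c + d) ↔ x ∈ rect k k d := by
    intro x
    simp only [mem_rect, coe_addLeft, Prod.fst_add, Prod.snd_add]
    omega
  refine ⟨c + d, h, .inl ?_⟩
  rw [mul_inv_eq_iff_eq_mul]
  ext1 x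
  simp only [Perm.mul_apply]
  by_cases hx : x ∈ rect k k d
  · rw [blockRotation_apply hx, blockRotation_apply ((h x).2 hx)]
    ext <;> simp <;> ring
  · rw [blockRotation_apply_of_notMem hx, blockRotation_apply_of_notMem (mt (h x).1 hx)]

/-- Reflection in the diagonal reverses orientation, so clockwise rotations become their inverses.
-/
theorem gridIso_prodComm (k : ℕ) : GridIso k (Equiv.prodComm ℤ ℤ) := by
  intro d
  have h : ∀ x, Equiv.prodComm ℤ ℤ x ∈ rect k k d.swap ↔ x ∈ rect k k d := by
    intro x
    simp only [mem_rect, prodComm_apply, Prod.fst_swap, Prod.snd_swap]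
    tauto
  refine ⟨d.swap, h, .inr ?_⟩
  rw [mul_inv_eq_iff_eq_mul, eq_inv_mul_iff_mul_eq]
  ext1 x
  simp only [Perm.mul_apply]
  by_cases hx : x ∈ rect k k d
  · rw [blockRotation_apply, blockRotation_apply hx]
    · ext <;> simp
    · rw [h, blockRotation_apply hx]
      rw [mem_rect] at hx ⊢
      dsimp only
      omega
  · rw [blockRotation_apply_of_notMem hx, blockRotation_apply_of_notMem (mt (h x).1 hx)]

theorem GridIso.conj_mem (hψ : GridIso k ψ) (h : ∀ x ∈ F, ψ x ∈ F')
    (hg : g ∈ gridGroup k F) : ψ * g * ψ⁻¹ ∈ gridGroup k F' := by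
  have key : gridGroup k F ≤ (gridGroup k F').comap (MulAut.conj ψ).toMonoidHom := by
    refine (Subgroup.closure_le _).2 ?_
    rintro _ ⟨c, hc, rfl⟩
    obtain ⟨d, h1, h2⟩ := hψ c
    have h3 : blockRotation k d ∈ gridGroup k F' := by
      refine blockRotation_mem_gridGroup fun x hx => ?_
      have h4 := h1 (ψ⁻¹ x)
      have h5 := h (ψ⁻¹ x)
      rw [show ψ (ψ⁻¹ x) = x by simp] at h4 h5
      exact h5 (hc (h4.1 hx))
    change ψ * blockRotation k c * ψ⁻¹ ∈ gridGroup k F'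
    rcases h2 with h2 | h2 <;> rw [h2]
    · exact h3
    · exact Subgroup.inv_mem _ h3
  exact key hg

/-- The rectangle with `k` rows and `k + 1` columns whose upper left tile is the origin. -/
noncomputable def baseRect (k : ℕ) : Finset Tile := rect k (k + 1) (0, 0)

theorem mem_baseRect {k : ℕ} {x : Tile} :
    x ∈ baseRect k ↔ (0 ≤ x.1 ∧ x.1 < k) ∧ (0 ≤ x.2 ∧ x.2 < k + 1) := by
  simp [baseRect, mem_rect]

/-- `ψ` maps the base rectangle to `R`, together with the puzzle group and the shading. -/
structure IsPlacement (k : ℕ) (ψ : Perm Tile) (R : Finset Tile) : Prop where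
  mem_iff : ∀ x, ψ x ∈ R ↔ x ∈ baseRect k
  conj_mem_iff : ∀ g, ψ * g * ψ⁻¹ ∈ gridGroup k R ↔ g ∈ gridGroup k (baseRect k)
  sameColor_iff : ∀ x y, SameColor (ψ x) (ψ y) ↔ SameColor x y

theorem GridIso.isPlacement (hψ : GridIso k ψ) (hψ' : GridIso k ψ⁻¹)
    (h : ∀ x, ψ x ∈ R ↔ x ∈ baseRect k) (hc : ∀ x y, SameColor (ψ x) (ψ y) ↔ SameColor x y) :
    IsPlacement k ψ R := by
  refine ⟨h, fun g => ⟨fun hg => ?_, hψ.conj_mem fun x => (h x).2⟩, hc⟩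
  have := hψ'.conj_mem (F' := baseRect k) (fun x hx => (h _).1 (by simpa using hx)) hg
  convert this using 1
  group

/-- Translations, preceded by the diagonal reflection for the upright shape, reach every basic
rectangle. Hence all statements about one rectangle may be proved for `baseRect`. -/
theorem IsBasicRect.exists_isPlacement (hR : IsBasicRect k R) : ∃ ψ, IsPlacement k ψ R := by
  obtain ⟨c, rfl | rfl⟩ := hR
  · refine ⟨Equiv.addLeft c, (gridIso_addLeft k c).isPlacement ?_ ?_ ?_⟩
    · simpa using gridIso_addLeft k (-c)
    · intro x
      simp only [mem_rect, mem_baseRect, coe_addLeft, Prod.fst_add, Prod.snd_add]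
      push_cast
      omega
    · intro x y
      simp only [sameColor_iff, coe_addLeft, Prod.fst_add, Prod.snd_add]
      omega
  · refine ⟨Equiv.addLeft c * Equiv.prodComm ℤ ℤ,
      ((gridIso_addLeft k c).mul (gridIso_prodComm k)).isPlacement ?_ ?_ ?_⟩
    · have h : (Equiv.addLeft c * Equiv.prodComm ℤ ℤ)⁻¹ =
          Equiv.prodComm ℤ ℤ * Equiv.addLeft (-c) := by
        rw [mul_inv_rev]
        congr 1
        simp
      rw [h]
      exact (gridIso_prodComm k).mul (gridIso_addLeft k (-c))
    · intro x
      simp only [mem_rect, mem_baseRect, Perm.mul_apply, coe_addLeft, Prod.fst_add, Prod.snd_add,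
        prodComm_apply, Prod.fst_swap, Prod.snd_swap]
      push_cast
      omega
    · intro x y
      simp only [sameColor_iff, Perm.mul_apply, coe_addLeft, Prod.fst_add, Prod.snd_add,
        prodComm_apply, Prod.fst_swap, Prod.snd_swap]
      omega

end GridIso

/-! ### The sign of a permutation composed of four-cycles -/

section Sign

variable {α : Type*} [Fintype α] [DecidableEq α]

/-- The second hypothesis excludes two-cycles, so all nontrivial cycles have length four, and each
contributes a factor -1. -/
theorem sign_of_pow_four_eq_one {σ : Perm α} (h4 : σ ^ 4 = 1) (h2 : ∀ x, σ (σ x) = x → σ x = x) :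
    sign σ = (-1) ^ (σ.support.card / 4) := by
  have key : ∀ n ∈ σ.cycleType, n = 4 := by
    intro n hn
    have hd : n ∣ 4 := (dvd_of_mem_cycleType hn).trans (orderOf_dvd_of_pow_eq_one h4)
    have hle := two_le_of_mem_cycleType hn
    have hlt := Nat.le_of_dvd (by norm_num) hd
    have : n ≠ 2 := by
      rintro rfl
      obtain ⟨c, τ, hσ, hdis, hc, hcard⟩ := mem_cycleType_iff.1 hn
      obtain ⟨x, hx⟩ : c.support.Nonempty := Finset.card_pos.1 (by omega)
      have hcx : σ x = c x := by
        rw [hσ, hdis.commute.eq, Perm.mul_apply]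
        exact (hdis (c x)).resolve_left (by simpa using hx)
      have hccx : σ (c x) = c (c x) := by
        rw [hσ, hdis.commute.eq, Perm.mul_apply]
        exact (hdis (c (c x))).resolve_left (by simpa using hx)
      have hc2 : c (c x) = x := by
        have h := pow_orderOf_eq_one c
        rw [hc.orderOf, hcard, pow_two] at h
        simpa using DFunLike.congr_fun h x
      have h3 := h2 x (by rw [hcx, hccx, hc2])
      rw [hcx] at h3
      exact (mem_support.1 hx) h3
    interval_cases n <;> omega
  have hrep := Multiset.eq_replicate_card.2 key
  have hs : σ.support.card = 4 * Multiset.card σ.cycleType := by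
    rw [← σ.sum_cycleType, hrep]
    simp [mul_comm]
  rw [sign_of_cycleType, σ.sum_cycleType, hs, Nat.mul_div_cancel_left _ (by norm_num), pow_add,
    Even.neg_one_pow ⟨2 * Multiset.card σ.cycleType, by ring⟩, one_mul]

end Sign

/-! ### The sign of a block rotation, in total and on each color -/

section BlockSign

variable {k : ℕ} {c x : Tile}

theorem blockRotation_mem (h : x ∈ rect k k c) : blockRotation k c x ∈ rect k k c :=
  (blockRotation_mem_iff subset_rfl x).2 h

theorem blockRotation_blockRotation (h : x ∈ rect k k c) :
    blockRotation k c (blockRotation k c x) =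
      (c.1 + (k - 1 - (x.1 - c.1)), c.2 + (k - 1 - (x.2 - c.2))) := by
  rw [blockRotation_apply (blockRotation_mem h), blockRotation_apply h]
  ext <;> simp

theorem blockRotation_pow_four (k : ℕ) (c : Tile) : blockRotation k c ^ 4 = 1 := by
  ext1 x
  simp only [pow_succ, pow_zero, one_mul, Perm.mul_apply, Perm.one_apply]
  by_cases h : x ∈ rect k k c
  · have h' := blockRotation_mem (blockRotation_mem h)
    rw [blockRotation_blockRotation h', blockRotation_blockRotation h]
    ext <;> simp
  · simp only [blockRotation_apply_of_notMem h]

theorem blockRotation_apply_eq_self_iff (h : x ∈ rect k k c) :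
    blockRotation k c x = x ↔ 2 * (x.1 - c.1) = k - 1 ∧ 2 * (x.2 - c.2) = k - 1 := by
  rw [blockRotation_apply h, Prod.ext_iff]
  dsimp only
  omega

theorem blockRotation_eq_of_sq (h : blockRotation k c (blockRotation k c x) = x) :
    blockRotation k c x = x := by
  by_cases hx : x ∈ rect k k c
  · rw [blockRotation_blockRotation hx, Prod.ext_iff] at h
    rw [blockRotation_apply_eq_self_iff hx]
    dsimp only at h
    omega
  · exact blockRotation_apply_of_notMem hx

/-- The embedding `i` and the predicate `p` allow one statement to serve both the whole figure and a
single color class. -/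
theorem sign_of_semiconj_blockRotation {α : Type*} [Fintype α] [DecidableEq α] (i : α ↪ Tile)
    {σ : Perm α} (h : ∀ a, i (σ a) = blockRotation k c (i a)) (p : Tile → Prop) [DecidablePred p]
    (hp : ∀ x ∈ rect k k c, p x ↔ ∃ a, i a = x) :
    sign σ = (-1) ^ (((rect k k c).filter fun x => p x ∧ blockRotation k c x ≠ x).card / 4) := by
  have h4 : σ ^ 4 = 1 := by
    ext1 a
    apply i.injective
    have := DFunLike.congr_fun (blockRotation_pow_four k c) (i a)
    simp only [pow_succ, pow_zero, one_mul, Perm.mul_apply, Perm.one_apply] at this ⊢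
    simp only [h, this]
  rw [sign_of_pow_four_eq_one h4]
  · congr 2
    rw [← Finset.card_map i]
    congr 1
    ext x
    simp only [Finset.mem_map, mem_support, Finset.mem_filter]
    constructor
    · rintro ⟨a, ha, rfl⟩
      have h1 : blockRotation k c (i a) ≠ i a := by
        rw [← h]
        exact fun h' => ha (i.injective h')
      have h2 : i a ∈ rect k k c := by_contra fun h' => h1 (blockRotation_apply_of_notMem h')
      exact ⟨h2, (hp _ h2).2 ⟨a, rfl⟩, h1⟩
    · rintro ⟨h1, h2, h3⟩
      obtain ⟨a, rfl⟩ := (hp x h1).1 h2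
      exact ⟨a, fun h' => h3 (by rw [← h, h']), rfl⟩
  · intro a ha
    apply i.injective
    rw [h]
    refine blockRotation_eq_of_sq ?_
    rw [← h, ← h, ha]

theorem card_rect (h w : ℕ) (c : Tile) : (rect h w c).card = h * w := by
  simp [rect]

theorem sum_Ico_negOnePow (hk : Odd k) (a : ℤ) :
    ∑ i ∈ Finset.Ico a (a + k), (i.negOnePow : ℤ) = a.negOnePow := by
  obtain ⟨m, rfl⟩ := hk
  induction m with
  | zero =>
    have : Finset.Ico a (a + 1) = {a} := by ext; simp; omega
    simp [this]
  | succ m ih =>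
    have : Finset.Ico a (a + (2 * (m + 1) + 1 : ℕ)) =
        insert (a + 2 * m + 2) (insert (a + 2 * m + 1) (Finset.Ico a (a + (2 * m + 1 : ℕ)))) := by
      ext x; simp; omega
    rw [this, Finset.sum_insert (by simp; omega), Finset.sum_insert (by simp; omega), ih,
      show a + 2 * m + 2 = a + 2 * m + 1 + 1 by ring, Int.negOnePow_succ (a + 2 * m + 1)]
    simp

/-- For odd k only the center of the block is fixed. The sum of the color signs ±1 over the block is
the sign of its corner, which is also that of the center, so without the center both colors occur
equally often. -/
theorem card_filter_color (hk : Odd k) (c : Tile) :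
    ((rect k k c).filter fun x => Even (x.1 + x.2) ∧ blockRotation k c x ≠ x).card =
        (k ^ 2 - 1) / 2 ∧
      ((rect k k c).filter fun x => ¬ Even (x.1 + x.2) ∧ blockRotation k c x ≠ x).card =
        (k ^ 2 - 1) / 2 := by
  obtain ⟨m, rfl⟩ := hk
  set k := 2 * m + 1 with hkm
  have hk : Odd k := ⟨m, rfl⟩
  set D := (rect k k c).erase (c.1 + m, c.2 + m) with hD
  have hc : ((c.1 + m, c.2 + m) : Tile) ∈ rect k k c := by
    rw [mem_rect]; dsimp only; omega
  have hcard : D.card = k ^ 2 - 1 := by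
    rw [hD, Finset.card_erase_of_mem hc, card_rect, sq]
  have hsum : ∑ x ∈ D, ((x.1 + x.2).negOnePow : ℤ) = 0 := by
    have h1 : ∑ x ∈ rect k k c, ((x.1 + x.2).negOnePow : ℤ) = (c.1 + c.2).negOnePow := by
      rw [rect, Finset.sum_product]
      simp only [Int.negOnePow_add, Units.val_mul, ← Finset.mul_sum, ← Finset.sum_mul,
        sum_Ico_negOnePow hk]
    have h2 := Finset.add_sum_erase _ (fun x : Tile => ((x.1 + x.2).negOnePow : ℤ)) hc
    have h3 : (c.1 + (m : ℤ) + (c.2 + m)).negOnePow = (c.1 + c.2).negOnePow := by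
      rw [show c.1 + (m : ℤ) + (c.2 + m) = c.1 + c.2 + (m + m) by ring, Int.negOnePow_add,
        Int.negOnePow_even (m + m) ⟨m, rfl⟩, mul_one]
    rw [h1] at h2
    simp only [h3] at h2
    exact add_left_cancel (h2.trans (add_zero _).symm)
  have hfilter : ∀ (p : Tile → Prop) [DecidablePred p],
      ((rect k k c).filter fun x => p x ∧ blockRotation k c x ≠ x) = D.filter p := by
    intro p _
    ext x
    simp only [Finset.mem_filter, hD, Finset.mem_erase]
    by_cases hx : x ∈ rect k k c
    · have : blockRotation k c x ≠ x ↔ x ≠ (c.1 + m, c.2 + m) := by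
        rw [Ne, blockRotation_apply_eq_self_iff hx, Ne, Prod.ext_iff]
        dsimp only
        omega
      rw [this]; tauto
    · tauto
  rw [hfilter, hfilter]
  have h1 := Finset.card_filter_add_card_filter_not (s := D) (fun x => Even (x.1 + x.2))
  rw [hcard] at h1
  rw [← Finset.sum_filter_add_sum_filter_not D (fun x => Even (x.1 + x.2)),
    Finset.sum_congr rfl (g := fun _ => 1) fun x hx => by
      rw [Int.negOnePow_even _ (Finset.mem_filter.1 hx).2]; rfl,
    Finset.sum_congr (s₂ := D.filter fun x => ¬ Even (x.1 + x.2)) rfl (g := fun _ => -1) fun x hx => by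
      rw [Int.negOnePow_odd _ (Int.not_even_iff_odd.1 (Finset.mem_filter.1 hx).2)]; rfl] at hsum
  simp only [Finset.sum_const, nsmul_eq_mul] at hsum
  omega

end BlockSign

/-! ### From linked tiles to the exact group -/

section Reduction

variable {k : ℕ} {F : Finset Tile}

/-- Any two tiles of `F` (of the same color, if `k` is odd) are linked by the puzzle group. -/
def IsLinked (k : ℕ) (F : Finset Tile) : Prop :=
  ∀ x ∈ F, ∀ y ∈ F, (Odd k → SameColor x y) → Linked (gridGroup k F) x y

/-- Three-cycles generate the alternating group, and each one is mapped into H because its points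
are linked there. The maps `i` and `f` cover the whole figure as well as each factor of the color
decomposition. -/
theorem alternatingGroup_le_comap {α β : Type*} [Fintype α] [DecidableEq α] [DecidableEq β]
    {H : Subgroup (Perm β)} (i : α → β) (hi : Function.Injective i) (f : Perm α →* Perm β)
    (hf : ∀ a b, f (swap a b) = swap (i a) (i b)) (h : ∀ a b, Linked H (i a) (i b)) :
    alternatingGroup α ≤ H.comap f := by
  rw [← closure_three_cycles_eq_alternating, Subgroup.closure_le]
  intro σ hσ
  have hσ' : IsThreeCycle σ := hσ
  obtain ⟨a, ha⟩ : σ.support.Nonempty := Finset.card_pos.1 (by rw [hσ'.card_support]; norm_num)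
  have h1 := hσ'.eq_swap_mul_swap_iff_mem_support.2 ha
  have h2 := hσ'.nodup_iff_mem_support.2 ha
  simp only [List.nodup_cons, List.mem_cons, List.not_mem_nil, or_false, not_or] at h2
  change f σ ∈ H
  rw [h1, map_mul, hf, hf]
  exact threeCyc_mem_of_linked (hi.ne h2.1.1) (hi.ne h2.2.1) (hi.ne (Ne.symm h2.1.2)) (h _ _)
    (h _ _)

theorem alternatingGroup_le_puzzleGroup (hk : Even k) (h : IsLinked k F) :
    alternatingGroup F ≤ puzzleGroup k F := by
  have := alternatingGroup_le_comap (H := gridGroup k F) (fun a : F => (a : Tile))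
    Subtype.val_injective Perm.ofSubtype (fun a b => ofSubtype_swap_eq a b)
    fun a b => h a a.2 b b.2 fun hk' => absurd hk (Nat.not_even_iff_odd.2 hk')
  exact fun g hg => ofSubtype_mem_gridGroup.1 (this hg)

theorem subtypeCongrHom_swap_one {α : Type*} [DecidableEq α] (p : α → Prop) [DecidablePred p]
    (a b : {x // p x}) : subtypeCongrHom p (swap a b, 1) = swap (a : α) b := by
  ext x
  simp only [subtypeCongrHom_apply, Perm.subtypeCongr.apply]
  split_ifs with h
  · simp only [swap_apply_def, Subtype.ext_iff]
    split_ifs <;> rfl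
  · have ha : x ≠ a := by rintro rfl; exact h a.2
    have hb : x ≠ b := by rintro rfl; exact h b.2
    rw [swap_apply_of_ne_of_ne ha hb]
    rfl

theorem subtypeCongrHom_one_swap {α : Type*} [DecidableEq α] (p : α → Prop) [DecidablePred p]
    (a b : {x // ¬ p x}) : subtypeCongrHom p (1, swap a b) = swap (a : α) b := by
  ext x
  simp only [subtypeCongrHom_apply, Perm.subtypeCongr.apply]
  split_ifs with h
  · have ha : x ≠ a := by rintro rfl; exact a.2 h
    have hb : x ≠ b := by rintro rfl; exact b.2 h
    rw [swap_apply_of_ne_of_ne ha hb]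
    rfl
  · simp only [swap_apply_def, Subtype.ext_iff]
    split_ifs <;> rfl

theorem altProd_le_puzzleGroup (h : IsLinked k F) : altProd F ≤ puzzleGroup k F := by
  rw [altProd, Subgroup.map_le_iff_le_comap]
  have key : ∀ q : Perm {x // Black F x} × Perm {x // ¬ Black F x},
      Perm.ofSubtype (subtypeCongrHom (Black F) q) ∈ gridGroup k F →
        q ∈ (puzzleGroup k F).comap (subtypeCongrHom (Black F)) :=
    fun q hq => ofSubtype_mem_gridGroup.1 hq
  have h1 := alternatingGroup_le_comap (H := gridGroup k F)
    (fun a : {x // Black F x} => ((a : F) : Tile))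
    (Subtype.val_injective.comp Subtype.val_injective)
    ((Perm.ofSubtype.comp (subtypeCongrHom (Black F))).comp (MonoidHom.inl _ _))
    (fun a b => by
      simp only [MonoidHom.comp_apply, MonoidHom.inl_apply, subtypeCongrHom_swap_one]
      exact ofSubtype_swap_eq _ _)
    fun a b => h a a.1.2 b b.1.2 fun _ => iff_of_true a.2 b.2
  have h2 := alternatingGroup_le_comap (H := gridGroup k F)
    (fun a : {x // ¬ Black F x} => ((a : F) : Tile))
    (Subtype.val_injective.comp Subtype.val_injective)
    ((Perm.ofSubtype.comp (subtypeCongrHom (Black F))).comp (MonoidHom.inr _ _))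
    (fun a b => by
      simp only [MonoidHom.comp_apply, MonoidHom.inr_apply, subtypeCongrHom_one_swap]
      exact ofSubtype_swap_eq _ _)
    fun a b => h a a.1.2 b b.1.2 fun _ => iff_of_false a.2 b.2
  rintro ⟨p, q⟩ ⟨hp, hq⟩
  have : (p, q) = (p, 1) * (1, q) := by simp
  rw [this]
  exact mul_mem (key _ (h1 hp)) (key _ (h2 hq))

variable {c : Tile}

theorem sign_rotationOn (hk : Even k) (h : rect k k c ⊆ F) :
    sign (rotationOn h) = (-1) ^ (k * k / 4) := by
  rw [sign_of_semiconj_blockRotation (Function.Embedding.subtype (· ∈ F)) (c := c) (k := k)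
    (fun _ => rfl) (fun _ => True) fun x hx => iff_of_true trivial ⟨⟨x, h hx⟩, rfl⟩, ← card_rect k k c]
  congr 3
  refine Finset.filter_true_of_mem fun x hx => ⟨trivial, ?_⟩
  rw [Ne, blockRotation_apply_eq_self_iff hx]
  obtain ⟨m, rfl⟩ := hk
  push_cast
  omega

/-- Both colors lose the same number (k²-1)/2 of moved tiles to four-cycles, so the two components
have the same sign. -/
theorem exists_rotationOn_eq (hk : Odd k) (h : rect k k c ⊆ F) :
    ∃ p q, rotationOn h = subtypeCongrHom (Black F) (p, q) ∧
      sign p = (-1) ^ ((k ^ 2 - 1) / 2 / 4) ∧ sign q = (-1) ^ ((k ^ 2 - 1) / 2 / 4) := by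
  have hB : ∀ x, Black F (rotationOn h x) ↔ Black F x := fun x => blockRotation_sameColor hk
  refine ⟨(rotationOn h).subtypePerm hB, (rotationOn h).subtypePerm fun x => not_congr (hB x),
    ?_, ?_, ?_⟩
  · ext1 x
    simp only [subtypeCongrHom_apply, Perm.subtypeCongr.apply]
    split_ifs <;> rfl
  · rw [← (card_filter_color hk c).1]
    refine sign_of_semiconj_blockRotation (k := k) (c := c) (σ := (rotationOn h).subtypePerm hB)
      ((Function.Embedding.subtype (Black F)).trans (Function.Embedding.subtype (· ∈ F)))
      (fun _ => rfl) (fun x => Even (x.1 + x.2)) fun x hx => ⟨fun hx' => ?_, ?_⟩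
    · exact ⟨⟨⟨x, h hx⟩, hx'⟩, rfl⟩
    · rintro ⟨a, rfl⟩
      exact a.2
  · rw [← (card_filter_color hk c).2]
    refine sign_of_semiconj_blockRotation (k := k) (c := c)
      (σ := (rotationOn h).subtypePerm fun x => not_congr (hB x))
      ((Function.Embedding.subtype fun x => ¬ Black F x).trans (Function.Embedding.subtype (· ∈ F)))
      (fun _ => rfl) (fun x => ¬ Even (x.1 + x.2)) fun x hx => ⟨fun hx' => ?_, ?_⟩
    · exact ⟨⟨⟨x, h hx⟩, hx'⟩, rfl⟩
    · rintro ⟨a, rfl⟩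
      exact a.2

theorem puzzleGroup_eq_alternatingGroup (hk : k % 4 = 0) (h : IsLinked k F) :
    puzzleGroup k F = alternatingGroup F := by
  have hk2 : Even k := Nat.even_iff.2 (by omega)
  refine le_antisymm ?_ (alternatingGroup_le_puzzleGroup hk2 h)
  refine (Subgroup.closure_le _).2 ?_
  rintro _ ⟨c, hc, rfl⟩
  rw [SetLike.mem_coe, mem_alternatingGroup, sign_rotationOn hk2 hc]
  obtain ⟨m, rfl⟩ : ∃ m, k = 4 * m := ⟨k / 4, by omega⟩
  rw [show 4 * m * (4 * m) / 4 = 4 * (m * m) by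
    rw [show 4 * m * (4 * m) = 4 * (4 * (m * m)) by ring]; omega]
  exact Even.neg_one_pow ⟨2 * (m * m), by ring⟩

/-- Here k²/4 is odd, so a rotation is an odd permutation, and together with the alternating group
it generates everything. -/
theorem puzzleGroup_eq_top (hk : k % 4 = 2) (h : IsLinked k F) (hF : ∃ c, rect k k c ⊆ F) :
    puzzleGroup k F = ⊤ := by
  have hk2 : Even k := Nat.even_iff.2 (by omega)
  have hA := alternatingGroup_le_puzzleGroup hk2 h
  obtain ⟨c, hc⟩ := hF
  have hr : rotationOn hc ∈ puzzleGroup k F := Subgroup.subset_closure ⟨c, hc, rfl⟩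
  have hs : sign (rotationOn hc) = -1 := by
    rw [sign_rotationOn hk2 hc]
    obtain ⟨m, rfl⟩ : ∃ m, k = 4 * m + 2 := ⟨k / 4, by omega⟩
    rw [show (4 * m + 2) * (4 * m + 2) / 4 = 2 * (2 * (m * m + m)) + 1 by
      rw [show (4 * m + 2) * (4 * m + 2) = 4 * (2 * (2 * (m * m + m)) + 1) by ring]; omega]
    exact Odd.neg_one_pow ⟨_, rfl⟩
  refine eq_top_iff.2 fun g _ => ?_
  rcases Int.units_eq_one_or (sign g) with hg | hg
  · exact hA (mem_alternatingGroup.2 hg)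
  · have : g * rotationOn hc ∈ puzzleGroup k F :=
      hA (mem_alternatingGroup.2 (by rw [map_mul, hg, hs]; rfl))
    exact (Subgroup.mul_mem_cancel_right _ hr).1 this

theorem puzzleGroup_eq_altProd (hk : k % 8 = 1 ∨ k % 8 = 7) (h : IsLinked k F) :
    puzzleGroup k F = altProd F := by
  have hk2 : Odd k := Nat.odd_iff.2 (by omega)
  refine le_antisymm ?_ (altProd_le_puzzleGroup h)
  refine (Subgroup.closure_le _).2 ?_
  rintro _ ⟨c, hc, rfl⟩
  obtain ⟨p, q, hpq, hp, hq⟩ := exists_rotationOn_eq hk2 hc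
  -- For k ≡ ±1 mod 8 one has k² ≡ 1 mod 16, so (k²-1)/8 is even.
  have hs : (-1 : ℤˣ) ^ ((k ^ 2 - 1) / 2 / 4) = 1 := by
    apply Even.neg_one_pow
    rcases hk with hk | hk
    · obtain ⟨m, rfl⟩ : ∃ m, k = 8 * m + 1 := ⟨k / 8, by omega⟩
      rw [show (8 * m + 1) ^ 2 = 16 * (4 * m * m + m) + 1 by ring, Nat.even_iff]
      omega
    · obtain ⟨m, rfl⟩ : ∃ m, k = 8 * m + 7 := ⟨k / 8, by omega⟩
      rw [show (8 * m + 7) ^ 2 = 16 * (4 * m * m + 7 * m + 3) + 1 by ring, Nat.even_iff]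
      omega
  rw [hpq]
  exact ⟨(p, q), ⟨mem_alternatingGroup.2 (hp.trans hs), mem_alternatingGroup.2 (hq.trans hs)⟩, rfl⟩

theorem coe_evenSymProd (F : Finset Tile) :
    (evenSymProd F : Set (Perm F)) = (altProd F : Set (Perm F)) ∪ oddOddProd F := by
  ext g
  constructor
  · rintro ⟨⟨⟨p, q⟩, rfl⟩, hg⟩
    have hs : sign p * sign q = 1 := by
      have := mem_alternatingGroup.1 hg
      rwa [subtypeCongrHom_apply, sign_subtypeCongr] at this
    rcases Int.units_eq_one_or (sign p) with hp | hp
    · rw [hp, one_mul] at hs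
      exact .inl ⟨(p, q), ⟨mem_alternatingGroup.2 hp, mem_alternatingGroup.2 hs⟩, rfl⟩
    · have hq : sign q ≠ 1 := by
        intro hq
        rw [hp, hq] at hs
        exact absurd hs (by decide)
      exact .inr ⟨(p, q), ⟨mt mem_alternatingGroup.1 (by rw [hp]; decide),
        mt mem_alternatingGroup.1 hq⟩, rfl⟩
  · rintro (⟨⟨p, q⟩, ⟨hp, hq⟩, rfl⟩ | ⟨⟨p, q⟩, ⟨hp, hq⟩, rfl⟩)
    · refine ⟨⟨_, rfl⟩, mem_alternatingGroup.2 ?_⟩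
      rw [subtypeCongrHom_apply, sign_subtypeCongr, mem_alternatingGroup.1 hp,
        mem_alternatingGroup.1 hq, one_mul]
    · refine ⟨⟨_, rfl⟩, mem_alternatingGroup.2 ?_⟩
      rw [mem_alternatingGroup] at hp hq
      rw [subtypeCongrHom_apply, sign_subtypeCongr, (Int.units_eq_one_or _).resolve_left hp,
        (Int.units_eq_one_or _).resolve_left hq]
      rfl

theorem puzzleGroup_eq_evenSymProd (hk : k % 8 = 3 ∨ k % 8 = 5) (h : IsLinked k F)
    (hF : ∃ c, rect k k c ⊆ F) : puzzleGroup k F = evenSymProd F := by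
  have hk2 : Odd k := Nat.odd_iff.2 (by omega)
  have hA := altProd_le_puzzleGroup h
  -- For k ≡ ±3 mod 8 one has k² ≡ 9 mod 16, so (k²-1)/8 is odd.
  have hs : (-1 : ℤˣ) ^ ((k ^ 2 - 1) / 2 / 4) = -1 := by
    apply Odd.neg_one_pow
    rcases hk with hk | hk
    · obtain ⟨m, rfl⟩ : ∃ m, k = 8 * m + 3 := ⟨k / 8, by omega⟩
      rw [show (8 * m + 3) ^ 2 = 16 * (4 * m * m + 3 * m) + 9 by ring, Nat.odd_iff]
      omega
    · obtain ⟨m, rfl⟩ : ∃ m, k = 8 * m + 5 := ⟨k / 8, by omega⟩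
      rw [show (8 * m + 5) ^ 2 = 16 * (4 * m * m + 5 * m + 1) + 9 by ring, Nat.odd_iff]
      omega
  refine le_antisymm ((Subgroup.closure_le _).2 ?_) ?_
  · rintro _ ⟨c, hc, rfl⟩
    obtain ⟨p, q, hpq, hp, hq⟩ := exists_rotationOn_eq hk2 hc
    rw [coe_evenSymProd, hpq]
    refine .inr ⟨(p, q), ⟨?_, ?_⟩, rfl⟩ <;> rw [mem_alternatingGroup]
    · rw [hp, hs]; decide
    · rw [hq, hs]; decide
  · obtain ⟨c, hc⟩ := hF
    obtain ⟨p, q, hpq, hp, hq⟩ := exists_rotationOn_eq hk2 hc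
    have hr : rotationOn hc ∈ puzzleGroup k F := Subgroup.subset_closure ⟨c, hc, rfl⟩
    intro g hg
    rw [← SetLike.mem_coe, coe_evenSymProd] at hg
    rcases hg with hg | ⟨⟨p', q'⟩, ⟨hp', hq'⟩, rfl⟩
    · exact hA hg
    · rw [mem_alternatingGroup] at hp' hq'
      refine (Subgroup.mul_mem_cancel_right _ hr).1 (hA ?_)
      rw [hpq, ← map_mul]
      refine ⟨_, ⟨mem_alternatingGroup.2 ?_, mem_alternatingGroup.2 ?_⟩, rfl⟩
      · change sign (p' * p) = 1
        rw [map_mul, (Int.units_eq_one_or _).resolve_left hp', hp, hs]; rfl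
      · change sign (q' * q) = 1
        rw [map_mul, (Int.units_eq_one_or _).resolve_left hq', hq, hs]; rfl

end Reduction

/-! ### The two generators on the base rectangle and invariant relations -/

section Base

variable {k : ℕ} {x : Tile}

/-- The rotation of the left block of the base rectangle. -/
noncomputable def rotA (k : ℕ) : Perm Tile := blockRotation k (0, 0)

/-- The rotation of the right block of the base rectangle. -/
noncomputable def rotB (k : ℕ) : Perm Tile := blockRotation k (0, 1)

theorem rotA_mem (k : ℕ) : rotA k ∈ gridGroup k (baseRect k) := by
  refine blockRotation_mem_gridGroup fun x hx => ?_
  rw [mem_rect] at hx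
  rw [mem_baseRect]
  dsimp only at hx
  omega

theorem rotB_mem (k : ℕ) : rotB k ∈ gridGroup k (baseRect k) := by
  refine blockRotation_mem_gridGroup fun x hx => ?_
  rw [mem_rect] at hx
  rw [mem_baseRect]
  dsimp only at hx
  omega

theorem gridGroup_baseRect (hk : 0 < k) :
    gridGroup k (baseRect k) = Subgroup.closure {rotA k, rotB k} := by
  refine le_antisymm ((Subgroup.closure_le _).2 ?_) ((Subgroup.closure_le _).2 ?_)
  · rintro _ ⟨c, hc, rfl⟩
    have h1 : c ∈ baseRect k := hc (by rw [mem_rect]; omega)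
    have h2 : c + ((k : ℤ) - 1, (k : ℤ) - 1) ∈ baseRect k :=
      hc (by rw [mem_rect, Prod.fst_add, Prod.snd_add]; omega)
    rw [mem_baseRect] at h1 h2
    simp only [Prod.fst_add, Prod.snd_add] at h2
    have h3 : c.1 = 0 := by omega
    rcases (by omega : c.2 = 0 ∨ c.2 = 1) with h4 | h4
    · rw [show c = (0, 0) from Prod.ext h3 h4]
      exact Subgroup.subset_closure (Set.mem_insert _ _)
    · rw [show c = (0, 1) from Prod.ext h3 h4]
      exact Subgroup.subset_closure (Set.mem_insert_of_mem _ rfl)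
  · rintro g (rfl | rfl)
    · exact rotA_mem k
    · exact rotB_mem k

theorem rotA_apply (h1 : 0 ≤ x.1) (h2 : x.1 < k) (h3 : 0 ≤ x.2) (h4 : x.2 < k) :
    rotA k x = (x.2, k - 1 - x.1) := by
  rw [rotA, blockRotation_apply (by rw [mem_rect]; dsimp only; omega)]
  ext <;> simp

theorem rotA_apply_of_le (h : k ≤ x.2) : rotA k x = x :=
  blockRotation_apply_of_notMem (by rw [mem_rect]; dsimp only; omega)

theorem rotB_apply (h1 : 0 ≤ x.1) (h2 : x.1 < k) (h3 : 1 ≤ x.2) (h4 : x.2 ≤ k) :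
    rotB k x = (x.2 - 1, k - x.1) := by
  rw [rotB, blockRotation_apply (by rw [mem_rect]; dsimp only; omega)]
  ext <;> dsimp only <;> ring

theorem rotB_apply_of_le (h : x.2 ≤ 0) : rotB k x = x :=
  blockRotation_apply_of_notMem (by rw [mem_rect]; dsimp only; omega)

theorem rotA_cases (h : x ∈ baseRect k) :
    (x.2 < k ∧ (rotA k x).1 = x.2 ∧ (rotA k x).2 = k - 1 - x.1) ∨
      (x.2 = k ∧ (rotA k x).1 = x.1 ∧ (rotA k x).2 = x.2) := by
  rw [mem_baseRect] at h
  by_cases h' : x.2 < k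
  · left; rw [rotA_apply] <;> tauto
  · right; rw [rotA_apply_of_le] <;> omega

theorem rotB_cases (h : x ∈ baseRect k) :
    (1 ≤ x.2 ∧ (rotB k x).1 = x.2 - 1 ∧ (rotB k x).2 = k - x.1) ∨
      (x.2 = 0 ∧ (rotB k x).1 = x.1 ∧ (rotB k x).2 = x.2) := by
  rw [mem_baseRect] at h
  by_cases h' : 1 ≤ x.2
  · left; rw [rotB_apply] <;> first | tauto | omega
  · right; rw [rotB_apply_of_le] <;> omega

/-- Diagonal steps lead from any tile to the first column, and there two of them through the second
column change the row by two. Only the parity of the coordinate sum survives. -/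
theorem iff_of_diagonal_moves (hk : 2 ≤ k) (P : Tile → Prop)
    (h1 : ∀ i j : ℤ, 0 ≤ i → i + 1 < k → 0 ≤ j → j < k → (P (i, j) ↔ P (i + 1, j + 1)))
    (h2 : ∀ i j : ℤ, 0 ≤ i → i + 1 < k → 0 ≤ j → j < k → (P (i + 1, j) ↔ P (i, j + 1)))
    (hx : x ∈ baseRect k) : P x ↔ P ((x.1 + x.2) % 2, 0) := by
  have key : ∀ j : ℕ, ∀ i : ℕ, i < k → j ≤ k → (P (i, j) ↔ P (((i : ℤ) + j) % 2, 0)) := by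
    intro j
    induction j with
    | zero =>
      intro i
      induction i using Nat.strong_induction_on with
      | _ i ih =>
        intro hi _
        by_cases hi2 : i < 2
        · rw [show ((i : ℤ) + (0 : ℕ)) % 2 = i by omega]
          simp
        · obtain ⟨m, rfl⟩ : ∃ m, i = m + 2 := ⟨i - 2, by omega⟩
          have h3 := ih m (by omega) (by omega) (by omega)
          have h4 := h2 (m + 1) 0 (by omega) (by omega) (by omega) (by omega)
          have h5 := h1 m 0 (by omega) (by omega) (by omega) (by omega)
          rw [show (((m + 2 : ℕ) : ℤ) + (0 : ℕ)) % 2 = ((m : ℤ) + (0 : ℕ)) % 2 by omega, ← h3]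
          push_cast
          rw [show (m : ℤ) + 2 = m + 1 + 1 by ring]
          exact h4.trans h5.symm
    | succ j ih =>
      intro i hi hj
      rcases i with _ | i
      · have h3 := h2 0 j (by omega) (by omega) (by omega) (by omega)
        have h4 := ih 1 (by omega) (by omega)
        push_cast at h4 ⊢
        rw [zero_add] at h3 ⊢
        rw [← h3, h4, add_comm]
      · have h3 := h1 i j (by omega) (by omega) (by omega) (by omega)
        have h4 := ih i (by omega) (by omega)
        push_cast
        rw [← h3, h4, show ((i : ℤ) + 1 + (j + 1)) % 2 = (i + j) % 2 by omega]
  rw [mem_baseRect] at hx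
  obtain ⟨⟨hx1, hx2⟩, hx3, hx4⟩ := hx
  have := key x.2.toNat x.1.toNat (by omega) (by omega)
  rwa [Int.toNat_of_nonneg hx1, Int.toNat_of_nonneg hx3] at this

/-- An invariant equivalence relation that relates a tile of the first column to a tile of the
last column relates all tiles of the base rectangle, or all those of the same color. -/
theorem rel_of_invariant (hk : 2 ≤ k) {r : Tile → Tile → Prop} (hr : Equivalence r)
    (hA : ∀ x y, r x y → r (rotA k x) (rotA k y)) (hB : ∀ x y, r x y → r (rotB k x) (rotB k y))
    {u v : Tile} (hu : u ∈ baseRect k) (hu0 : u.2 = 0) (hvk : v.2 = k)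
    (huv : r u v) (hx : x ∈ baseRect k) (hxu : Odd k → SameColor x u) : r x u := by
  -- The rotation `rotA` fixes v, hence preserves the class of v, which is also the class of u;
  -- likewise `rotB` fixes u. So this class is invariant under both generators.
  have pA : ∀ x, r x u → r (rotA k x) u := by
    intro x hx
    have h1 := hA _ _ huv
    rw [rotA_apply_of_le hvk.ge] at h1
    exact hr.trans (hA _ _ hx) (hr.trans h1 (hr.symm huv))
  have pB : ∀ x, r x u → r (rotB k x) u := by
    intro x hx
    have h1 := hB _ _ hx
    rwa [rotB_apply_of_le hu0.le] at h1
  have pA' : ∀ x, r x u ↔ r (rotA k x) u := by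
    refine fun x => ⟨pA x, fun h => ?_⟩
    have := DFunLike.congr_fun (blockRotation_pow_four k (0, 0)) x
    have h' := pA _ (pA _ (pA _ h))
    simp only [pow_succ, pow_zero, one_mul, Perm.mul_apply, Perm.one_apply] at this
    rwa [rotA, this] at h'
  have pB' : ∀ x, r x u ↔ r (rotB k x) u := by
    refine fun x => ⟨pB x, fun h => ?_⟩
    have := DFunLike.congr_fun (blockRotation_pow_four k (0, 1)) x
    have h' := pB _ (pB _ (pB _ h))
    simp only [pow_succ, pow_zero, one_mul, Perm.mul_apply, Perm.one_apply] at this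
    rwa [rotB, this] at h'
  -- The two rotations differ by a diagonal shift: `rotA` at (i, j) equals `rotB` at (i+1, j+1), and
  -- the tile (k-1-j, i+1) is sent to (i+1, j) by `rotA` and to (i, j+1) by `rotB`.
  have key : ∀ x ∈ baseRect k, (r x u ↔ r ((x.1 + x.2) % 2, 0) u) := by
    refine fun x hx => iff_of_diagonal_moves hk (fun x => r x u) ?_ ?_ hx
    · intro i j hi hi' hj hj'
      rw [pA' (i, j), pB' (i + 1, j + 1), rotA_apply, rotB_apply]
      · dsimp only
        ring_nf
      all_goals dsimp only; omega
    · intro i j hi hi' hj hj'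
      have h1 := pA' (k - 1 - j, i + 1)
      have h2 := pB' (k - 1 - j, i + 1)
      rw [rotA_apply] at h1
      rw [rotB_apply] at h2
      · dsimp only at h1 h2
        rw [show (k : ℤ) - 1 - (k - 1 - j) = j by ring] at h1
        rw [show (k : ℤ) - (k - 1 - j) = j + 1 by ring, show i + 1 - 1 = i by ring] at h2
        exact h1.symm.trans h2
      all_goals dsimp only; omega
  have hu1 := (key u hu).1 (hr.refl u)
  rw [key x hx]
  by_cases hxu' : SameColor x u
  · rw [sameColor_iff] at hxu'
    rwa [show (x.1 + x.2) % 2 = (u.1 + u.2) % 2 by omega]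
  have hk2 : Even k := Nat.not_odd_iff_even.1 fun h => hxu' (hxu h)
  obtain ⟨m, hm⟩ := hk2
  -- For even k the rotation takes (0, 0) to (0, k-1), a tile of the other color, which merges the
  -- two parity classes.
  have h0 : r (0, 0) u ↔ r (1, 0) u := by
    rw [pA' (0, 0), rotA_apply]
    · rw [key]
      · dsimp only
        rw [show (0 + ((k : ℤ) - 1 - 0)) % 2 = 1 by omega]
      · rw [mem_baseRect]; dsimp only; omega
    all_goals dsimp only; omega
  rw [sameColor_iff] at hxu'
  rcases Int.emod_two_eq_zero_or_one (u.1 + u.2) with h | h <;> rw [h] at hu1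
  · rw [show (x.1 + x.2) % 2 = 1 by omega]
    exact h0.1 hu1
  · rw [show (x.1 + x.2) % 2 = 0 by omega]
    exact h0.2 hu1

end Base

/-! ### Three-cycles in one rectangle for k ≥ 5 -/

section Contour

variable {k : ℕ} {x : Tile}

/-- A permutation that moves exactly the tiles of the first row, the first column and the last
column of the base rectangle. -/
noncomputable def contourPerm (k : ℕ) : Perm Tile := rotA k * rotB k * (rotA k * rotB k)

theorem contourPerm_apply (x : Tile) :
    contourPerm k x = rotA k (rotB k (rotA k (rotB k x))) := rfl

theorem contourPerm_mem (k : ℕ) : contourPerm k ∈ gridGroup k (baseRect k) :=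
  have h := mul_mem (rotA_mem k) (rotB_mem k)
  mul_mem h h

theorem mem_contour_of_ne (h : contourPerm k x ≠ x) :
    x ∈ baseRect k ∧ (x.1 = 0 ∨ x.2 = 0 ∨ x.2 = k) := by
  have hx : x ∈ baseRect k :=
    by_contra fun h' => h (gridGroup_apply_of_notMem (contourPerm_mem k) h')
  refine ⟨hx, by_contra fun h' => h ?_⟩
  rw [mem_baseRect] at hx
  -- On the tiles off the contour the product of the two rotations is a half-turn, so its square
  -- fixes them.
  have key : ∀ y : Tile, 1 ≤ y.1 → y.1 < k → 1 ≤ y.2 → y.2 < k →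
      rotA k (rotB k y) = (k - y.1, k - y.2) := by
    intro y h1 h2 h3 h4
    rw [rotB_apply (by omega) h2 h3 h4.le, rotA_apply] <;> dsimp only
    · ext <;> dsimp only; ring
    all_goals omega
  rw [contourPerm_apply, key x (by omega) (by omega) (by omega) (by omega), key]
  · ext <;> simp
  all_goals dsimp only; omega

theorem mem_baseRect_of_mem_gridGroup {g : Perm Tile} (hg : g ∈ gridGroup k (baseRect k))
    (hx : x ∈ baseRect k) : g x ∈ baseRect k :=
  (gridGroup_apply_mem_iff hg).2 hx

/-- `x` is a tile of the base rectangle whose coordinates satisfy `S`. -/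
def InBase (k : ℕ) (S : ℤ → ℤ → Prop) (x : Tile) : Prop := x ∈ baseRect k ∧ S x.1 x.2

section Steps

variable {S : ℤ → ℤ → Prop} (S' : ℤ → ℤ → Prop)

/-- `S'` only has to contain the image of `S`. Following such supersets through a word leaves linear
inequalities at every letter; `h2` treats the column that the rotation fixes. -/
theorem InBase.apply_rotA (h : InBase k S x)
    (h1 : ∀ i j : ℤ, 0 ≤ i → i < k → 0 ≤ j → j < k → S i j → S' j (k - 1 - i))
    (h2 : ∀ i : ℤ, 0 ≤ i → i < k → S i k → S' i k) : InBase k S' (rotA k x) := by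
  obtain ⟨hx, hS⟩ := h
  refine ⟨mem_baseRect_of_mem_gridGroup (rotA_mem k) hx, ?_⟩
  have hx' := mem_baseRect.1 hx
  rcases rotA_cases hx with ⟨e1, e2, e3⟩ | ⟨e1, e2, e3⟩ <;> rw [e2, e3]
  · exact h1 _ _ hx'.1.1 hx'.1.2 hx'.2.1 e1 hS
  · rw [e1] at hS ⊢
    exact h2 _ hx'.1.1 hx'.1.2 hS

theorem InBase.apply_rotB (h : InBase k S x)
    (h1 : ∀ i j : ℤ, 0 ≤ i → i < k → 1 ≤ j → j ≤ k → S i j → S' (j - 1) (k - i))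
    (h2 : ∀ i : ℤ, 0 ≤ i → i < k → S i 0 → S' i 0) : InBase k S' (rotB k x) := by
  obtain ⟨hx, hS⟩ := h
  refine ⟨mem_baseRect_of_mem_gridGroup (rotB_mem k) hx, ?_⟩
  have hx' := mem_baseRect.1 hx
  rcases rotB_cases hx with ⟨e1, e2, e3⟩ | ⟨e1, e2, e3⟩ <;> rw [e2, e3]
  · exact h1 _ _ hx'.1.1 hx'.1.2 e1 (by omega) hS
  · rw [e1] at hS ⊢
    exact h2 _ hx'.1.1 hx'.1.2 hS

theorem InBase.apply_rotA_inv (h : InBase k S x)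
    (h1 : ∀ i j : ℤ, 0 ≤ i → i < k → 0 ≤ j → j < k → S i j → S' (k - 1 - j) i)
    (h2 : ∀ i : ℤ, 0 ≤ i → i < k → S i k → S' i k) : InBase k S' ((rotA k)⁻¹ x) := by
  obtain ⟨y, rfl⟩ := (rotA k).surjective x
  rw [← Perm.mul_apply, inv_mul_cancel, Perm.one_apply]
  obtain ⟨hx, hS⟩ := h
  have hy := (gridGroup_apply_mem_iff (rotA_mem k)).1 hx
  have hy' := mem_baseRect.1 hy
  refine ⟨hy, ?_⟩
  rcases rotA_cases hy with ⟨e1, e2, e3⟩ | ⟨e1, e2, e3⟩ <;> rw [e2, e3] at hS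
  · have := h1 _ _ hy'.2.1 e1 (by omega) (by omega) hS
    rwa [sub_sub_cancel] at this
  · rw [e1] at hS ⊢
    exact h2 _ hy'.1.1 hy'.1.2 hS

theorem InBase.apply_rotB_inv (h : InBase k S x)
    (h1 : ∀ i j : ℤ, 0 ≤ i → i < k → 1 ≤ j → j ≤ k → S i j → S' (k - j) (i + 1))
    (h2 : ∀ i : ℤ, 0 ≤ i → i < k → S i 0 → S' i 0) : InBase k S' ((rotB k)⁻¹ x) := by
  obtain ⟨y, rfl⟩ := (rotB k).surjective x
  rw [← Perm.mul_apply, inv_mul_cancel, Perm.one_apply]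
  obtain ⟨hx, hS⟩ := h
  have hy := (gridGroup_apply_mem_iff (rotB_mem k)).1 hx
  have hy' := mem_baseRect.1 hy
  refine ⟨hy, ?_⟩
  rcases rotB_cases hy with ⟨e1, e2, e3⟩ | ⟨e1, e2, e3⟩ <;> rw [e2, e3] at hS
  · have := h1 _ _ (by omega) (by omega) (by omega) (by omega) hS
    rwa [sub_sub_cancel, sub_add_cancel] at this
  · rw [e1] at hS ⊢
    exact h2 _ hy'.1.1 hy'.1.2 hS

end Steps

/-- A conjugator that moves the contour to a set meeting the contour only in `(2, 0)`. -/
noncomputable def leftShift (k : ℕ) : Perm Tile :=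
  rotA k * (rotB k * (rotB k * (rotA k * (rotA k * (rotB k * ((rotA k)⁻¹ * (rotB k)⁻¹))))))

/-- A conjugator that moves the contour to a set meeting the contour only in `(k - 1, k)`. -/
noncomputable def rightShift (k : ℕ) : Perm Tile :=
  rotA k * (rotA k * (rotB k * ((rotA k)⁻¹ * (rotB k * (rotB k * (rotA k * rotA k))))))

theorem leftShift_mem (k : ℕ) : leftShift k ∈ gridGroup k (baseRect k) :=
  have hA := rotA_mem k
  have hB := rotB_mem k
  mul_mem hA (mul_mem hB (mul_mem hB (mul_mem hA (mul_mem hA (mul_mem hB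
    (mul_mem (inv_mem hA) (inv_mem hB)))))))

theorem rightShift_mem (k : ℕ) : rightShift k ∈ gridGroup k (baseRect k) :=
  have hA := rotA_mem k
  have hB := rotB_mem k
  mul_mem hA (mul_mem hA (mul_mem hB (mul_mem (inv_mem hA) (mul_mem hB (mul_mem hB
    (mul_mem hA hA))))))

/-- The contour is followed through the word from its last letter to its first. What remains is
contained in row 2 without the last column and in inner tiles, and the contour meets this only in
(2, 0). As k ≥ 5, column 4, reached before the final rotation, still belongs to the left block. -/
theorem eq_of_leftShift_mem_contour (hk : 5 ≤ k)
    (hx : InBase k (fun i j => i = 0 ∨ j = 0 ∨ j = k) x)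
    (h : InBase k (fun i j => i = 0 ∨ j = 0 ∨ j = k) (leftShift k x)) :
    leftShift k x = (2, 0) := by
  have s1 := hx.apply_rotB_inv (fun i j => i = 0 ∨ j = 0 ∨ j = 1)
    (by intros; omega) (by intros; omega)
  have s2 := s1.apply_rotA_inv (fun i j => j = 0 ∨ i = k - 1 ∧ j < k ∨ i = k - 2 ∧ j < k ∨ i = 0 ∧ j = k)
    (by intros; omega) (by intros; omega)
  have s3 := s2.apply_rotB (fun i j => j = 0 ∨ j = 1 ∧ i ≤ k - 2 ∨ j = 2 ∧ i ≤ k - 2 ∨ i = k - 1 ∧ j = k)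
    (by intros; omega) (by intros; omega)
  have s4 := s3.apply_rotA (fun i j => i = 0 ∧ j < k ∨ i = 1 ∧ 1 ≤ j ∧ j < k ∨ i = 2 ∧ 1 ≤ j ∧ j < k ∨
      i = k - 1 ∧ j = k)
    (by intros; omega) (by intros; omega)
  have s5 := s4.apply_rotA (fun i j => j = k - 1 ∨ j = k - 2 ∧ 1 ≤ i ∨ j = k - 3 ∧ 1 ≤ i ∨
      i = k - 1 ∧ j = k)
    (by intros; omega) (by intros; omega)
  have s6 := s5.apply_rotB (fun i j => i = k - 2 ∧ 1 ≤ j ∨ i = k - 3 ∧ 1 ≤ j ∧ j < k ∨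
      i = k - 4 ∧ 1 ≤ j ∧ j < k ∨ i = k - 1 ∧ j = 1)
    (by intros; omega) (by intros; omega)
  have s7 := s6.apply_rotB (fun i j => j = 2 ∨ j = 3 ∧ i ≤ k - 2 ∨ j = 4 ∧ i ≤ k - 2 ∨ i = 0 ∧ j = 1)
    (by intros; omega) (by intros; omega)
  have s8 := s7.apply_rotA (fun i j => i = 2 ∧ j < k ∨ 1 ≤ i ∧ 1 ≤ j ∧ j < k)
    (by intros; omega) (by intros; omega)
  have h1 := h.2
  simp only [leftShift, Perm.mul_apply] at h1 ⊢
  have h3 := s8.2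
  clear s1 s2 s3 s4 s5 s6 s7 s8 h hx
  generalize rotA k _ = y at *
  ext <;> dsimp only <;> omega

theorem eq_of_rightShift_mem_contour (hk : 5 ≤ k)
    (hx : InBase k (fun i j => i = 0 ∨ j = 0 ∨ j = k) x)
    (h : InBase k (fun i j => i = 0 ∨ j = 0 ∨ j = k) (rightShift k x)) :
    rightShift k x = ((k : ℤ) - 1, (k : ℤ)) := by
  have s1 := hx.apply_rotA (fun i j => j = k - 1 ∨ j = k ∨ i = 0)
    (by intros; omega) (by intros; omega)
  have s2 := s1.apply_rotA (fun i j => i = k - 1 ∨ j = k - 1 ∨ j = k)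
    (by intros; omega) (by intros; omega)
  have s3 := s2.apply_rotB (fun i j => j = 1 ∨ i = k - 2 ∧ 1 ≤ j ∨ i = k - 1)
    (by intros; omega) (by intros; omega)
  have s4 := s3.apply_rotB (fun i j => i = 0 ∧ 1 ≤ j ∨ j = 1 ∨ j = 2 ∨ i = k - 1 ∧ j = 0)
    (by intros; omega) (by intros; omega)
  have s5 := s4.apply_rotA_inv (fun i j => j = 0 ∧ i ≤ k - 2 ∨ i = 0 ∧ j = k ∨ i = k - 2 ∧ j < k ∨
      i = k - 3 ∧ j < k ∨ i = k - 1 ∧ j = k - 1)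
    (by intros; omega) (by intros; omega)
  have s6 := s5.apply_rotB (fun i j => j = 0 ∧ i ≤ k - 2 ∨ i = k - 1 ∧ j = k ∨ j = 2 ∧ i ≤ k - 2 ∨
      j = 3 ∧ i ≤ k - 2 ∨ i = k - 2 ∧ j = 1)
    (by intros; omega) (by intros; omega)
  have s7 := s6.apply_rotA (fun i j => (i = 0 ∨ i = 2 ∨ i = 3) ∧ 1 ≤ j ∧ j < k ∨ i = k - 1 ∧ j = k ∨
      i = 1 ∧ j = 1)
    (by intros; omega) (by intros; omega)
  have s8 := s7.apply_rotA (fun i j => 1 ≤ i ∧ 1 ≤ j ∧ j < k ∨ i = k - 1 ∧ j = k)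
    (by intros; omega) (by intros; omega)
  have h1 := h.2
  simp only [rightShift, Perm.mul_apply] at h1 ⊢
  have h3 := s8.2
  clear s1 s2 s3 s4 s5 s6 s7 s8 h hx
  generalize rotA k _ = y at *
  ext <;> dsimp only <;> omega

/-- The contour permutation and its conjugate by g are supported in the contour and in its image
under g. These share only g z, so the commutator is a three-cycle. -/
theorem linked_of_shift {g : Perm Tile} (hg : g ∈ gridGroup k (baseRect k)) {z : Tile}
    (h : ∀ x, InBase k (fun i j => i = 0 ∨ j = 0 ∨ j = k) x →
      InBase k (fun i j => i = 0 ∨ j = 0 ∨ j = k) (g x) → g x = g z)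
    (hz : contourPerm k z ≠ z) (hgz : contourPerm k (g z) ≠ g z) :
    Linked (gridGroup k (baseRect k)) (g z) (contourPerm k (g z)) := by
  have hc := contourPerm_mem k
  refine Linked.of_supports hc (mul_mem (mul_mem hg hc) (inv_mem hg)) hgz ?_ ?_
  · simpa [Perm.mul_apply] using hz
  · intro y hy hy'
    obtain ⟨x, rfl⟩ := g.surjective y
    refine h x (mem_contour_of_ne ?_) (mem_contour_of_ne hy)
    simpa [Perm.mul_apply] using hy'

theorem rotA_rotB_first_column {i : ℤ} (h1 : 0 ≤ i) (h2 : i < k) :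
    rotA k (rotB k (i, 0)) = (0, (k : ℤ) - 1 - i) := by
  rw [rotB_apply_of_le le_rfl, rotA_apply] <;> dsimp only <;> omega

theorem rotA_rotB_last_column {i : ℤ} (h1 : 1 ≤ i) (h2 : i < k) :
    rotA k (rotB k (i, (k : ℤ))) = ((k : ℤ) - i, 0) := by
  rw [rotB_apply, rotA_apply] <;> dsimp only
  · ext <;> dsimp only; ring
  all_goals omega

theorem rotA_rotB_first_row {j : ℤ} (h1 : 1 ≤ j) (h2 : j ≤ k) :
    rotA k (rotB k (0, j)) = (j - 1, (k : ℤ)) := by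
  rw [rotB_apply, rotA_apply_of_le] <;> dsimp only
  · rw [sub_zero]
  all_goals omega

theorem isLinked_baseRect_of_five_le (hk : 5 ≤ k) : IsLinked k (baseRect k) := by
  have hr := Linked.equivalence (gridGroup k (baseRect k))
  have hA : ∀ x y, Linked (gridGroup k (baseRect k)) x y →
      Linked (gridGroup k (baseRect k)) (rotA k x) (rotA k y) := fun x y h => h.map (rotA_mem k)
  have hB : ∀ x y, Linked (gridGroup k (baseRect k)) x y →
      Linked (gridGroup k (baseRect k)) (rotB k x) (rotB k y) := fun x y h => h.map (rotB_mem k)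
  have c1 : contourPerm k (0, 0) = ((k : ℤ) - 2, (k : ℤ)) := by
    rw [contourPerm_apply, rotA_rotB_first_column, rotA_rotB_first_row]
    · ext <;> dsimp only; ring
    all_goals omega
  have c2 : contourPerm k (2, 0) = ((k : ℤ) - 4, (k : ℤ)) := by
    rw [contourPerm_apply, rotA_rotB_first_column, rotA_rotB_first_row]
    · ext <;> dsimp only; ring
    all_goals omega
  have c3 : contourPerm k (0, (k : ℤ) - 2) = (3, 0) := by
    rw [contourPerm_apply, rotA_rotB_first_row, rotA_rotB_last_column]
    · ext <;> dsimp only; ring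
    all_goals omega
  have c4 : contourPerm k ((k : ℤ) - 1, (k : ℤ)) = (0, (k : ℤ) - 2) := by
    rw [contourPerm_apply, rotA_rotB_last_column, rotA_rotB_first_column]
    · ext <;> dsimp only; ring
    all_goals omega
  have l1 : leftShift k (0, 0) = (2, 0) := by
    have s0 : InBase k (fun i j => i = 0 ∧ j = 0) ((0, 0) : Tile) := by
      refine ⟨?_, rfl, rfl⟩
      rw [mem_baseRect]; dsimp only; omega
    have s1 := s0.apply_rotB_inv (fun i j => i = 0 ∧ j = 0)
      (by intros; omega) (by intros; omega)
    have s2 := s1.apply_rotA_inv (fun i j => i = k - 1 ∧ j = 0)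
      (by intros; omega) (by intros; omega)
    have s3 := s2.apply_rotB (fun i j => i = k - 1 ∧ j = 0)
      (by intros; omega) (by intros; omega)
    have s4 := s3.apply_rotA (fun i j => i = 0 ∧ j = 0)
      (by intros; omega) (by intros; omega)
    have s5 := s4.apply_rotA (fun i j => i = 0 ∧ j = k - 1)
      (by intros; omega) (by intros; omega)
    have s6 := s5.apply_rotB (fun i j => i = k - 2 ∧ j = k)
      (by intros; omega) (by intros; omega)
    have s7 := s6.apply_rotB (fun i j => i = k - 1 ∧ j = 2)
      (by intros; omega) (by intros; omega)
    have s8 := s7.apply_rotA (fun i j => i = 2 ∧ j = 0)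
      (by intros; omega) (by intros; omega)
    simp only [leftShift, Perm.mul_apply]
    exact Prod.ext s8.2.1 s8.2.2
  have l2 : rightShift k (0, (k : ℤ) - 2) = ((k : ℤ) - 1, (k : ℤ)) := by
    have s0 : InBase k (fun i j => i = 0 ∧ j = k - 2) ((0, (k : ℤ) - 2) : Tile) := by
      refine ⟨?_, rfl, rfl⟩
      rw [mem_baseRect]; dsimp only; omega
    have s1 := s0.apply_rotA (fun i j => i = k - 2 ∧ j = k - 1)
      (by intros; omega) (by intros; omega)
    have s2 := s1.apply_rotA (fun i j => i = k - 1 ∧ j = 1)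
      (by intros; omega) (by intros; omega)
    have s3 := s2.apply_rotB (fun i j => i = 0 ∧ j = 1)
      (by intros; omega) (by intros; omega)
    have s4 := s3.apply_rotB (fun i j => i = 0 ∧ j = k)
      (by intros; omega) (by intros; omega)
    have s5 := s4.apply_rotA_inv (fun i j => i = 0 ∧ j = k)
      (by intros; omega) (by intros; omega)
    have s6 := s5.apply_rotB (fun i j => i = k - 1 ∧ j = k)
      (by intros; omega) (by intros; omega)
    have s7 := s6.apply_rotA (fun i j => i = k - 1 ∧ j = k)
      (by intros; omega) (by intros; omega)
    have s8 := s7.apply_rotA (fun i j => i = k - 1 ∧ j = k)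
      (by intros; omega) (by intros; omega)
    simp only [rightShift, Perm.mul_apply]
    exact Prod.ext s8.2.1 s8.2.2
  -- A link between the first and the last column, as `rel_of_invariant` requires.
  have m1 : Linked (gridGroup k (baseRect k)) (2, 0) ((k : ℤ) - 4, (k : ℤ)) := by
    have := linked_of_shift (leftShift_mem k) (z := (0, 0))
      (fun x h h' => (eq_of_leftShift_mem_contour hk h h').trans l1.symm)
      (by rw [c1, Ne, Prod.ext_iff]; dsimp only; omega)
      (by rw [l1, c2, Ne, Prod.ext_iff]; dsimp only; omega)
    rwa [l1, c2] at this
  -- The second link serves the other color. It leads from the last column to the first row, and one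
  -- more application of the contour permutation brings it to the first column.
  have m2 : Linked (gridGroup k (baseRect k)) (3, 0) ((k : ℤ) - 1, (k : ℤ)) := by
    have := linked_of_shift (rightShift_mem k) (z := (0, (k : ℤ) - 2))
      (fun x h h' => (eq_of_rightShift_mem_contour hk h h').trans l2.symm)
      (by rw [c3, Ne, Prod.ext_iff]; dsimp only; omega)
      (by rw [l2, c4, Ne, Prod.ext_iff]; dsimp only; omega)
    rw [l2, c4] at this
    have h' := this.map (contourPerm_mem k)
    rw [c4, c3] at h'
    exact (this.trans h').symm
  intro x hx y hy hxy
  have b1 : ((2, 0) : Tile) ∈ baseRect k := by rw [mem_baseRect]; dsimp only; omega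
  have b2 : ((3, 0) : Tile) ∈ baseRect k := by rw [mem_baseRect]; dsimp only; omega
  by_cases hc : SameColor x (2, 0)
  · exact (rel_of_invariant (by omega) hr hA hB b1 rfl rfl m1 hx fun _ => hc).trans
      (rel_of_invariant (by omega) hr hA hB b1 rfl rfl m1 hy
        fun h => (hxy h).symm.trans hc).symm
  · have hc' : SameColor x (3, 0) := by
      rw [sameColor_iff] at *
      dsimp only at *
      omega
    exact (rel_of_invariant (by omega) hr hA hB b2 rfl rfl m2 hx fun _ => hc').trans
      (rel_of_invariant (by omega) hr hA hB b2 rfl rfl m2 hy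
        fun h => (hxy h).symm.trans hc').symm

end Contour

/-! ### Evaluation of words in the generators for k = 2 and k = 4 -/

section Words

/-- The two generators of the puzzle group of the base rectangle. -/
inductive Gen
  | a
  | b

open Gen

/-- The rotation of a block of the base rectangle, in a form suited to evaluation. -/
def genFun (k : ℕ) : Gen → ℤ × ℤ → ℤ × ℤ
  | a, x => if 0 ≤ x.1 ∧ x.1 < k ∧ 0 ≤ x.2 ∧ x.2 < k then (x.2, k - 1 - x.1) else x
  | b, x => if 0 ≤ x.1 ∧ x.1 < k ∧ 1 ≤ x.2 ∧ x.2 ≤ k then (x.2 - 1, k - x.1) else x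

/-- The action of a word in the generators, in a form suited to evaluation. -/
def wordFun (k : ℕ) (w : List Gen) (x : ℤ × ℤ) : ℤ × ℤ := w.foldr (genFun k) x

/-- The permutation of the grid given by a word in the generators. -/
noncomputable def wordPerm (k : ℕ) : List Gen → Perm Tile
  | [] => 1
  | a :: w => rotA k * wordPerm k w
  | b :: w => rotB k * wordPerm k w

variable {k : ℕ}

theorem rotA_eq_genFun (x : Tile) : rotA k x = genFun k a x := by
  by_cases h : 0 ≤ x.1 ∧ x.1 < k ∧ 0 ≤ x.2 ∧ x.2 < k
  · rw [genFun, if_pos h, rotA_apply h.1 h.2.1 h.2.2.1 h.2.2.2]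
  · rw [genFun, if_neg h, rotA, blockRotation_apply_of_notMem]
    rw [mem_rect]; dsimp only; omega

theorem rotB_eq_genFun (x : Tile) : rotB k x = genFun k b x := by
  by_cases h : 0 ≤ x.1 ∧ x.1 < k ∧ 1 ≤ x.2 ∧ x.2 ≤ k
  · rw [genFun, if_pos h, rotB_apply h.1 h.2.1 h.2.2.1 h.2.2.2]
  · rw [genFun, if_neg h, rotB, blockRotation_apply_of_notMem]
    rw [mem_rect]; dsimp only; omega

theorem wordPerm_apply (w : List Gen) (x : Tile) : wordPerm k w x = wordFun k w x := by
  induction w with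
  | nil => rfl
  | cons g w ih =>
    cases g
    · rw [wordPerm, Perm.mul_apply, ih, rotA_eq_genFun]; rfl
    · rw [wordPerm, Perm.mul_apply, ih, rotB_eq_genFun]; rfl

theorem wordPerm_mem (w : List Gen) : wordPerm k w ∈ gridGroup k (baseRect k) := by
  induction w with
  | nil => exact one_mem _
  | cons g w ih =>
    cases g
    · exact mul_mem (rotA_mem k) ih
    · exact mul_mem (rotB_mem k) ih

/-- The tiles of the base rectangle, in a form suited to evaluation. -/
def baseTiles (k : ℕ) : List (ℤ × ℤ) :=
  (List.range k).flatMap fun i : ℕ => (List.range (k + 1)).map fun j : ℕ => ((i : ℤ), (j : ℤ))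

theorem mem_baseTiles {x : Tile} : x ∈ baseTiles k ↔ x ∈ baseRect k := by
  simp only [baseTiles, List.mem_flatMap, List.mem_range, List.mem_map, mem_baseRect]
  constructor
  · rintro ⟨i, hi, j, hj, rfl⟩
    dsimp only
    omega
  · intro h
    exact ⟨x.1.toNat, by omega, x.2.toNat, by omega,
      Prod.ext (Int.toNat_of_nonneg h.1.1) (Int.toNat_of_nonneg h.2.1)⟩

theorem threeCyc_eq_of_forall {g : Perm Tile} (hg : g ∈ gridGroup k (baseRect k)) {x y z : Tile}
    (hx : x ∈ baseRect k) (hy : y ∈ baseRect k) (hz : z ∈ baseRect k)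
    (h : ∀ t ∈ baseRect k, g t = threeCyc x y z t) : g = threeCyc x y z := by
  ext1 t
  by_cases ht : t ∈ baseRect k
  · exact h t ht
  · rw [gridGroup_apply_of_notMem hg ht, threeCyc_apply_of_ne] <;> rintro rfl <;> contradiction

theorem isLinked_baseRect_four : IsLinked 4 (baseRect 4) := by
  have hr := Linked.equivalence (gridGroup 4 (baseRect 4))
  have b1 : ((3, 0) : Tile) ∈ baseRect 4 := by rw [mem_baseRect]; norm_num
  have b2 : ((2, 4) : Tile) ∈ baseRect 4 := by rw [mem_baseRect]; norm_num
  have b3 : ((3, 2) : Tile) ∈ baseRect 4 := by rw [mem_baseRect]; norm_num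
  -- The word has one cycle of length three and otherwise cycles of length dividing four, so its
  -- fourth power is a three-cycle. It is chosen to join the first column to the last.
  have key : (wordPerm 4 [a, b, b, b, a, a, a, b, a, b, b, a, a, b]) ^ 4 = threeCyc (3, 0) (2, 4) (3, 2) := by
    refine threeCyc_eq_of_forall (pow_mem (wordPerm_mem _) 4) b1 b2 b3 ?_
    simp only [pow_succ, pow_zero, one_mul, Perm.mul_apply, wordPerm_apply, threeCyc,
      swap_apply_def, ← mem_baseTiles]
    decide +kernel
  have h : Linked (gridGroup 4 (baseRect 4)) (3, 0) (2, 4) := by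
    refine .of_mem (z := (3, 2)) (by decide) (by decide) (by decide) ?_
    rw [← key]
    exact pow_mem (wordPerm_mem _) 4
  intro x hx y hy _
  have h4 : ¬ Odd 4 := by decide
  exact (rel_of_invariant (by norm_num) hr (fun x y h => h.map (rotA_mem 4))
    (fun x y h => h.map (rotB_mem 4)) b1 rfl rfl h hx fun h' => absurd h' h4).trans
    (rel_of_invariant (by norm_num) hr (fun x y h => h.map (rotA_mem 4))
    (fun x y h => h.map (rotB_mem 4)) b1 rfl rfl h hy fun h' => absurd h' h4).symm

/-- Words whose permutations of the `2 × 3` rectangle have exactly two fixed points. -/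
def twoFixedWords : List (List Gen) :=
  [[a],
    [b],
    [a, a, a, b, a],
    [a, a, b, a, a],
    [a, b, a, a, a],
    [b, a, b, b, b],
    [b, b, b, a, b],
    [a, a, a, b, a, a, b],
    [a, a, a, b, a, b, b],
    [a, a, b, a, b, b, b],
    [a, a, b, b, b, a, b],
    [a, b, a, b, b, b, a],
    [a, b, b, a, b, b, b],
    [a, b, b, b, a, a, b],
    [b, a, b, b, b, a, a]]

/-- In PGL_2(5) the stabilizer of two points is cyclic of order four and permutes the other four
points regularly. The fifteen words supply a generator for each of the fifteen pairs. -/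
theorem exists_fixing_two {p q : Tile} (hp : p ∈ baseRect 2) (hq : q ∈ baseRect 2) (hpq : p ≠ q) :
    ∃ g ∈ gridGroup 2 (baseRect 2), g p = p ∧ g q = q ∧
      ∀ r ∈ baseRect 2, r ≠ p → r ≠ q → g r ≠ r := by
  have key : ∀ p ∈ baseTiles 2, ∀ q ∈ baseTiles 2, p ≠ q → ∃ w ∈ twoFixedWords,
      wordFun 2 w p = p ∧ wordFun 2 w q = q ∧
        ∀ r ∈ baseTiles 2, r ≠ p → r ≠ q → wordFun 2 w r ≠ r := by
    decide +kernel
  obtain ⟨w, -, h1, h2, h3⟩ := key p (mem_baseTiles.2 hp) q (mem_baseTiles.2 hq) hpq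
  refine ⟨wordPerm 2 w, wordPerm_mem w, ?_⟩
  simp only [wordPerm_apply]
  exact ⟨h1, h2, fun r hr => h3 r (mem_baseTiles.2 hr)⟩

/-- A four-cycle that fixes p and one further tile other than u and v has a power taking u to v. -/
theorem exists_fixing_one {p u v : Tile} (hp : p ∈ baseRect 2) (hu : u ∈ baseRect 2)
    (hv : v ∈ baseRect 2) (hup : u ≠ p) (hvp : v ≠ p) :
    ∃ g ∈ gridGroup 2 (baseRect 2), g p = p ∧ g u = v := by
  have key : ∀ p ∈ baseTiles 2, ∀ u ∈ baseTiles 2, ∀ v ∈ baseTiles 2, u ≠ p → v ≠ p →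
      ∃ w ∈ twoFixedWords, wordFun 2 w p = p ∧
        ∃ n ∈ List.range 4, (wordFun 2 w)^[n] u = v := by
    decide +kernel
  obtain ⟨w, -, h1, n, -, h2⟩ :=
    key p (mem_baseTiles.2 hp) u (mem_baseTiles.2 hu) v (mem_baseTiles.2 hv) hup hvp
  have h : ⇑(wordPerm 2 w) = wordFun 2 w := funext (wordPerm_apply w)
  refine ⟨wordPerm 2 w ^ n, pow_mem (wordPerm_mem w) n, ?_, ?_⟩
  · exact Perm.pow_apply_eq_self_of_apply_eq_self (by rw [h, h1]) n
  · rw [← Perm.iterate_eq_pow, h, h2]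

end Words

/-! ### Attaching rectangles to a linked figure -/

section Attach

variable {k : ℕ} {F R R₁ R₂ : Finset Tile} {ψ : Perm Tile} {x y : Tile}

theorem IsPlacement.linked (hψ : IsPlacement k ψ R)
    (h : Linked (gridGroup k (baseRect k)) x y) : Linked (gridGroup k R) (ψ x) (ψ y) := by
  rcases h with rfl | ⟨z, h1, h2, h3, h4⟩
  · exact .refl _ _
  · refine .of_mem (z := ψ z) (by simpa) (by simpa) (by simpa) ?_
    rw [← threeCyc_conj]
    exact (hψ.conj_mem_iff _).2 h4

theorem IsPlacement.exists_eq (hψ : IsPlacement k ψ R) (hx : x ∈ R) :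
    ∃ x' ∈ baseRect k, ψ x' = x := by
  obtain ⟨x', rfl⟩ := ψ.surjective x
  exact ⟨x', (hψ.mem_iff x').1 hx, rfl⟩

theorem IsBasicRect.card_eq (hR : IsBasicRect k R) : R.card = k * (k + 1) := by
  obtain ⟨c, rfl | rfl⟩ := hR <;> rw [card_rect]
  ring

theorem isLinked_of_isBasicRect (hk : 4 ≤ k) (hR : IsBasicRect k R) : IsLinked k R := by
  have h0 : IsLinked k (baseRect k) := by
    rcases hk.eq_or_lt with rfl | hk
    · exact isLinked_baseRect_four
    · exact isLinked_baseRect_of_five_le hk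
  obtain ⟨ψ, hψ⟩ := hR.exists_isPlacement
  intro x hx y hy hxy
  obtain ⟨x, hx', rfl⟩ := hψ.exists_eq hx
  obtain ⟨y, hy', rfl⟩ := hψ.exists_eq hy
  exact hψ.linked (h0 x hx' y hy' fun h => (hψ.sameColor_iff x y).1 (hxy h))

theorem Adjacent.not_sameColor (h : Adjacent x y) : ¬ SameColor x y := by
  rw [sameColor_iff]
  unfold Adjacent at h
  rcases abs_cases (x.1 - y.1) with ⟨h1, -⟩ | ⟨h1, -⟩ <;>
    rcases abs_cases (x.2 - y.2) with ⟨h2, -⟩ | ⟨h2, -⟩ <;> omega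

/-- For odd k the overlap contains two adjacent tiles, hence tiles of both colors. This is the
purpose of the stronger overlap condition. -/
theorem Overlaps.exists_mem (h : Overlaps k F R) (x : Tile) :
    ∃ p, p ∈ F ∧ p ∈ R ∧ (Odd k → SameColor x p) := by
  rcases Nat.even_or_odd k with hk | hk
  · obtain ⟨p, hp⟩ := h.1 hk
    rw [Finset.mem_inter] at hp
    exact ⟨p, hp.1, hp.2, fun h' => absurd hk (Nat.not_even_iff_odd.2 h')⟩
  · obtain ⟨p, hp, q, hq, hpq⟩ := h.2 hk
    rw [Finset.mem_inter] at hp hq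
    by_cases hxp : SameColor x p
    · exact ⟨p, hp.1, hp.2, fun _ => hxp⟩
    · refine ⟨q, hq.1, hq.2, fun _ => ?_⟩
      exact SameColor.of_not (fun h => hxp h.symm) hpq.not_sameColor

theorem IsLinked.union (hF : IsLinked k F) (hR : IsLinked k R) (h : Overlaps k F R) :
    IsLinked k (F ∪ R) := by
  have key : ∀ x ∈ F ∪ R, ∀ p, p ∈ F → p ∈ R → (Odd k → SameColor x p) →
      Linked (gridGroup k (F ∪ R)) x p := by
    intro x hx p hpF hpR hxp
    rcases Finset.mem_union.1 hx with hx | hx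
    · exact (hF x hx p hpF hxp).mono (gridGroup_mono Finset.subset_union_left)
    · exact (hR x hx p hpR hxp).mono (gridGroup_mono Finset.subset_union_right)
  intro x hx y hy hxy
  obtain ⟨p, hpF, hpR, hp⟩ := h.exists_mem x
  exact (key x hx p hpF hpR hp).trans
    (key y hy p hpF hpR fun h => (hxy h).symm.trans (hp h)).symm

theorem isLinked_of_admissible (hk : 4 ≤ k) (hF : Admissible k F) : IsLinked k F := by
  induction hF with
  | single R hR => exact isLinked_of_isBasicRect hk hR
  | attach F R _ hR hFR ih => exact ih.union (isLinked_of_isBasicRect hk hR) hFR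

theorem Admissible.exists_isBasicRect (hF : Admissible k F) : ∃ R, IsBasicRect k R ∧ R ⊆ F := by
  induction hF with
  | single R hR => exact ⟨R, hR, subset_rfl⟩
  | attach F R _ _ _ ih =>
    obtain ⟨R', h1, h2⟩ := ih
    exact ⟨R', h1, h2.trans Finset.subset_union_left⟩

theorem IsBasicRect.exists_rect_subset (hR : IsBasicRect k R) : ∃ c, rect k k c ⊆ R := by
  obtain ⟨c, rfl | rfl⟩ := hR <;> refine ⟨c, fun x hx => ?_⟩ <;> rw [mem_rect] at hx ⊢ <;>
    push_cast <;> omega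

theorem Admissible.exists_rect_subset (hF : Admissible k F) : ∃ c, rect k k c ⊆ F := by
  obtain ⟨R, hR, hRF⟩ := hF.exists_isBasicRect
  obtain ⟨c, hc⟩ := hR.exists_rect_subset
  exact ⟨c, hc.trans hRF⟩

/-- The puzzle group of `R` acts transitively on the tiles (of each color, if `k` is odd) other
than a given one, with that tile fixed. -/
def FixesAndMoves (k : ℕ) (R : Finset Tile) : Prop :=
  ∀ q, ∀ u ∈ R, ∀ v ∈ R, u ≠ q → v ≠ q → (Odd k → SameColor u v ∧ SameColor u q) →
    ∃ g ∈ gridGroup k R, g q = q ∧ g u = v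

/-- An element that fixes q and moves p to y carries the link between p and q to one between y and
q. -/
theorem FixesAndMoves.linked (hR : FixesAndMoves k R) {H : Subgroup (Perm Tile)}
    (hH : gridGroup k R ≤ H) {p q : Tile} (hp : p ∈ R) (hpq : p ≠ q)
    (hc : Odd k → SameColor p q) (h : Linked H p q) (hy : y ∈ R) (hyp : Odd k → SameColor y p) :
    Linked H y p := by
  by_cases hyq : y = q
  · rw [hyq]; exact h.symm
  obtain ⟨g, hg, h1, h2⟩ := hR q p hp y hy hpq hyq fun hk => ⟨(hyp hk).symm, hc hk⟩
  have := h.map (hH hg)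
  rw [h1, h2] at this
  exact this.trans h.symm

/-- R itself need not be linked. A common tile p is linked inside F to some q, and the group of R
spreads this link over R. -/
theorem IsLinked.attach (hF : IsLinked k F) (hR : FixesAndMoves k R) (h : Overlaps k F R)
    (hex : ∀ p ∈ F, ∃ q ∈ F, p ≠ q ∧ (Odd k → SameColor p q)) : IsLinked k (F ∪ R) := by
  have key : ∀ x ∈ F ∪ R, ∀ p, p ∈ F → p ∈ R → (Odd k → SameColor x p) →
      Linked (gridGroup k (F ∪ R)) x p := by
    intro x hx p hpF hpR hxp
    rcases Finset.mem_union.1 hx with hx | hx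
    · exact (hF x hx p hpF hxp).mono (gridGroup_mono Finset.subset_union_left)
    · obtain ⟨q, hq, hpq, hc⟩ := hex p hpF
      exact hR.linked (gridGroup_mono Finset.subset_union_right) hpR hpq hc
        ((hF p hpF q hq hc).mono (gridGroup_mono Finset.subset_union_left)) hx hxp
  intro x hx y hy hxy
  obtain ⟨p, hpF, hpR, hp⟩ := h.exists_mem x
  exact (key x hx p hpF hpR hp).trans
    (key y hy p hpF hpR fun h => (hxy h).symm.trans (hp h)).symm

theorem Admissible.exists_ne_sameColor (hk : 1 < k) (hF : Admissible k F) {p : Tile} (hp : p ∈ F) :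
    ∃ q ∈ F, p ≠ q ∧ (Odd k → SameColor p q) := by
  have key : ∀ c p : Tile, p ∈ rect k k c → ∃ q ∈ rect k k c, p ≠ q ∧ (Odd k → SameColor p q) := by
    intro c p hp
    have hp' := mem_rect.1 hp
    -- The witness is a diagonal neighbor inside the block, which has the color of p.
    refine ⟨(if p.1 = c.1 then p.1 + 1 else p.1 - 1, if p.2 = c.2 then p.2 + 1 else p.2 - 1),
      ?_, ?_, fun _ => ?_⟩
    · rw [mem_rect]; dsimp only; split_ifs <;> omega
    · rw [Ne, Prod.ext_iff]; dsimp only; split_ifs <;> omega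
    · rw [sameColor_iff]; dsimp only; split_ifs <;> omega
  have key2 : ∃ c, p ∈ rect k k c ∧ rect k k c ⊆ F := by
    have hbasic : ∀ R : Finset Tile, IsBasicRect k R → p ∈ R →
        ∃ c, p ∈ rect k k c ∧ rect k k c ⊆ R := by
      rintro R ⟨c, rfl | rfl⟩ hp
      · rw [mem_rect] at hp
        refine ⟨(c.1, if p.2 = c.2 then c.2 else c.2 + 1), ?_, fun x hx => ?_⟩
        · rw [mem_rect]; dsimp only; split_ifs <;> omega
        · rw [mem_rect] at hx ⊢; dsimp only at hx; split_ifs at hx <;> omega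
      · rw [mem_rect] at hp
        refine ⟨(if p.1 = c.1 then c.1 else c.1 + 1, c.2), ?_, fun x hx => ?_⟩
        · rw [mem_rect]; dsimp only; split_ifs <;> omega
        · rw [mem_rect] at hx ⊢; dsimp only at hx; split_ifs at hx <;> omega
    induction hF with
    | single R hR => exact hbasic R hR hp
    | attach F R _ hR _ ih =>
      rcases Finset.mem_union.1 hp with hp | hp
      · obtain ⟨c, h1, h2⟩ := ih hp
        exact ⟨c, h1, h2.trans Finset.subset_union_left⟩
      · obtain ⟨c, h1, h2⟩ := hbasic R hR hp
        exact ⟨c, h1, h2.trans Finset.subset_union_right⟩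
  obtain ⟨c, h1, h2⟩ := key2
  obtain ⟨q, h3, h4⟩ := key c p h1
  exact ⟨q, h2 h3, h4⟩

/-- Repeating the same rectangle changes nothing; the first different one makes the figure linked,
and it remains so. This serves k = 2 and k = 3, where a single rectangle is exceptional. -/
theorem Admissible.isBasicRect_or_isLinked (hk : 1 < k)
    (hfix : ∀ R, IsBasicRect k R → FixesAndMoves k R)
    (htwo : ∀ R₁ R₂, IsBasicRect k R₁ → IsBasicRect k R₂ → R₁ ≠ R₂ → Overlaps k R₁ R₂ →
      IsLinked k (R₁ ∪ R₂)) (hF : Admissible k F) : IsBasicRect k F ∨ IsLinked k F := by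
  induction hF with
  | single R hR => exact .inl hR
  | attach F R hF hR hFR ih =>
    rcases ih with ih | ih
    · by_cases h : F = R
      · left; rwa [h, Finset.union_self]
      · exact .inr (htwo F R ih hR h hFR)
    · exact .inr (ih.attach (hfix R hR) hFR fun p hp => hF.exists_ne_sameColor hk hp)

/-- A basic rectangle contains a line of `k` tiles outside any other basic rectangle. -/
theorem IsBasicRect.exists_line (hk : 0 < k) (h₁ : IsBasicRect k R₁) (h₂ : IsBasicRect k R₂)
    (h : R₁ ≠ R₂) : ∃ x : Tile,
      (∀ i : ℤ, 0 ≤ i → i < k → ((x.1 + i, x.2) : Tile) ∈ R₁ \ R₂) ∨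
        (∀ i : ℤ, 0 ≤ i → i < k → ((x.1, x.2 + i) : Tile) ∈ R₁ \ R₂) := by
  simp only [Finset.mem_sdiff]
  obtain ⟨c, rfl | rfl⟩ := h₁ <;> obtain ⟨d, rfl | rfl⟩ := h₂ <;>
    simp only [mem_rect] <;> push_cast
  · have hcd : c.1 ≠ d.1 ∨ c.2 ≠ d.2 := by
      by_contra! h'
      exact h (by rw [Prod.ext h'.1 h'.2])
    rcases (by omega : c.1 < d.1 ∨ d.1 < c.1 ∨ c.2 < d.2 ∨ d.2 < c.2) with h' | h' | h' | h'
    · exact ⟨c, .inr fun i _ _ => by omega⟩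
    · exact ⟨(c.1 + k - 1, c.2), .inr fun i _ _ => by dsimp only; omega⟩
    · exact ⟨c, .inl fun i _ _ => by omega⟩
    · exact ⟨(c.1, c.2 + k), .inl fun i _ _ => by dsimp only; omega⟩
  · rcases (by omega : c.2 < d.2 ∨ d.2 + k ≤ c.2 + k) with h' | h'
    · exact ⟨c, .inl fun i _ _ => by omega⟩
    · exact ⟨(c.1, c.2 + k), .inl fun i _ _ => by dsimp only; omega⟩
  · rcases (by omega : c.1 < d.1 ∨ d.1 + k ≤ c.1 + k) with h' | h'
    · exact ⟨c, .inr fun i _ _ => by omega⟩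
    · exact ⟨(c.1 + k, c.2), .inr fun i _ _ => by dsimp only; omega⟩
  · have hcd : c.1 ≠ d.1 ∨ c.2 ≠ d.2 := by
      by_contra! h'
      exact h (by rw [Prod.ext h'.1 h'.2])
    rcases (by omega : c.1 < d.1 ∨ d.1 < c.1 ∨ c.2 < d.2 ∨ d.2 < c.2) with h' | h' | h' | h'
    · exact ⟨c, .inr fun i _ _ => by omega⟩
    · exact ⟨(c.1 + k, c.2), .inr fun i _ _ => by dsimp only; omega⟩
    · exact ⟨c, .inl fun i _ _ => by omega⟩
    · exact ⟨(c.1, c.2 + k - 1), .inl fun i _ _ => by dsimp only; omega⟩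

end Attach

/-! ### Two overlapping rectangles for k = 2 -/

section Two

variable {R R₁ R₂ : Finset Tile}

theorem IsBasicRect.exists_fixing_two (hR : IsBasicRect 2 R) {p q : Tile} (hp : p ∈ R)
    (hq : q ∈ R) (hpq : p ≠ q) :
    ∃ g ∈ gridGroup 2 R, g p = p ∧ g q = q ∧ ∀ r ∈ R, r ≠ p → r ≠ q → g r ≠ r := by
  obtain ⟨ψ, hψ⟩ := hR.exists_isPlacement
  obtain ⟨p, hp', rfl⟩ := hψ.exists_eq hp
  obtain ⟨q, hq', rfl⟩ := hψ.exists_eq hq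
  obtain ⟨g, hg, h1, h2, h3⟩ := RotatingSquares.exists_fixing_two hp' hq' fun h => hpq (by rw [h])
  refine ⟨ψ * g * ψ⁻¹, (hψ.conj_mem_iff g).2 hg, ?_, ?_, fun r hr hrp hrq => ?_⟩
  · simp [Perm.mul_apply, h1]
  · simp [Perm.mul_apply, h2]
  · obtain ⟨r, hr', rfl⟩ := hψ.exists_eq hr
    simpa [Perm.mul_apply] using h3 r hr' (fun h => hrp (by rw [h])) fun h => hrq (by rw [h])

theorem IsBasicRect.fixesAndMoves_two (hR : IsBasicRect 2 R) : FixesAndMoves 2 R := by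
  obtain ⟨ψ, hψ⟩ := hR.exists_isPlacement
  have key : ∀ p ∈ R, ∀ u ∈ R, ∀ v ∈ R, u ≠ p → v ≠ p → ∃ g ∈ gridGroup 2 R, g p = p ∧ g u = v := by
    intro p hp u hu v hv hup hvp
    obtain ⟨p, hp', rfl⟩ := hψ.exists_eq hp
    obtain ⟨u, hu', rfl⟩ := hψ.exists_eq hu
    obtain ⟨v, hv', rfl⟩ := hψ.exists_eq hv
    obtain ⟨g, hg, h1, h2⟩ := exists_fixing_one hp' hu' hv' (fun h => hup (by rw [h]))
      fun h => hvp (by rw [h])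
    refine ⟨ψ * g * ψ⁻¹, (hψ.conj_mem_iff g).2 hg, ?_, ?_⟩
    · simp [Perm.mul_apply, h1]
    · simp [Perm.mul_apply, h2]
  intro q u hu v hv huq hvq _
  by_cases hq : q ∈ R
  · exact key q hq u hu v hv huq hvq
  -- A tile q outside R is fixed by the whole group, so any tile of R other than u and v can play
  -- its part.
  · obtain ⟨p, hp⟩ : (R \ {u, v}).Nonempty := by
      rw [← Finset.card_pos]
      have h1 := Finset.le_card_sdiff {u, v} R
      have h2 : ({u, v} : Finset Tile).card ≤ 2 := Finset.card_le_two
      have h3 := hR.card_eq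
      omega
    simp only [Finset.mem_sdiff, Finset.mem_insert, Finset.mem_singleton, not_or] at hp
    obtain ⟨g, hg, -, h⟩ := key p hp.1 u hu v hv (Ne.symm hp.2.1) (Ne.symm hp.2.2)
    exact ⟨g, hg, gridGroup_apply_of_notMem hg hq, h⟩

/-- Besides r there are at most three common tiles. An element of the first group fixes two of them
and one of the second group fixes the remaining one, so their supports meet only in r. -/
theorem isLinked_union_two (h₁ : IsBasicRect 2 R₁) (h₂ : IsBasicRect 2 R₂) (h : R₁ ≠ R₂)
    (ho : Overlaps 2 R₁ R₂) : IsLinked 2 (R₁ ∪ R₂) := by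
  obtain ⟨r, hr1, hr2, -⟩ := ho.exists_mem (0, 0)
  have hc1 := h₁.card_eq
  have hc2 := h₂.card_eq
  have hcard : (R₁ ∩ R₂).card ≤ 4 := by
    obtain ⟨a, b, hab, ha, hb⟩ : ∃ a b, a ≠ b ∧ a ∈ R₁ \ R₂ ∧ b ∈ R₁ \ R₂ := by
      obtain ⟨x, hx | hx⟩ := h₁.exists_line (by norm_num) h₂ h
      · exact ⟨_, _, by rw [Ne, Prod.ext_iff]; dsimp only; omega, hx 0 le_rfl (by norm_num), hx 1 (by norm_num) (by norm_num)⟩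
      · exact ⟨_, _, by rw [Ne, Prod.ext_iff]; dsimp only; omega, hx 0 le_rfl (by norm_num), hx 1 (by norm_num) (by norm_num)⟩
    have h2 : 2 ≤ (R₁ \ R₂).card := by
      rw [← Finset.card_pair hab]
      exact Finset.card_le_card (by simp [Finset.insert_subset_iff, *])
    have h3 := Finset.card_sdiff_add_card_inter R₁ R₂
    omega
  have hrZ : r ∈ R₁ ∩ R₂ := Finset.mem_inter.2 ⟨hr1, hr2⟩
  have hZ := Finset.card_erase_of_mem hrZ
  -- `P₀` takes up to two of the common tiles other than r, and at most one is left over. Both sets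
  -- are then padded to exactly two tiles, as `exists_fixing_two` demands.
  obtain ⟨P₀, hP₀, hP₀c⟩ := Finset.exists_subset_card_eq
    (min_le_right 2 ((R₁ ∩ R₂).erase r).card)
  obtain ⟨P, hP₀P, hP, hPc⟩ := Finset.exists_subsuperset_card_eq (n := 2)
    (hP₀.trans (Finset.erase_subset_erase r Finset.inter_subset_left)) (by omega)
    (by rw [Finset.card_erase_of_mem hr1]; omega)
  have hQ₀c := Finset.card_sdiff_of_subset hP₀
  obtain ⟨Q, hQ₀Q, hQ, hQc⟩ := Finset.exists_subsuperset_card_eq (n := 2)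
    (Finset.sdiff_subset.trans (Finset.erase_subset_erase r Finset.inter_subset_right) :
      (R₁ ∩ R₂).erase r \ P₀ ⊆ R₂.erase r) (by omega)
    (by rw [Finset.card_erase_of_mem hr2]; omega)
  obtain ⟨p, q, hpq, rfl⟩ := Finset.card_eq_two.1 hPc
  obtain ⟨s, t, hst, rfl⟩ := Finset.card_eq_two.1 hQc
  simp only [Finset.insert_subset_iff, Finset.singleton_subset_iff, Finset.mem_erase] at hP hQ
  obtain ⟨f, hf, hf1, hf2, hf3⟩ := h₁.exists_fixing_two hP.1.2 hP.2.2 hpq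
  obtain ⟨g, hg, hg1, hg2, hg3⟩ := h₂.exists_fixing_two hQ.1.2 hQ.2.2 hst
  have hfr : f r ≠ r := hf3 r hr1 (Ne.symm hP.1.1) (Ne.symm hP.2.1)
  have hgr : g r ≠ r := hg3 r hr2 (Ne.symm hQ.1.1) (Ne.symm hQ.2.1)
  have hfg : ∀ y, f y ≠ y → g y ≠ y → y = r := by
    intro y hfy hgy
    by_contra hyr
    have hy1 : y ∈ R₁ := by_contra fun h' => hfy (gridGroup_apply_of_notMem hf h')
    have hy2 : y ∈ R₂ := by_contra fun h' => hgy (gridGroup_apply_of_notMem hg h')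
    have hyZ : y ∈ (R₁ ∩ R₂).erase r :=
      Finset.mem_erase.2 ⟨hyr, Finset.mem_inter.2 ⟨hy1, hy2⟩⟩
    by_cases hyP : y ∈ P₀
    · have := hP₀P hyP
      simp only [Finset.mem_insert, Finset.mem_singleton] at this
      rcases this with rfl | rfl
      · exact hfy hf1
      · exact hfy hf2
    · have := hQ₀Q (Finset.mem_sdiff.2 ⟨hyZ, hyP⟩)
      simp only [Finset.mem_insert, Finset.mem_singleton] at this
      rcases this with rfl | rfl
      · exact hgy hg1
      · exact hgy hg2
  have hH1 := gridGroup_mono (k := 2) (Finset.subset_union_left : R₁ ⊆ R₁ ∪ R₂)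
  have hH2 := gridGroup_mono (k := 2) (Finset.subset_union_right : R₂ ⊆ R₁ ∪ R₂)
  have l1 := Linked.of_supports (hH1 hf) (hH2 hg) hfr hgr hfg
  have l2 := Linked.of_supports (hH2 hg) (hH1 hf) hgr hfr fun y h1 h2 => hfg y h2 h1
  have h2 : ¬ Odd 2 := by decide
  have key : ∀ y ∈ R₁ ∪ R₂, Linked (gridGroup 2 (R₁ ∪ R₂)) y r := by
    intro y hy
    rcases Finset.mem_union.1 hy with hy | hy
    · exact h₁.fixesAndMoves_two.linked hH1 hr1 hfr.symm (fun h' => absurd h' h2) l1 hy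
        fun h' => absurd h' h2
    · exact h₂.fixesAndMoves_two.linked hH2 hr2 hgr.symm (fun h' => absurd h' h2) l2 hy
        fun h' => absurd h' h2
  exact fun x hx y hy _ => (key x hx).trans (key y hy).symm

theorem isLinked_of_card_ne_six {F : Finset Tile} (hF : Admissible 2 F) (h : F.card ≠ 6) :
    IsLinked 2 F :=
  (hF.isBasicRect_or_isLinked (by norm_num) (fun _ => IsBasicRect.fixesAndMoves_two)
    fun _ _ => isLinked_union_two).resolve_left fun h' => h h'.card_eq

end Two

/-! ### Elements that are a transposition on one color -/

section Toggle

variable {k : ℕ} {R : Finset Tile} {x y z : Tile}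

theorem sameColor_inv_apply {g : Perm Tile} (hg : ∀ y, SameColor (g y) y) (y : Tile) :
    SameColor (g⁻¹ y) y := by
  simpa using (hg (g⁻¹ y)).symm

theorem sameColor_swap_apply (h : SameColor x y) (z : Tile) : SameColor (swap x y z) z := by
  rw [swap_apply_def]
  split_ifs with h1 h2
  · rw [h1]; exact h.symm
  · rw [h2]; exact h
  · exact .refl z

/-- `t` exchanges `x` and `y`, fixes all other tiles of their color, and moves all tiles of `R`
of the other color. -/
def Toggles (R : Finset Tile) (t : Perm Tile) (x y : Tile) : Prop :=
  (∀ z, SameColor z x → t z = swap x y z) ∧ ∀ z ∈ R, ¬ SameColor z x → t z ≠ z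

theorem Toggles.conj {g t : Perm Tile} (hc : ∀ y, SameColor (g y) y) (hR : ∀ y, g y ∈ R ↔ y ∈ R)
    (h : Toggles R t x y) : Toggles R (g * t * g⁻¹) (g x) (g y) := by
  constructor
  · intro z hz
    have hz' : SameColor (g⁻¹ z) x := (sameColor_inv_apply hc z).trans (hz.trans (hc x))
    rw [Perm.mul_apply, Perm.mul_apply, h.1 _ hz', swap_apply_apply]
    rfl
  · intro z hz hzx h'
    refine h.2 (g⁻¹ z) ((hR _).1 (by simpa using hz)) (fun h'' => hzx ?_) ?_
    · exact ((sameColor_inv_apply hc z).symm.trans h'').trans (hc x).symm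
    · rw [Perm.eq_inv_iff_eq]; exact h'

/-- `x` and `y` coincide or are exchanged by a toggle in the puzzle group of `R`. -/
def Toggled (k : ℕ) (R : Finset Tile) (x y : Tile) : Prop :=
  x = y ∨ SameColor x y ∧ ∃ t ∈ gridGroup k R, Toggles R t x y

theorem Toggled.map (hk : Odd k) {g : Perm Tile} (hg : g ∈ gridGroup k R) (h : Toggled k R x y) :
    Toggled k R (g x) (g y) := by
  rcases h with rfl | ⟨hxy, t, ht, h⟩
  · exact .inl rfl
  · have hc := gridGroup_sameColor hk hg
    exact .inr ⟨(hc x).trans (hxy.trans (hc y).symm), _, mul_mem (mul_mem hg ht) (inv_mem hg),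
      h.conj hc fun _ => gridGroup_apply_mem_iff hg⟩

/-- For transitivity, a toggle of x and y sends y to x and fixes any other tile z of their color, so
conjugation by it turns a toggle of y and z into one of x and z. -/
theorem Toggled.equivalence (hk : Odd k) (R : Finset Tile) : Equivalence (Toggled k R) where
  refl x := .inl rfl
  symm := by
    rintro x y (rfl | ⟨hxy, t, ht, h1, h2⟩)
    · exact .inl rfl
    · refine .inr ⟨hxy.symm, t, ht, fun z hz => ?_, fun z hz hzy => h2 z hz fun h => hzy (h.trans hxy)⟩
      rw [swap_comm]
      exact h1 z (hz.trans hxy.symm)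
  trans := by
    rintro x y z (rfl | ⟨hxy, s, hs, h⟩) hyz
    · exact hyz
    have hy : s y = x := by rw [h.1 y hxy.symm, swap_apply_right]
    by_cases hzx : z = x
    · exact .inl hzx.symm
    by_cases hzy : z = y
    · rw [hzy]; exact .inr ⟨hxy, s, hs, h⟩
    have hyz' : SameColor y z := by
      rcases hyz with rfl | h'
      · exact .refl _
      · exact h'.1
    have hz : s z = z := by
      rw [h.1 z (hyz'.symm.trans hxy.symm), swap_apply_of_ne_of_ne hzx hzy]
    have := Toggled.map hk hs hyz
    rwa [hy, hz] at this

theorem IsPlacement.toggled {ψ : Perm Tile} (hψ : IsPlacement k ψ R)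
    (h : Toggled k (baseRect k) x y) : Toggled k R (ψ x) (ψ y) := by
  rcases h with rfl | ⟨hxy, t, ht, h1, h2⟩
  · exact .inl rfl
  refine .inr ⟨(hψ.sameColor_iff x y).2 hxy, _, (hψ.conj_mem_iff t).2 ht, fun z hz => ?_,
    fun z hz hzx h' => ?_⟩ <;> obtain ⟨z, rfl⟩ := ψ.surjective z
  · rw [hψ.sameColor_iff] at hz
    simp [Perm.mul_apply, h1 z hz, swap_apply_apply]
  · rw [hψ.sameColor_iff] at hzx
    exact h2 z ((hψ.mem_iff z).1 hz) hzx (by simpa [Perm.mul_apply] using h')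

end Toggle

/-! ### One rectangle for k = 3 -/

section Three

open Gen

variable {R R₁ R₂ : Finset Tile} {x y z : Tile}

theorem toggles_baseRect_three {w : List Gen} (hx : x ∈ baseRect 3) (hy : y ∈ baseRect 3)
    (h : ∀ z ∈ baseTiles 3, ((z.1 + z.2 - (x.1 + x.2)) % 2 = 0 →
      wordFun 3 w z = if z = x then y else if z = y then x else z) ∧
      (¬ (z.1 + z.2 - (x.1 + x.2)) % 2 = 0 → wordFun 3 w z ≠ z)) :
    Toggles (baseRect 3) (wordPerm 3 w) x y := by
  simp only [← wordPerm_apply, mem_baseTiles, ← sameColor_iff, ← swap_apply_def] at h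
  refine ⟨fun z hz => ?_, fun z hz => (h z hz).2⟩
  by_cases hzR : z ∈ baseRect 3
  · exact (h z hzR).1 hz
  · rw [gridGroup_apply_of_notMem (wordPerm_mem w) hzR, swap_apply_of_ne_of_ne] <;>
      rintro rfl <;> contradiction

theorem odd_three : Odd 3 := by decide

/-- An outer automorphism of S_6 sends transpositions to products of three disjoint transpositions,
which is why toggles exist. One explicit toggle between the outer columns for each color is spread
by `rel_of_invariant`. -/
theorem toggled_baseRect_three (hx : x ∈ baseRect 3) (hy : y ∈ baseRect 3) (h : SameColor x y) :
    Toggled 3 (baseRect 3) x y := by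
  have hr := Toggled.equivalence odd_three (baseRect 3)
  have b1 : ((0, 0) : Tile) ∈ baseRect 3 := by rw [mem_baseRect]; norm_num
  have b2 : ((1, 3) : Tile) ∈ baseRect 3 := by rw [mem_baseRect]; norm_num
  have b3 : ((1, 0) : Tile) ∈ baseRect 3 := by rw [mem_baseRect]; norm_num
  have b4 : ((0, 3) : Tile) ∈ baseRect 3 := by rw [mem_baseRect]; norm_num
  have m1 : Toggled 3 (baseRect 3) (0, 0) (1, 3) := by
    refine .inr ⟨by rw [sameColor_iff]; norm_num, _, wordPerm_mem [b, a, a, b, b, a, a, a, b],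
      toggles_baseRect_three b1 b2 ?_⟩
    decide +kernel
  have m2 : Toggled 3 (baseRect 3) (1, 0) (0, 3) := by
    refine .inr ⟨by rw [sameColor_iff]; norm_num, _, wordPerm_mem [a, b, b, b, a, a, b, b, a],
      toggles_baseRect_three b3 b4 ?_⟩
    decide +kernel
  have hA : ∀ x y, Toggled 3 (baseRect 3) x y → Toggled 3 (baseRect 3) (rotA 3 x) (rotA 3 y) :=
    fun x y h => h.map odd_three (rotA_mem 3)
  have hB : ∀ x y, Toggled 3 (baseRect 3) x y → Toggled 3 (baseRect 3) (rotB 3 x) (rotB 3 y) :=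
    fun x y h => h.map odd_three (rotB_mem 3)
  by_cases hc : SameColor x (0, 0)
  · exact hr.trans (rel_of_invariant (by norm_num) hr hA hB b1 rfl rfl m1 hx fun _ => hc)
      (hr.symm (rel_of_invariant (by norm_num) hr hA hB b1 rfl rfl m1 hy
        fun _ => h.symm.trans hc))
  · have hc' : SameColor x (1, 0) := SameColor.of_not (fun h => hc h.symm) (by rw [sameColor_iff]; norm_num)
    exact hr.trans (rel_of_invariant (by norm_num) hr hA hB b3 rfl rfl m2 hx fun _ => hc')
      (hr.symm (rel_of_invariant (by norm_num) hr hA hB b3 rfl rfl m2 hy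
        fun _ => h.symm.trans hc'))

theorem IsBasicRect.exists_toggles (hR : IsBasicRect 3 R) (hx : x ∈ R) (hy : y ∈ R)
    (hxy : x ≠ y) (h : SameColor x y) : ∃ t ∈ gridGroup 3 R, Toggles R t x y := by
  obtain ⟨ψ, hψ⟩ := hR.exists_isPlacement
  obtain ⟨x, hx', rfl⟩ := hψ.exists_eq hx
  obtain ⟨y, hy', rfl⟩ := hψ.exists_eq hy
  exact ((hψ.toggled (toggled_baseRect_three hx' hy' ((hψ.sameColor_iff x y).1 h))).resolve_left
    hxy).2

theorem IsBasicRect.fixesAndMoves_three (hR : IsBasicRect 3 R) : FixesAndMoves 3 R := by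
  intro q u hu v hv huq hvq h
  obtain ⟨h1, h2⟩ := h odd_three
  by_cases huv : u = v
  · exact ⟨1, one_mem _, rfl, huv⟩
  obtain ⟨t, ht, h3, -⟩ := hR.exists_toggles hu hv huv h1
  refine ⟨t, ht, ?_, ?_⟩
  · rw [h3 q h2.symm, swap_apply_of_ne_of_ne huq.symm hvq.symm]
  · rw [h3 u (.refl u), swap_apply_left]

/-- The outer automorphism pairs a three-cycle on one color with two disjoint three-cycles on the
other. -/
theorem IsBasicRect.exists_threeCyc_mul (hR : IsBasicRect 3 R) (x : Tile) :
    ∃ f ∈ gridGroup 3 R, ∃ c : Fin 9 → Tile, (∀ i, c i ∈ R) ∧ Function.Injective c ∧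
      (∀ i, SameColor (c i) x ↔ i < 3) ∧
      f = threeCyc (c 0) (c 1) (c 2) * threeCyc (c 3) (c 4) (c 5) *
        threeCyc (c 6) (c 7) (c 8) := by
  obtain ⟨ψ, hψ⟩ := hR.exists_isPlacement
  have key : ∀ (w : List Gen) (c : Fin 9 → Tile), (∀ i, c i ∈ baseTiles 3) →
      Function.Injective c → (∀ i, SameColor (ψ (c i)) x ↔ i < 3) →
      (∀ z ∈ baseTiles 3, wordFun 3 w z = (swap (c 0) (c 1) (swap (c 1) (c 2)
        (swap (c 3) (c 4) (swap (c 4) (c 5) (swap (c 6) (c 7) (swap (c 7) (c 8) z)))))) ) →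
      ∃ f ∈ gridGroup 3 R, ∃ c : Fin 9 → Tile, (∀ i, c i ∈ R) ∧ Function.Injective c ∧
      (∀ i, SameColor (c i) x ↔ i < 3) ∧
      f = threeCyc (c 0) (c 1) (c 2) * threeCyc (c 3) (c 4) (c 5) *
        threeCyc (c 6) (c 7) (c 8) := by
    intro w c h1 h2 h3 h4
    refine ⟨_, (hψ.conj_mem_iff _).2 (wordPerm_mem w), fun i => ψ (c i),
      fun i => (hψ.mem_iff _).2 (mem_baseTiles.1 (h1 i)), ψ.injective.comp h2, h3, ?_⟩
    simp only [← threeCyc_conj]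
    rw [show ∀ A B C : Perm Tile, ψ * A * ψ⁻¹ * (ψ * B * ψ⁻¹) * (ψ * C * ψ⁻¹) =
      ψ * (A * B * C) * ψ⁻¹ by intros; group]
    congr 2
    ext1 z
    by_cases hz : z ∈ baseRect 3
    · rw [wordPerm_apply, h4 z (mem_baseTiles.2 hz)]
      rfl
    · have : ∀ i, z ≠ c i := fun i h => hz (h ▸ mem_baseTiles.1 (h1 i))
      rw [gridGroup_apply_of_notMem (wordPerm_mem w) hz, Perm.mul_apply, Perm.mul_apply,
        threeCyc_apply_of_ne (this 6) (this 7) (this 8),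
        threeCyc_apply_of_ne (this 3) (this 4) (this 5),
        threeCyc_apply_of_ne (this 0) (this 1) (this 2)]
  have hcol : ∀ u v : Tile, SameColor (ψ u) x → (SameColor (ψ v) x ↔ SameColor v u) := by
    intro u v hu
    rw [← hψ.sameColor_iff v u]
    exact ⟨fun h => h.trans hu.symm, fun h => h.trans hu⟩
  -- There is one word for each of the two base colors that may correspond to the color of x.
  by_cases hc : SameColor (ψ (0, 0)) x
  · refine key [a, a, a, b, a, b] ![(0, 0), (1, 3), (2, 2), (0, 1), (2, 3), (2, 1), (0, 3), (1, 2),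
      (1, 0)] (by decide) (by decide) ?_ ?_
    · simp only [hcol _ _ hc, sameColor_iff]
      decide
    · simp only [swap_apply_def]
      decide +kernel
  · have hc' : SameColor (ψ (0, 1)) x := by
      refine SameColor.of_not (x := ψ (0, 0)) ?_ hc
      rw [hψ.sameColor_iff, sameColor_iff]; norm_num
    refine key [a, a, b, a, a, b] ![(0, 1), (2, 3), (0, 3), (0, 0), (1, 1), (0, 2), (1, 3), (2, 2),
      (2, 0)] (by decide) (by decide) ?_ ?_
    · simp only [hcol _ _ hc', sameColor_iff]
      decide
    · simp only [swap_apply_def]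
      decide +kernel

end Three

/-! ### Elements acting on a single color -/

section ColorClass

variable {H : Subgroup (Perm Tile)} {U : Finset Tile} {x y p q : Tile}

/-- The group `H` preserves the shading and the set `U`, and it induces on the tiles of `U` with
the color of `x` all transpositions. -/
structure InducesSwaps (H : Subgroup (Perm Tile)) (U : Finset Tile) (x : Tile) : Prop where
  sameColor : ∀ g ∈ H, ∀ y, SameColor (g y) y
  mem_iff : ∀ g ∈ H, ∀ y, g y ∈ U ↔ y ∈ U
  exists_swap : ∀ p ∈ U, ∀ q ∈ U, SameColor p x → SameColor q x → p ≠ q →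
    ∃ g ∈ H, ∀ y, SameColor y x → g y = swap p q y

/-- An element that induces the transposition conjugates u in the same way as the transposition
does: what it does to the other color is irrelevant, since u is trivial there. -/
theorem InducesSwaps.swap_conj_mem (h : InducesSwaps H U x) {u : Perm Tile} (hu : u ∈ H)
    (hux : ∀ y, ¬ SameColor y x → u y = y) (hp : p ∈ U) (hq : q ∈ U) (hpx : SameColor p x)
    (hqx : SameColor q x) : swap p q * u * (swap p q)⁻¹ ∈ H := by
  by_cases hpq : p = q
  · simpa [hpq, swap_self] using! hu
  obtain ⟨g, hg, hgx⟩ := h.exists_swap p hp q hq hpx hqx hpq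
  have hc := h.sameColor g hg
  have hs := sameColor_swap_apply (hpx.trans hqx.symm)
  suffices h' : swap p q * u * (swap p q)⁻¹ = g * u * g⁻¹ by
    rw [h']; exact mul_mem (mul_mem hg hu) (inv_mem hg)
  ext1 y
  simp only [Perm.mul_apply, swap_inv]
  by_cases hy : SameColor y x
  · have h1 : g⁻¹ y = swap p q y := by
      rw [Perm.inv_eq_iff_eq, hgx _ ((hs y).trans hy), swap_apply_self]
    rw [h1, hgx]
    exact (h.sameColor u hu _).trans ((hs y).trans hy)
  · have h1 : ¬ SameColor (g⁻¹ y) x := fun h' => hy ((sameColor_inv_apply hc y).symm.trans h')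
    have h2 : ¬ SameColor (swap p q y) x := fun h' => hy ((hs y).symm.trans h')
    rw [hux _ h1, hux _ h2, swap_apply_self]
    simp

theorem InducesSwaps.linked_of_threeCyc (h : InducesSwaps H U x) {a b c : Tile}
    (hax : SameColor a x) (hb : b ∈ U) (hbx : SameColor b x) (hcx : SameColor c x) (hab : a ≠ b)
    (hbc : b ≠ c) (hca : c ≠ a) (hH : threeCyc a b c ∈ H) (hy : y ∈ U) (hyx : SameColor y x) :
    Linked H a y := by
  by_cases hya : y = a
  · exact .inl hya.symm
  have hpure : ∀ z, ¬ SameColor z x → threeCyc a b c z = z := fun z hz =>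
    threeCyc_apply_of_ne (fun h' => hz (h' ▸ hax)) (fun h' => hz (h' ▸ hbx))
      fun h' => hz (h' ▸ hcx)
  have := h.swap_conj_mem hH hpure hb hy hbx hyx
  rw [threeCyc_conj, swap_apply_left, swap_apply_of_ne_of_ne hab (Ne.symm hya)] at this
  refine .of_mem (Ne.symm hya) ?_ ?_ this
  · exact fun h' => hbc ((swap b y).injective ((swap_apply_left b y).trans h'))
  · exact fun h' => hca ((swap b y).injective
      (h'.trans (swap_apply_of_ne_of_ne hab (Ne.symm hya)).symm))

theorem InducesSwaps.linked_of_threeCyc' (h : InducesSwaps H U x) {a b c : Tile}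
    (hax : SameColor a x) (hb : b ∈ U) (hbx : SameColor b x) (hcx : SameColor c x) (hab : a ≠ b)
    (hbc : b ≠ c) (hca : c ≠ a) (hH : threeCyc a b c ∈ H) (hy : y ∈ U) (hyx : SameColor y x)
    (hp : p ∈ U) (hpx : SameColor p x) : Linked H p y :=
  (h.linked_of_threeCyc hax hb hbx hcx hab hbc hca hH hp hpx).symm.trans
    (h.linked_of_threeCyc hax hb hbx hcx hab hbc hca hH hy hyx)

/-- The elements trivial on the other color induce a nontrivial normal subgroup of a full symmetric
group of degree at least five, so it contains the alternating group. The proof extracts a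
three-cycle from commutators of u with transpositions. -/
theorem InducesSwaps.linked_of_pure (h : InducesSwaps H U x) {u : Perm Tile} (hu : u ∈ H)
    (hux : ∀ y, ¬ SameColor y x → u y = y) (hp : p ∈ U) (hpx : SameColor p x) (hup : u p ≠ p)
    (hcard : 5 ≤ (U.filter fun z => Even (z.1 + z.2) ↔ Even (x.1 + x.2)).card)
    (hy : y ∈ U) (hyx : SameColor y x) (hq : q ∈ U) (hqx : SameColor q x) : Linked H q y := by
  have hmem : ∀ z ∈ U, u z ∈ U := fun z hz => (h.mem_iff u hu z).2 hz
  have hcol : ∀ z, SameColor z x → SameColor (u z) x := fun z hz => (h.sameColor u hu z).trans hz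
  have hchoose : ∀ s : Finset Tile, s.card ≤ 4 → ∃ z ∈ U, SameColor z x ∧ z ∉ s := by
    intro s hs
    obtain ⟨z, hz, hzs⟩ := Finset.exists_mem_notMem_of_card_lt_card (lt_of_le_of_lt hs hcard)
    rw [Finset.mem_filter] at hz
    exact ⟨z, hz.1, hz.2, hzs⟩
  have hcomm : ∀ a ∈ U, ∀ b ∈ U, SameColor a x → SameColor b x →
      swap (u a) (u b) * swap a b ∈ H := by
    intro a ha b hb hax hbx
    have h1 := h.swap_conj_mem (inv_mem hu) (fun y hy => by
      rw [Perm.inv_eq_iff_eq]; exact (hux y hy).symm) ha hb hax hbx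
    have h2 := mul_mem hu h1
    rwa [← mul_assoc, ← mul_assoc, ← swap_apply_apply, swap_inv] at h2
  obtain ⟨a, b, c, ha, hax, hb, hbx, hcx, hab, hbc, hca, hH⟩ : ∃ a b c, a ∈ U ∧ SameColor a x ∧
      b ∈ U ∧ SameColor b x ∧ SameColor c x ∧ a ≠ b ∧ b ≠ c ∧ c ≠ a ∧ threeCyc a b c ∈ H := by
    by_cases huup : u (u p) = p
    · obtain ⟨v, hv, hvx, hvs⟩ := hchoose {p, u p} (Finset.card_le_two.trans (by norm_num))
      simp only [Finset.mem_insert, Finset.mem_singleton, not_or] at hvs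
      have hD := hcomm p hp v hv hpx hvx
      have huv1 : u v ≠ p := fun h' => hvs.2 (u.injective (h'.trans huup.symm))
      have huv2 : u v ≠ u p := fun h' => hvs.1 (u.injective h')
      by_cases huv : u v = v
      · rw [huv, swap_comm p v] at hD
        exact ⟨u p, v, p, hmem p hp, hcol p hpx, hv, hvx, hpx, Ne.symm hvs.2, hvs.1, hup.symm, hD⟩
      -- The commutator is the double transposition (u p, u v)(p, v). Its conjugate by (p e) is (u
      -- p, u v)(e, v), and their product is a three-cycle; this is where a fifth tile is needed.
      · obtain ⟨e, he, hex, hes⟩ := hchoose {p, u p, v, u v} Finset.card_le_four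
        simp only [Finset.mem_insert, Finset.mem_singleton, not_or] at hes
        have hDp : ∀ y, ¬ SameColor y x → (swap (u p) (u v) * swap p v) y = y := by
          intro y hy
          have hne : ∀ z, SameColor z x → y ≠ z := fun z hz h' => hy (h' ▸ hz)
          rw [Perm.mul_apply, swap_apply_of_ne_of_ne (hne p hpx) (hne v hvx),
            swap_apply_of_ne_of_ne (hne _ (hcol p hpx)) (hne _ (hcol v hvx))]
        have h1 := h.swap_conj_mem hD hDp hp he hpx hex
        have h2 : swap p e * (swap (u p) (u v) * swap p v) * (swap p e)⁻¹ =
            swap (u p) (u v) * swap e v := by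
          rw [show ∀ A B C : Perm Tile, A * (B * C) * A⁻¹ = A * B * A⁻¹ * (A * C * A⁻¹) by
            intros; group, ← swap_apply_apply, ← swap_apply_apply, swap_apply_left,
            swap_apply_of_ne_of_ne hup (Ne.symm hes.2.1),
            swap_apply_of_ne_of_ne huv1 (Ne.symm hes.2.2.2),
            swap_apply_of_ne_of_ne hvs.1 (Ne.symm hes.2.2.1)]
        have h3 := mul_mem hD h1
        rw [h2, show swap (u p) (u v) * swap p v * (swap (u p) (u v) * swap e v) =
            (swap (u p) (u v) * swap p v * (swap (u p) (u v))⁻¹) * swap e v by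
              rw [swap_inv]; group, ← swap_apply_apply,
          swap_apply_of_ne_of_ne hup.symm (Ne.symm huv1),
          swap_apply_of_ne_of_ne hvs.2 (Ne.symm huv), swap_comm e v] at h3
        exact ⟨p, v, e, hp, hpx, hv, hvx, hex, Ne.symm hvs.1, Ne.symm hes.2.2.1, hes.1, h3⟩
    · have hD := hcomm p hp (u p) (hmem p hp) hpx (hcol p hpx)
      rw [swap_comm (u p) (u (u p)), swap_comm p (u p)] at hD
      exact ⟨u (u p), u p, p, hmem _ (hmem p hp), hcol _ (hcol p hpx), hmem p hp, hcol p hpx, hpx,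
        fun h' => hup (u.injective h'), hup, Ne.symm huup, hD⟩
  exact h.linked_of_threeCyc' hax hb hbx hcx hab hbc hca hH hy hyx hq hqx

end ColorClass

/-! ### Two overlapping rectangles for k = 3 -/

section Three

variable {R₁ R₂ : Finset Tile} {x : Tile}

theorem IsBasicRect.inducesSwaps_union (h₁ : IsBasicRect 3 R₁) (h₂ : IsBasicRect 3 R₂)
    {w : Tile} (hw₁ : w ∈ R₁) (hw₂ : w ∈ R₂) (hwx : SameColor w x) :
    InducesSwaps (gridGroup 3 (R₁ ∪ R₂)) (R₁ ∪ R₂) x := by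
  have hH1 := gridGroup_mono (k := 3) (Finset.subset_union_left : R₁ ⊆ R₁ ∪ R₂)
  have hH2 := gridGroup_mono (k := 3) (Finset.subset_union_right : R₂ ⊆ R₁ ∪ R₂)
  have hcol : ∀ g ∈ gridGroup 3 (R₁ ∪ R₂), ∀ y, SameColor (g y) y := fun g hg =>
    gridGroup_sameColor odd_three hg
  refine ⟨hcol, fun g hg y => gridGroup_apply_mem_iff hg, ?_⟩
  have one : ∀ p ∈ R₁, ∀ q ∈ R₁, SameColor p x → SameColor q x → p ≠ q →
      ∃ g ∈ gridGroup 3 (R₁ ∪ R₂), ∀ y, SameColor y x → g y = swap p q y := by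
    intro p hp q hq hpx hqx hpq
    obtain ⟨t, ht, h, -⟩ := h₁.exists_toggles hp hq hpq (hpx.trans hqx.symm)
    exact ⟨t, hH1 ht, fun y hy => h y (hy.trans hpx.symm)⟩
  have two : ∀ p ∈ R₂, ∀ q ∈ R₂, SameColor p x → SameColor q x → p ≠ q →
      ∃ g ∈ gridGroup 3 (R₁ ∪ R₂), ∀ y, SameColor y x → g y = swap p q y := by
    intro p hp q hq hpx hqx hpq
    obtain ⟨t, ht, h, -⟩ := h₂.exists_toggles hp hq hpq (hpx.trans hqx.symm)
    exact ⟨t, hH2 ht, fun y hy => h y (hy.trans hpx.symm)⟩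
  -- The transposition of p and q is that of w and q conjugated by that of p and w, with w common to
  -- both rectangles.
  have mixed : ∀ p ∈ R₁, ∀ q ∈ R₂, SameColor p x → SameColor q x → p ≠ q →
      ∃ g ∈ gridGroup 3 (R₁ ∪ R₂), ∀ y, SameColor y x → g y = swap p q y := by
    intro p hp q hq hpx hqx hpq
    by_cases hpw : p = w
    · exact two p (hpw ▸ hw₂) q hq hpx hqx hpq
    by_cases hqw : q = w
    · exact one p hp q (hqw ▸ hw₁) hpx hqx hpq
    obtain ⟨g, hg, hg'⟩ := one p hp w hw₁ hpx hwx hpw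
    obtain ⟨s, hs, hs'⟩ := two w hw₂ q hq hwx hqx (Ne.symm hqw)
    refine ⟨g * s * g, mul_mem (mul_mem hg hs) hg, fun y hy => ?_⟩
    rw [Perm.mul_apply, Perm.mul_apply, hg' _ ((hcol s hs _).trans ((hcol g hg _).trans hy)),
      hs' _ ((hcol g hg _).trans hy), hg' _ hy, ← Perm.mul_apply, ← Perm.mul_apply, swap_comm p w,
      swap_comm w q, swap_mul_swap_mul_swap hqw (Ne.symm hpq)]
  intro p hp q hq hpx hqx hpq
  rcases Finset.mem_union.1 hp with hp | hp <;> rcases Finset.mem_union.1 hq with hq | hq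
  · exact one p hp q hq hpx hqx hpq
  · exact mixed p hp q hq hpx hqx hpq
  · obtain ⟨g, hg, h⟩ := mixed q hq p hp hqx hpx hpq.symm
    exact ⟨g, hg, fun y hy => by rw [h y hy, swap_comm]⟩
  · exact two p hp q hq hpx hqx hpq

theorem IsBasicRect.exists_line_three (h₁ : IsBasicRect 3 R₁) (h₂ : IsBasicRect 3 R₂)
    (h : R₁ ≠ R₂) : ∃ c : Fin 3 → Tile, (∀ i, c i ∈ R₁ ∧ c i ∉ R₂) ∧ c 0 ≠ c 2 ∧
      SameColor (c 0) (c 2) ∧ ¬ SameColor (c 0) (c 1) := by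
  obtain ⟨x, hx | hx⟩ := h₁.exists_line (by norm_num) h₂ h
  · refine ⟨fun i => (x.1 + (i : ℕ), x.2), fun i => ?_, ?_, ?_, ?_⟩
    · exact Finset.mem_sdiff.1 (hx (i : ℕ) (by omega) (by omega))
    · rw [Ne, Prod.ext_iff]; simp
    · rw [sameColor_iff]; simp
    · rw [sameColor_iff]; simp
  · refine ⟨fun i => (x.1, x.2 + (i : ℕ)), fun i => ?_, ?_, ?_, ?_⟩
    · exact Finset.mem_sdiff.1 (hx (i : ℕ) (by omega) (by omega))
    · rw [Ne, Prod.ext_iff]; simp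
    · rw [sameColor_iff]; simp
    · rw [sameColor_iff]; simp

theorem IsBasicRect.five_le_card_filter (h : IsBasicRect 3 R₁) (x : Tile) :
    5 ≤ (R₁.filter fun z => Even (z.1 + z.2) ↔ Even (x.1 + x.2)).card := by
  -- The neighbor of x has the opposite color, so the six entries with index at least three have the
  -- color of x.
  obtain ⟨f, -, c, hc, hinj, hcol, -⟩ := h.exists_threeCyc_mul (x.1 + 1, x.2)
  have : ((Finset.univ.filter fun i : Fin 9 => ¬ i < 3).map ⟨c, hinj⟩) ⊆
      R₁.filter fun z => Even (z.1 + z.2) ↔ Even (x.1 + x.2) := by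
    intro z hz
    simp only [Finset.mem_map, Finset.mem_filter, Finset.mem_univ, true_and,
      Function.Embedding.coeFn_mk] at hz
    obtain ⟨i, hi, rfl⟩ := hz
    rw [← hcol i, sameColor_iff] at hi
    rw [Finset.mem_filter]
    refine ⟨hc i, sameColor_iff.2 ?_⟩
    dsimp only at hi
    omega
  refine le_trans ?_ (Finset.card_le_card this)
  rw [Finset.card_map]
  decide

/-- A toggle t of two tiles outside R₂ and a toggle s in R₂ on the other color have a commutator
that acts on one color only, so that color is linked. Dividing the element of
`IsBasicRect.exists_threeCyc_mul` by its two three-cycles of that color then leaves a three-cycle on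
the other one. -/
theorem isLinked_union_three (h₁ : IsBasicRect 3 R₁) (h₂ : IsBasicRect 3 R₂) (h : R₁ ≠ R₂)
    (ho : Overlaps 3 R₁ R₂) : IsLinked 3 (R₁ ∪ R₂) := by
  have hH1 := gridGroup_mono (k := 3) (Finset.subset_union_left : R₁ ⊆ R₁ ∪ R₂)
  have hH2 := gridGroup_mono (k := 3) (Finset.subset_union_right : R₂ ⊆ R₁ ∪ R₂)
  have hcol : ∀ g ∈ gridGroup 3 (R₁ ∪ R₂), ∀ y, SameColor (g y) y := fun g hg =>
    gridGroup_sameColor odd_three hg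
  have hcard : ∀ x : Tile,
      5 ≤ ((R₁ ∪ R₂).filter fun z => Even (z.1 + z.2) ↔ Even (x.1 + x.2)).card := fun x =>
    (h₁.five_le_card_filter x).trans
      (Finset.card_le_card (Finset.filter_subset_filter _ Finset.subset_union_left))
  have hind : ∀ x, InducesSwaps (gridGroup 3 (R₁ ∪ R₂)) (R₁ ∪ R₂) x := by
    intro x
    obtain ⟨w, hw1, hw2, hw⟩ := ho.exists_mem x
    exact h₁.inducesSwaps_union h₂ hw1 hw2 (hw odd_three).symm
  obtain ⟨c, hc, hc02, hcc, hcn⟩ := h₁.exists_line_three h₂ h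
  obtain ⟨d, hd, -, -, hdn⟩ := h₂.exists_line_three h₁ h.symm
  obtain ⟨w, hw1, hw2, hw⟩ := ho.exists_mem (c 1)
  have hwc : ¬ SameColor (c 0) w := fun h' => hcn (h'.trans (hw odd_three).symm)
  obtain ⟨z, hz2, hz1, hzw⟩ : ∃ z ∈ R₂, z ∉ R₁ ∧ SameColor z w := by
    by_cases h' : SameColor (d 0) w
    · exact ⟨d 0, (hd 0).1, (hd 0).2, h'⟩
    · exact ⟨d 1, (hd 1).1, (hd 1).2, SameColor.of_not hdn h'⟩
  have hwz : w ≠ z := by rintro rfl; exact hz1 hw1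
  obtain ⟨t, ht, ht1, ht2⟩ := h₁.exists_toggles (hc 0).1 (hc 2).1 hc02 hcc
  obtain ⟨s, hs, hs1, -⟩ := h₂.exists_toggles hw2 hz2 hwz hzw.symm
  have hsw : s w = z := by rw [hs1 w (.refl w), swap_apply_left]
  have hsz : s z = w := by rw [hs1 z hzw, swap_apply_right]
  have htz : t z = z := gridGroup_apply_of_notMem ht hz1
  have hu : t * s * t⁻¹ * s⁻¹ ∈ gridGroup 3 (R₁ ∪ R₂) :=
    mul_mem (mul_mem (mul_mem (hH1 ht) (hH2 hs)) (inv_mem (hH1 ht))) (inv_mem (hH2 hs))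
  -- On this color t is the transposition of `c 0` and `c 2`, both fixed by s as they lie outside
  -- R₂; so s and t commute there.
  have hpure : ∀ y, ¬ SameColor y w → (t * s * t⁻¹ * s⁻¹) y = y := by
    intro y hy
    obtain ⟨y, rfl⟩ := (s * t).surjective y
    have hst := hcol _ (mul_mem (hH2 hs) (hH1 ht)) y
    have hyw : ¬ SameColor w y := fun h' => hy (hst.trans h'.symm)
    have hyc : SameColor y (c 0) := SameColor.of_not hyw fun h' => hwc h'.symm
    have e1 : (t * s * t⁻¹ * s⁻¹) ((s * t) y) = t (s y) := by
      rw [← Perm.mul_apply, ← Perm.mul_apply]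
      congr 1
      group
    rw [e1, Perm.mul_apply, ht1 y hyc, ht1 (s y) ((hcol s (hH2 hs) y).trans hyc)]
    have f0 := gridGroup_apply_of_notMem hs (hc 0).2
    have f2 := gridGroup_apply_of_notMem hs (hc 2).2
    conv_lhs => rw [← f0, ← f2, swap_apply_apply]
    simp [Perm.mul_apply]
  -- As t fixes z and s exchanges w and z, a fixed z would force t to fix w, but a toggle moves
  -- every tile of R₁ of the other color.
  have hmove : (t * s * t⁻¹ * s⁻¹) z ≠ z := by
    have hs' : s⁻¹ z = w := by rw [Perm.inv_eq_iff_eq, hsw]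
    intro h'
    rw [Perm.mul_apply, hs', Perm.mul_apply, Perm.mul_apply, ← Perm.eq_inv_iff_eq] at h'
    have ht' : t⁻¹ z = z := by rw [Perm.inv_eq_iff_eq, htz]
    rw [ht', ← Perm.eq_inv_iff_eq, hs', Perm.inv_eq_iff_eq] at h'
    exact ht2 w hw1 (fun h'' => hwc h''.symm) h'.symm
  have link : ∀ y ∈ R₁ ∪ R₂, SameColor y w → ∀ q ∈ R₁ ∪ R₂, SameColor q w →
      Linked (gridGroup 3 (R₁ ∪ R₂)) q y := fun y hy hyw q hq hqw =>
    (hind w).linked_of_pure hu hpure (Finset.mem_union_right _ hz2) hzw hmove (hcard w) hy hyw hq hqw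
  obtain ⟨f, hf, e, he, hinj, hecol, rfl⟩ := h₁.exists_threeCyc_mul (c 0)
  have he' : ∀ i, e i ∈ R₁ ∪ R₂ := fun i => Finset.mem_union_left _ (he i)
  have hother : ∀ i j l : Fin 9, i ≠ j → j ≠ l → l ≠ i → ¬ i < 3 → ¬ j < 3 → ¬ l < 3 →
      threeCyc (e i) (e j) (e l) ∈ gridGroup 3 (R₁ ∪ R₂) := by
    intro i j l hij hjl hli hi hj hl
    have hcw : ∀ i, ¬ i < 3 → SameColor (e i) w := fun i hi =>
      SameColor.of_not (fun h' => hi ((hecol i).1 h'.symm)) hwc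
    exact threeCyc_mem_of_linked (hinj.ne hij) (hinj.ne hjl) (hinj.ne hli)
      (link _ (he' j) (hcw j hj) _ (he' i) (hcw i hi))
      (link _ (he' l) (hcw l hl) _ (he' i) (hcw i hi))
  have h3 := hother 3 4 5 (by decide) (by decide) (by decide) (by decide) (by decide) (by decide)
  have h6 := hother 6 7 8 (by decide) (by decide) (by decide) (by decide) (by decide) (by decide)
  have h0 : threeCyc (e 0) (e 1) (e 2) ∈ gridGroup 3 (R₁ ∪ R₂) := by
    have := hH1 hf
    rwa [Subgroup.mul_mem_cancel_right _ h6, Subgroup.mul_mem_cancel_right _ h3] at this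
  intro x hx y hy hxy
  by_cases hxw : SameColor x w
  · exact link y hy ((hxy odd_three).symm.trans hxw) x hx hxw
  · have hxc : SameColor x (c 0) := SameColor.of_not (fun h' => hxw h'.symm) fun h' => hwc h'.symm
    exact (hind (c 0)).linked_of_threeCyc' ((hecol 0).2 (by decide)) (he' 1)
      ((hecol 1).2 (by decide)) ((hecol 2).2 (by decide)) (hinj.ne (by decide))
      (hinj.ne (by decide)) (hinj.ne (by decide)) h0 hy ((hxy odd_three).symm.trans hxc) hx hxc

theorem isLinked_of_card_ne_twelve {F : Finset Tile} (hF : Admissible 3 F) (h : F.card ≠ 12) :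
    IsLinked 3 F :=
  (hF.isBasicRect_or_isLinked (by norm_num) (fun _ => IsBasicRect.fixesAndMoves_three)
    fun _ _ => isLinked_union_three).resolve_left fun h' => h h'.card_eq

end Three

/-! ### Transport of the group of one rectangle to explicit coordinates -/

section Coordinates

variable {k : ℕ} {F : Finset Tile} {α : Type*} {f : α → Tile} {A B : Perm α}

/-- The puzzle group of a single rectangle in the coordinates `f` of the base rectangle. -/
theorem IsBasicRect.exists_equiv_map_puzzleGroup (hk : 0 < k) (hF : IsBasicRect k F)
    (hf : Function.Injective f) (hr : ∀ x, x ∈ baseRect k ↔ x ∈ Set.range f)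
    (hA : ∀ i, f (A i) = rotA k (f i)) (hB : ∀ i, f (B i) = rotB k (f i)) :
    ∃ e : F ≃ α, (puzzleGroup k F).map e.permCongrHom.toMonoidHom = Subgroup.closure {A, B} ∧
      ∀ x y : F, SameColor x y ↔ SameColor (f (e x)) (f (e y)) := by
  obtain ⟨ψ, hψ⟩ := hF.exists_isPlacement
  let h : α ≃ F := Equiv.ofBijective (fun i => ⟨ψ (f i), (hψ.mem_iff _).2 ((hr _).2 ⟨i, rfl⟩)⟩) (by
    constructor
    · intro i j hij
      exact hf (ψ.injective (congrArg Subtype.val hij))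
    · rintro ⟨x, hx⟩
      obtain ⟨x, hx, rfl⟩ := hψ.exists_eq hx
      obtain ⟨i, rfl⟩ := (hr x).1 ((hψ.mem_iff x).1 hx)
      exact ⟨i, rfl⟩)
  have hh : ∀ i, ((h i : F) : Tile) = ψ (f i) := fun i => rfl
  -- Permutations of the coordinates become grid permutations of the base rectangle, where both
  -- groups can be compared.
  let j : Perm α →* Perm Tile := (MulAut.conj ψ⁻¹).toMonoidHom.comp
    ((Perm.ofSubtype : Perm F →* Perm Tile).comp h.permCongrHom.toMonoidHom)
  have hj : ∀ p, j p = ψ⁻¹ * (Perm.ofSubtype : Perm F →* Perm Tile) (h.permCongr p) * ψ :=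
    fun p => by
      change ψ⁻¹ * _ * ψ⁻¹⁻¹ = _
      rw [inv_inv]; rfl
  have hinj : Function.Injective j := (MulAut.conj ψ⁻¹).injective.comp
    (ofSubtype_injective.comp h.permCongrHom.injective)
  have hj1 : ∀ p i, j p (f i) = f (p i) := by
    intro p i
    rw [hj, Perm.mul_apply, Perm.mul_apply, ← hh, ofSubtype_apply_coe, Perm.inv_eq_iff_eq, ← hh]
    simp
  have hj2 : ∀ p x, x ∉ baseRect k → j p x = x := by
    intro p x hx
    rw [hj, Perm.mul_apply, Perm.mul_apply, ofSubtype_apply_of_not_mem, Perm.inv_eq_iff_eq]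
    rwa [hψ.mem_iff]
  have hj3 : ∀ p, ∀ g ∈ gridGroup k (baseRect k), (∀ i, f (p i) = g (f i)) → j p = g := by
    intro p g hg hpg
    ext1 x
    by_cases hx : x ∈ baseRect k
    · obtain ⟨i, rfl⟩ := (hr x).1 hx
      rw [hj1, hpg]
    · rw [hj2 p x hx, gridGroup_apply_of_notMem hg hx]
  have hmap : (Subgroup.closure {A, B}).map j = gridGroup k (baseRect k) := by
    rw [MonoidHom.map_closure, Set.image_pair, hj3 A _ (rotA_mem k) hA, hj3 B _ (rotB_mem k) hB,
      gridGroup_baseRect hk]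
  refine ⟨h.symm, ?_, fun x y => ?_⟩
  · ext p
    rw [Subgroup.mem_map_equiv, ← Subgroup.mem_map_iff_mem (K := Subgroup.closure _) hinj, hmap,
      ← hψ.conj_mem_iff, hj, show ∀ g : Perm Tile, ψ * (ψ⁻¹ * g * ψ) * ψ⁻¹ = g by intros; group]
    exact ofSubtype_mem_gridGroup.symm
  · obtain ⟨i, rfl⟩ := h.surjective x
    obtain ⟨i', rfl⟩ := h.surjective y
    rw [hh, hh, hψ.sameColor_iff, h.symm_apply_apply, h.symm_apply_apply]

end Coordinates

/-! ### The 3 × 4 rectangle and the outer automorphism of S_6 -/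

section Twelve

/-- Coordinates on the `3 × 4` rectangle: the color of a tile and its number among the tiles of
this color. -/
def tileTwelve (i : Bool × Fin 6) : ℤ × ℤ :=
  ((i.2 / 2 : ℕ), 2 * (i.2 % 2 : ℕ) + ((i.2 / 2 + i.1.toNat) % 2 : ℕ))

/-- The table of the rotation of the left block of the `3 × 4` rectangle. -/
def leftTwelve : Bool → Fin 6 → Fin 6
  | false => ![1, 5, 2, 3, 0, 4]
  | true => ![3, 1, 0, 4, 2, 5]

/-- The table of the rotation of the right block of the `3 × 4` rectangle. -/
def rightTwelve : Bool → Fin 6 → Fin 6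
  | false => ![0, 3, 1, 5, 4, 2]
  | true => ![1, 5, 2, 3, 0, 4]

/-- The permutation of the coordinates with a given table of order four. -/
def permTwelve (t : Bool → Fin 6 → Fin 6) (h : ∀ c, (t c)^[4] = id) : Perm (Bool × Fin 6) where
  toFun i := (i.1, t i.1 i.2)
  invFun i := (i.1, (t i.1)^[3] i.2)
  left_inv i := Prod.ext rfl (congrFun (h i.1) i.2)
  right_inv i := Prod.ext rfl (by
    change t i.1 ((t i.1)^[3] i.2) = i.2
    rw [← Function.iterate_succ_apply' (t i.1), h]; rfl)

/-- An involution without fixed points on the tiles of one color, for every pair of tiles of the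
other color. This exhibits an outer automorphism of the symmetric group of degree six. -/
def synthemeTable : Fin 6 → Fin 6 → Fin 6 → Fin 6 :=
  ![![![0, 1, 2, 3, 4, 5], ![3, 5, 4, 0, 2, 1], ![2, 4, 0, 5, 1, 3], ![5, 2, 1, 4, 3, 0],
      ![1, 0, 3, 2, 5, 4], ![4, 3, 5, 1, 0, 2]],
    ![![3, 5, 4, 0, 2, 1], ![0, 1, 2, 3, 4, 5], ![1, 0, 5, 4, 3, 2], ![2, 3, 0, 1, 5, 4],
      ![4, 2, 1, 5, 0, 3], ![5, 4, 3, 2, 1, 0]],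
    ![![2, 4, 0, 5, 1, 3], ![1, 0, 5, 4, 3, 2], ![0, 1, 2, 3, 4, 5], ![4, 5, 3, 2, 0, 1],
      ![5, 3, 4, 1, 2, 0], ![3, 2, 1, 0, 5, 4]],
    ![![5, 2, 1, 4, 3, 0], ![2, 3, 0, 1, 5, 4], ![4, 5, 3, 2, 0, 1], ![0, 1, 2, 3, 4, 5],
      ![3, 4, 5, 0, 1, 2], ![1, 0, 4, 5, 2, 3]],
    ![![1, 0, 3, 2, 5, 4], ![4, 2, 1, 5, 0, 3], ![5, 3, 4, 1, 2, 0], ![3, 4, 5, 0, 1, 2],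
      ![0, 1, 2, 3, 4, 5], ![2, 5, 0, 4, 3, 1]],
    ![![4, 3, 5, 1, 0, 2], ![5, 4, 3, 2, 1, 0], ![3, 2, 1, 0, 5, 4], ![1, 0, 4, 5, 2, 3],
      ![2, 5, 0, 4, 3, 1], ![0, 1, 2, 3, 4, 5]]]

/-- The six tiles of color `true` stand for the six totals formed from the other six tiles. Two
totals share exactly one syntheme, the table entry, which therefore determines the pair. -/
theorem synthemeTable_injective : ∀ w w' v v', w ≠ w' →
    synthemeTable v v' = synthemeTable w w' → v = w ∨ v = w' := by
  decide +kernel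

/-- The table entries commute with the puzzle group. -/
theorem closure_permTwelve_equivariant {g : Perm (Bool × Fin 6)}
    (hg : g ∈ Subgroup.closure {permTwelve leftTwelve (by decide +kernel),
      permTwelve rightTwelve (by decide +kernel)}) :
    (∀ i, (g i).1 = i.1) ∧ ∀ w w' z, synthemeTable (g (true, w)).2 (g (true, w')).2
      (g (false, z)).2 = (g (false, synthemeTable w w' z)).2 := by
  induction hg using Subgroup.closure_induction with
  | mem g hg =>
    rcases hg with rfl | rfl
    · exact ⟨fun _ => rfl, by decide +kernel⟩
    · exact ⟨fun _ => rfl, by decide +kernel⟩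
  | one => exact ⟨fun _ => rfl, fun _ _ _ => rfl⟩
  | mul g h _ _ ihg ihh =>
    have hh : ∀ c n, h (c, n) = (c, (h (c, n)).2) := fun c n => Prod.ext (ihh.1 _) rfl
    refine ⟨fun i => (ihg.1 _).trans (ihh.1 _), fun w w' z => ?_⟩
    simp only [Perm.mul_apply]
    rw [hh true w, hh true w', hh false z, ihg.2, ihh.2, ← hh]
  | inv g _ ih =>
    have h1 : ∀ i, (g⁻¹ i).1 = i.1 := fun i => by simpa using (ih.1 (g⁻¹ i)).symm
    have hh : ∀ c n, (c, (g⁻¹ (c, n)).2) = g⁻¹ (c, n) := fun c n => Prod.ext (h1 (c, n)).symm rfl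
    refine ⟨h1, fun w w' z => ?_⟩
    have h2 := ih.2 (g⁻¹ (true, w)).2 (g⁻¹ (true, w')).2 (g⁻¹ (false, z)).2
    simp only [hh, ← Perm.mul_apply, mul_inv_cancel, Perm.one_apply] at h2
    rw [h2]
    have h3 : ∀ n, g (false, n) = (false, (g (false, n)).2) := fun n => Prod.ext (ih.1 _) rfl
    rw [← h3]
    simp

/-- An element trivial on one color fixes all table entries, hence preserves every pair of tiles of
the other color. -/
theorem closure_permTwelve_eq_one {g : Perm (Bool × Fin 6)}
    (hg : g ∈ Subgroup.closure {permTwelve leftTwelve (by decide +kernel),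
      permTwelve rightTwelve (by decide +kernel)}) (h : ∀ n, g (false, n) = (false, n)) :
    g = 1 := by
  obtain ⟨h1, h2⟩ := closure_permTwelve_equivariant hg
  simp only [h] at h2
  have h3 : ∀ w w', w ≠ w' → (g (true, w)).2 = w ∨ (g (true, w)).2 = w' := fun w w' hw =>
    synthemeTable_injective w w' _ _ hw (funext (h2 w w'))
  ext1 ⟨c, n⟩
  cases c
  · exact h n
  · refine Prod.ext (h1 _) ?_
    -- Two pairs that share only n are both preserved, so n is fixed.
    have h4 : ∀ n : Fin 6, ∃ m l, n ≠ m ∧ n ≠ l ∧ m ≠ l := by decide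
    obtain ⟨m, l, hm, hl, hml⟩ := h4 n
    rcases h3 n m hm with h5 | h5
    · exact h5
    rcases h3 n l hl with h6 | h6
    · exact h6
    exact absurd (h5.symm.trans h6) hml

theorem IsBasicRect.exists_equiv_twelve {F : Finset Tile} (hF : IsBasicRect 3 F) :
    ∃ e : F ≃ Bool × Fin 6, (puzzleGroup 3 F).map e.permCongrHom.toMonoidHom =
        Subgroup.closure {permTwelve leftTwelve (by decide +kernel),
          permTwelve rightTwelve (by decide +kernel)} ∧
      ∀ x y : F, SameColor x y ↔ (e x).1 = (e y).1 := by
  have hr : ∀ x, x ∈ baseRect 3 ↔ x ∈ Set.range tileTwelve := by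
    intro x
    rw [← mem_baseTiles]
    constructor
    · revert x
      decide +kernel
    · rintro ⟨i, rfl⟩
      revert i
      decide +kernel
  obtain ⟨e, h1, h2⟩ := hF.exists_equiv_map_puzzleGroup (f := tileTwelve)
    (A := permTwelve leftTwelve (by decide +kernel))
    (B := permTwelve rightTwelve (by decide +kernel)) (by norm_num) (by decide +kernel) hr
    (by simp only [rotA_eq_genFun]; decide +kernel) (by simp only [rotB_eq_genFun]; decide +kernel)
  refine ⟨e, h1, fun x y => ?_⟩
  rw [h2, sameColor_iff]
  generalize e x = i
  generalize e y = j
  revert i j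
  decide +kernel

end Twelve

/-! ### Orbits and isomorphism type of the group on twelve tiles -/

section SingleRectangle

variable {k : ℕ} {F : Finset Tile}

theorem Admissible.isBasicRect_of_card (hF : Admissible k F) (h : F.card = k * (k + 1)) :
    IsBasicRect k F := by
  obtain ⟨R, hR, hRF⟩ := hF.exists_isBasicRect
  rwa [← Finset.eq_of_subset_of_card_le hRF (by rw [h, hR.card_eq])]

theorem puzzleGroup_sameColor (hk : Odd k) {g : Perm F} (hg : g ∈ puzzleGroup k F) (x : F) :
    SameColor (g x) x := by
  rw [← ofSubtype_apply_coe]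
  exact gridGroup_sameColor hk (ofSubtype_mem_gridGroup.2 hg) x

theorem IsBasicRect.exists_swap_on_color (hF : IsBasicRect 3 F) {x y : F} (hxy : x ≠ y)
    (h : SameColor x y) :
    ∃ g ∈ puzzleGroup 3 F, ∀ z : F, SameColor z x → g z = swap x y z := by
  obtain ⟨t, ht, h1, -⟩ := hF.exists_toggles x.2 y.2 (fun h' => hxy (Subtype.ext h')) h
  obtain ⟨g, hg, hgt⟩ := exists_puzzleGroup_of_mem ht
  refine ⟨g, hg, fun z hz => Subtype.ext ?_⟩
  rw [hgt, h1 z hz]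
  simp only [swap_apply_def, Subtype.ext_iff]
  split_ifs <;> rfl

theorem IsBasicRect.orbit_eq (hF : IsBasicRect 3 F) (x : F) :
    MulAction.orbit (puzzleGroup 3 F) x = {y | Black F y ↔ Black F x} := by
  ext y
  constructor
  · rintro ⟨g, rfl⟩
    exact puzzleGroup_sameColor odd_three g.2 x
  · intro (hy : SameColor y x)
    by_cases hyx : x = y
    · rw [hyx]; exact MulAction.mem_orbit_self y
    obtain ⟨g, hg, h⟩ := hF.exists_swap_on_color hyx hy.symm
    exact ⟨⟨g, hg⟩, (h x (.refl _)).trans (swap_apply_left x y)⟩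

theorem IsBasicRect.card_orbit (hF : IsBasicRect 3 F) (x : F) :
    Nat.card (MulAction.orbit (puzzleGroup 3 F) x) = 6 := by
  obtain ⟨e, -, he⟩ := hF.exists_equiv_twelve
  have h : ∀ y, y ∈ MulAction.orbit (puzzleGroup 3 F) x ↔ (e y).1 = (e x).1 := fun y => by
    rw [hF.orbit_eq, ← he]; rfl
  rw [Nat.card_congr (e.subtypeEquiv (q := fun i => i.1 = (e x).1) h)]
  generalize (e x).1 = c
  rw [Nat.card_eq_fintype_card]
  revert c
  decide +kernel

theorem IsBasicRect.toPermHom_surjective (hF : IsBasicRect 3 F) (x : F) :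
    Function.Surjective
      (MulAction.toPermHom (puzzleGroup 3 F) (MulAction.orbit (puzzleGroup 3 F) x)) := by
  classical
  rw [← MonoidHom.range_eq_top, eq_top_iff, ← closure_isSwap, Subgroup.closure_le]
  rintro _ ⟨p, q, hpq, rfl⟩
  have hcol : ∀ p : MulAction.orbit (puzzleGroup 3 F) x, SameColor (p : F) x := fun p =>
    (hF.orbit_eq x).le p.2
  obtain ⟨g, hg, h⟩ := hF.exists_swap_on_color (fun h => hpq (Subtype.ext h))
    ((hcol p).trans (hcol q).symm)
  refine ⟨⟨g, hg⟩, ?_⟩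
  ext1 z
  refine Subtype.ext ((h z ((hcol z).trans (hcol p).symm)).trans ?_)
  simp only [swap_apply_def, Subtype.ext_iff]
  split_ifs <;> rfl

/-- Restriction to one color class is injective by the syntheme table and surjective because toggles
induce all transpositions. -/
theorem IsBasicRect.nonempty_mulEquiv_perm_six (hF : IsBasicRect 3 F) :
    Nonempty (puzzleGroup 3 F ≃* Perm (Fin 6)) := by
  obtain ⟨e, h1, h2⟩ := hF.exists_equiv_twelve
  have hinj : Function.Injective (MulAction.toPermHom (puzzleGroup 3 F)
      (MulAction.orbit (puzzleGroup 3 F) (e.symm (false, 0)))) := by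
    refine (injective_iff_map_eq_one _).2 fun g hg => ?_
    have hmem : e.permCongr (g : Perm F) ∈ (puzzleGroup 3 F).map e.permCongrHom.toMonoidHom :=
      ⟨g, g.2, rfl⟩
    rw [h1] at hmem
    have h3 := closure_permTwelve_eq_one hmem fun n => by
      have h4 : e.symm (false, n) ∈ MulAction.orbit (puzzleGroup 3 F) (e.symm (false, 0)) := by
        rw [hF.orbit_eq]
        exact (h2 _ _).2 (by simp)
      have h5 := congrArg Subtype.val (DFunLike.congr_fun hg ⟨_, h4⟩)
      rw [permCongr_apply, ← e.symm.apply_eq_iff_eq, e.symm_apply_apply]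
      exact h5
    exact Subtype.ext (e.permCongrHom.injective (h3.trans (map_one e.permCongrHom).symm))
  exact ⟨(MulEquiv.ofBijective _ ⟨hinj, hF.toPermHom_surjective _⟩).trans
    (Finite.equivFinOfCardEq (hF.card_orbit _)).permCongrHom⟩

end SingleRectangle

/-! ### The 2 × 3 rectangle and PGL_2(5) -/

section ProjectiveLine

open Matrix

/-- The projective transformation `z ↦ (z + 1) / (4 z + 1)`. -/
def leftGL : GL (Fin 2) (ZMod 5) :=
  GeneralLinearGroup.mkOfDetNeZero !![1, 1; 4, 1] (by decide +kernel)

/-- The projective transformation `z ↦ z / (z + 2)`. -/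
def rightGL : GL (Fin 2) (ZMod 5) :=
  GeneralLinearGroup.mkOfDetNeZero !![1, 0; 1, 2] (by decide +kernel)

/-- The scalar matrix `2`, which acts trivially on the projective line. -/
def scalarGL : GL (Fin 2) (ZMod 5) :=
  GeneralLinearGroup.mkOfDetNeZero !![2, 0; 0, 2] (by decide +kernel)

theorem scalarGL_smul (z : OnePoint (ZMod 5)) : scalarGL • z = z := by
  cases z with
  | infty => simp [OnePoint.smul_infty_eq_ite, scalarGL, GeneralLinearGroup.mkOfDetNeZero]
  | coe z =>
    have : (2 : ZMod 5) ≠ 0 := by decide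
    simp [OnePoint.smul_some_eq_ite, scalarGL, GeneralLinearGroup.mkOfDetNeZero, this]

/-- The word is diag(4, 2), whose ratio of entries generates the units mod 5; the scalar 2 adjusts
the rest. -/
theorem exists_word_eq_diagonal : ∀ d : Fin 2 → ZMod 5, det (diagonal d) ≠ 0 →
    ∃ n m : Fin 4, ((!![1, 1; 4, 1] * !![1, 1; 4, 1] * !![1, 0; 1, 2] * !![1, 0; 1, 2] *
      !![1, 1; 4, 1] * !![1, 0; 1, 2] * !![1, 1; 4, 1] : Matrix (Fin 2) (Fin 2) (ZMod 5)) ^ (n : ℕ)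
        * !![2, 0; 0, 2] ^ (m : ℕ)) = diagonal d := by
  decide +kernel

theorem exists_word_eq_transvection_upper : ∀ c : ZMod 5, ∃ n : Fin 5,
    (!![2, 0; 0, 2] * !![2, 0; 0, 2] * !![2, 0; 0, 2] * !![1, 1; 4, 1] * !![1, 0; 1, 2] :
      Matrix (Fin 2) (Fin 2) (ZMod 5)) ^ (n : ℕ) = transvection 0 1 c := by
  decide +kernel

/-- The square of the first matrix is an antidiagonal involution, so conjugation by it turns upper
transvections into lower ones. -/
theorem exists_word_eq_transvection_lower : ∀ c : ZMod 5, ∃ n : Fin 5,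
    (!![1, 1; 4, 1] * !![1, 1; 4, 1] * (!![2, 0; 0, 2] * !![2, 0; 0, 2] * !![2, 0; 0, 2] *
      !![1, 1; 4, 1] * !![1, 0; 1, 2] : Matrix (Fin 2) (Fin 2) (ZMod 5)) ^ (n : ℕ)) *
      (!![1, 1; 4, 1] * !![1, 1; 4, 1]) = transvection 1 0 c := by
  decide +kernel

/-- Diagonal matrices and transvections generate GL_2(5), and all of them are words in the two
generators and a scalar matrix, which acts trivially. -/
theorem PGL25_eq_closure : PGL25 =
    Subgroup.closure {MulAction.toPerm leftGL, MulAction.toPerm rightGL} := by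
  set N : Subgroup (GL (Fin 2) (ZMod 5)) := (Subgroup.closure {MulAction.toPerm leftGL,
    MulAction.toPerm rightGL}).comap (MulAction.toPermHom _ (OnePoint (ZMod 5))) with hN
  refine le_antisymm ?_ ((Subgroup.closure_le _).2 ?_)
  · have hA : leftGL ∈ N := Subgroup.subset_closure (Set.mem_insert _ _)
    have hB : rightGL ∈ N := Subgroup.subset_closure (Set.mem_insert_of_mem _ rfl)
    have hS : scalarGL ∈ N := by
      have h : MulAction.toPermHom _ (OnePoint (ZMod 5)) scalarGL = 1 :=
        Equiv.ext scalarGL_smul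
      rw [hN, Subgroup.mem_comap, h]
      exact one_mem _
    let M : Submonoid (Matrix (Fin 2) (Fin 2) (ZMod 5)) :=
      N.toSubmonoid.map (Units.coeHom _)
    have hA' : !![1, 1; 4, 1] ∈ M := ⟨_, hA, rfl⟩
    have hB' : !![1, 0; 1, 2] ∈ M := ⟨_, hB, rfl⟩
    have hS' : !![2, 0; 0, 2] ∈ M := ⟨_, hS, rfl⟩
    rintro _ ⟨g, rfl⟩
    suffices h : (g : Matrix (Fin 2) (Fin 2) (ZMod 5)) ∈ M by
      obtain ⟨g', hg', h⟩ := h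
      rw [← Units.ext h]
      exact hg'
    refine diagonal_transvection_induction_of_det_ne_zero (· ∈ M) _ g.det_ne_zero ?_ ?_
      fun A B _ _ => mul_mem
    · intro d hd
      obtain ⟨n, m, h⟩ := exists_word_eq_diagonal d hd
      rw [← h]
      apply_rules [mul_mem, pow_mem]
    · rintro ⟨i, j, hij, c⟩
      rw [TransvectionStruct.toMatrix_mk]
      rcases (by decide +revert : (i = 0 ∧ j = 1) ∨ (i = 1 ∧ j = 0)) with ⟨rfl, rfl⟩ | ⟨rfl, rfl⟩
      · obtain ⟨n, h⟩ := exists_word_eq_transvection_upper c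
        rw [← h]
        apply_rules [mul_mem, pow_mem]
      · obtain ⟨n, h⟩ := exists_word_eq_transvection_lower c
        rw [← h]
        apply_rules [mul_mem, pow_mem]
  · rintro _ (rfl | rfl)
    · exact ⟨leftGL, rfl⟩
    · exact ⟨rightGL, rfl⟩

/-- The tiles of the `2 × 3` rectangle, labeled by the points of the projective line. -/
def tileProjective : OnePoint (ZMod 5) → ℤ × ℤ
  | none => (1, 1)
  | some z => (![(0, 0), (0, 1), (0, 2), (1, 2), (1, 0)] : Fin 5 → ℤ × ℤ) z

/-- The labels are chosen so that the two rotations become the projective maps of `leftGL` and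
`rightGL`. -/
theorem IsBasicRect.exists_equiv_map_eq_PGL25 {F : Finset Tile} (hF : IsBasicRect 2 F) :
    ∃ e : F ≃ OnePoint (ZMod 5),
      (puzzleGroup 2 F).map e.permCongrHom.toMonoidHom = PGL25 := by
  have hinj : Function.Injective tileProjective := by
    have h1 : ∀ x y : ZMod 5, tileProjective x = tileProjective y → x = y := by decide +kernel
    have h2 : ∀ x : ZMod 5, tileProjective x ≠ tileProjective OnePoint.infty := by decide +kernel
    intro x y hxy
    cases x with
    | infty => cases y with
      | infty => rfl
      | coe y => exact absurd hxy.symm (h2 y)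
    | coe x => cases y with
      | infty => exact absurd hxy (h2 x)
      | coe y => rw [h1 x y hxy]
  have hr : ∀ x, x ∈ baseRect 2 ↔ x ∈ Set.range tileProjective := by
    intro x
    rw [← mem_baseTiles]
    constructor
    · revert x
      decide +kernel
    · rintro ⟨i, rfl⟩
      revert i
      decide +kernel
  have hA : ∀ z, tileProjective (MulAction.toPerm leftGL z) = rotA 2 (tileProjective z) := by
    intro z
    rw [rotA_eq_genFun, MulAction.toPerm_apply]
    cases z with
    | infty =>
      rw [OnePoint.smul_infty_eq_ite]
      decide +kernel
    | coe z =>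
      rw [OnePoint.smul_some_eq_ite]
      revert z
      decide +kernel
  have hB : ∀ z, tileProjective (MulAction.toPerm rightGL z) = rotB 2 (tileProjective z) := by
    intro z
    rw [rotB_eq_genFun, MulAction.toPerm_apply]
    cases z with
    | infty =>
      rw [OnePoint.smul_infty_eq_ite]
      decide +kernel
    | coe z =>
      rw [OnePoint.smul_some_eq_ite]
      revert z
      decide +kernel
  obtain ⟨e, he, -⟩ := hF.exists_equiv_map_puzzleGroup (by norm_num) hinj hr hA hB
  exact ⟨e, he.trans PGL25_eq_closure.symm⟩

end ProjectiveLine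

/-! ### The isomorphism with S_5 -/

section SixTiles

/-- Two subgroups generated by corresponding pairs are isomorphic if each element of the group
generated by the pairs is determined by either of its components. -/
theorem nonempty_mulEquiv_closure_pair {M N : Type*} [Group M] [Group N] {a b : M} {a' b' : N}
    (h1 : ∀ p ∈ Subgroup.closure {(a, a'), (b, b')}, p.1 = 1 → p.2 = 1)
    (h2 : ∀ p ∈ Subgroup.closure {(a, a'), (b, b')}, p.2 = 1 → p.1 = 1) :
    Nonempty (Subgroup.closure {a, b} ≃* Subgroup.closure {a', b'}) := by
  set L : Subgroup (M × N) := Subgroup.closure {(a, a'), (b, b')} with hL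
  have i1 : Function.Injective ((MonoidHom.fst M N).comp L.subtype) :=
    (injective_iff_map_eq_one _).2 fun p hp => Subtype.ext (Prod.ext hp (h1 p p.2 hp))
  have i2 : Function.Injective ((MonoidHom.snd M N).comp L.subtype) :=
    (injective_iff_map_eq_one _).2 fun p hp => Subtype.ext (Prod.ext (h2 p p.2 hp) hp)
  have r1 : ((MonoidHom.fst M N).comp L.subtype).range = Subgroup.closure {a, b} := by
    rw [MonoidHom.range_comp, Subgroup.range_subtype, hL, MonoidHom.map_closure, Set.image_pair]
    rfl
  have r2 : ((MonoidHom.snd M N).comp L.subtype).range = Subgroup.closure {a', b'} := by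
    rw [MonoidHom.range_comp, Subgroup.range_subtype, hL, MonoidHom.map_closure, Set.image_pair]
    rfl
  rw [← r1, ← r2]
  exact ⟨(MonoidHom.ofInjective i1).symm.trans (MonoidHom.ofInjective i2)⟩

/-- The permutation with a given table of order dividing four. -/
def permOfTable {n : ℕ} (t : Fin n → Fin n) (h : t^[4] = id) : Perm (Fin n) where
  toFun := t
  invFun := t^[3]
  left_inv i := congrFun h i
  right_inv i := by rw [← Function.iterate_succ_apply' t, h]; rfl

/-- The rotation of the left block of the `2 × 3` rectangle with its tiles numbered by rows. -/
def leftSix : Perm (Fin 6) := permOfTable ![1, 4, 2, 0, 3, 5] (by decide +kernel)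

/-- The rotation of the right block of the `2 × 3` rectangle with its tiles numbered by rows. -/
def rightSix : Perm (Fin 6) := permOfTable ![0, 2, 5, 3, 1, 4] (by decide +kernel)

/-- Five partitions of the six tiles into pairs, permuted by the puzzle group. -/
def syntheme : Fin 5 → Fin 6 → Fin 6 :=
  ![![1, 0, 3, 2, 5, 4], ![2, 4, 0, 5, 1, 3], ![3, 5, 4, 0, 2, 1], ![4, 3, 5, 1, 0, 2],
    ![5, 2, 1, 4, 3, 0]]

/-- The action of `leftSix` on the five synthemes. -/
def leftFive : Perm (Fin 5) := permOfTable ![1, 4, 0, 3, 2] (by decide +kernel)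

/-- The action of `rightSix` on the five synthemes. -/
def rightFive : Perm (Fin 5) := permOfTable ![1, 4, 2, 0, 3] (by decide +kernel)

/-- A five-cycle and a transposition generate the symmetric group of prime degree five. -/
theorem closure_leftFive_rightFive : Subgroup.closure {leftFive, rightFive} = ⊤ := by
  have hA : leftFive ∈ Subgroup.closure {leftFive, rightFive} :=
    Subgroup.subset_closure (Set.mem_insert _ _)
  have hB : rightFive ∈ Subgroup.closure {leftFive, rightFive} :=
    Subgroup.subset_closure (Set.mem_insert_of_mem _ rfl)
  have h1 : leftFive * rightFive = List.formPerm [0, 4, 3, 1, 2] := by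
    ext1 i
    revert i
    decide +kernel
  have h2 : leftFive * leftFive * rightFive * leftFive * rightFive = swap 0 3 := by
    ext1 i
    revert i
    decide +kernel
  have hc : IsCycle (leftFive * rightFive) := by
    rw [h1]
    exact List.isCycle_formPerm (by decide) (by decide)
  have hs : (leftFive * rightFive).support = Finset.univ := by decide +kernel
  rw [eq_top_iff, ← closure_prime_cycle_swap (by decide) hc hs
    ⟨0, 3, by decide, h2⟩, Subgroup.closure_le]
  rintro _ (rfl | rfl) <;> apply_rules [mul_mem]

/-- The five synthemes form a total, and the puzzle group permutes them by conjugation. This action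
is faithful and gives all of S_5. -/
theorem nonempty_mulEquiv_closure_six :
    Nonempty (Subgroup.closure {leftSix, rightSix} ≃* Perm (Fin 5)) := by
  have key : ∀ p ∈ Subgroup.closure {(leftSix, leftFive), (rightSix, rightFive)},
      ∀ i z, p.1 (syntheme i z) = syntheme (p.2 i) (p.1 z) := by
    intro p hp
    induction hp using Subgroup.closure_induction with
    | mem p hp =>
      rcases hp with rfl | rfl <;> decide +kernel
    | one => intro i z; rfl
    | mul p q _ _ hp hq =>
      intro i z
      simp only [Prod.fst_mul, Prod.snd_mul, Perm.mul_apply, hp, hq]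
    | inv p _ hp =>
      intro i z
      rw [Prod.fst_inv, Prod.snd_inv, Perm.inv_eq_iff_eq, hp]
      simp
  have h1 : ∀ p ∈ Subgroup.closure {(leftSix, leftFive), (rightSix, rightFive)},
      p.1 = 1 → p.2 = 1 := by
    intro p hp h
    have hi : Function.Injective syntheme := by decide +kernel
    ext1 i
    refine hi (funext fun z => ?_)
    simpa [h] using (key p hp i z).symm
  have h2 : ∀ p ∈ Subgroup.closure {(leftSix, leftFive), (rightSix, rightFive)},
      p.2 = 1 → p.1 = 1 := by
    intro p hp h
    -- An element that fixes all five synthemes commutes with them, and the relations between their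
    -- products tell the six tiles apart.
    have hi : ∀ x y, (∀ i j l, syntheme i (syntheme j x) = syntheme l x →
        syntheme i (syntheme j y) = syntheme l y) → y = x := by decide +kernel
    have hc : ∀ i z, p.1 (syntheme i z) = syntheme i (p.1 z) := fun i z => by
      rw [key p hp, h]; rfl
    ext1 x
    refine hi x _ fun i j l hx => ?_
    rw [← hc, ← hc, hx, hc]
  obtain ⟨f⟩ := nonempty_mulEquiv_closure_pair h1 h2
  exact ⟨(f.trans (MulEquiv.subgroupCongr closure_leftFive_rightFive)).trans Subgroup.topEquiv⟩

/-- The tiles of the `2 × 3` rectangle, numbered by rows. -/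
def tileSix (i : Fin 6) : ℤ × ℤ := ((i / 3 : ℕ), (i % 3 : ℕ))

theorem IsBasicRect.nonempty_mulEquiv_perm_five {F : Finset Tile} (hF : IsBasicRect 2 F) :
    Nonempty (puzzleGroup 2 F ≃* Perm (Fin 5)) := by
  have hr : ∀ x, x ∈ baseRect 2 ↔ x ∈ Set.range tileSix := by
    intro x
    rw [← mem_baseTiles]
    constructor
    · revert x
      decide +kernel
    · rintro ⟨i, rfl⟩
      revert i
      decide +kernel
  obtain ⟨e, he, -⟩ := hF.exists_equiv_map_puzzleGroup (f := tileSix) (A := leftSix)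
    (B := rightSix) (by norm_num) (by decide +kernel) hr
    (by simp only [rotA_eq_genFun]; decide +kernel) (by simp only [rotB_eq_genFun]; decide +kernel)
  obtain ⟨f⟩ := nonempty_mulEquiv_closure_six
  exact ⟨((puzzleGroup 2 F).equivMapOfInjective _ e.permCongrHom.injective).trans
    ((MulEquiv.subgroupCongr he).trans f)⟩

end SixTiles

end RotatingSquares

open RotatingSquares in
theorem theorem1 (k : ℕ) (hk : 1 < k) (F : Finset Tile) (hF : Admissible k F) :
    (Even k → F.card ≠ 6 →
      (k % 4 = 0 → puzzleGroup k F = alternatingGroup F) ∧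
      (k % 4 = 2 → puzzleGroup k F = ⊤)) ∧
    (Odd k → F.card ≠ 12 →
      (k % 8 = 1 ∨ k % 8 = 7 → puzzleGroup k F = altProd F) ∧
      (k % 8 = 3 ∨ k % 8 = 5 → puzzleGroup k F = evenSymProd F ∧
        (evenSymProd F : Set (Equiv.Perm F)) = (altProd F : Set (Equiv.Perm F)) ∪ oddOddProd F)) ∧
    (F.card = 6 →
      (∃ e : F ≃ OnePoint (ZMod 5),
        (puzzleGroup k F).map e.permCongrHom.toMonoidHom = PGL25) ∧
      Nonempty (puzzleGroup k F ≃* Equiv.Perm (Fin 5))) ∧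
    (k = 3 → F.card = 12 →
      Nonempty (puzzleGroup k F ≃* Equiv.Perm (Fin 6)) ∧
      ∀ x : F,
        MulAction.orbit (puzzleGroup k F) x = {y | Black F y ↔ Black F x} ∧
        Nat.card (MulAction.orbit (puzzleGroup k F) x) = 6 ∧
        Function.Surjective
          (MulAction.toPermHom (puzzleGroup k F) (MulAction.orbit (puzzleGroup k F) x))) := by
  have hlink : ((k = 2 → F.card ≠ 6) ∧ (k = 3 → F.card ≠ 12)) → IsLinked k F := by
    rintro ⟨h2, h3⟩
    rcases (by omega : k = 2 ∨ k = 3 ∨ 4 ≤ k) with rfl | rfl | hk4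
    · exact isLinked_of_card_ne_six hF (h2 rfl)
    · exact isLinked_of_card_ne_twelve hF (h3 rfl)
    · exact isLinked_of_admissible hk4 hF
  refine ⟨fun hk2 hn => ?_, fun hk2 hn => ?_, fun hn => ?_, ?_⟩
  · have h := hlink ⟨fun _ => hn, by rintro rfl; exact absurd hk2 (by decide)⟩
    exact ⟨fun h4 => puzzleGroup_eq_alternatingGroup h4 h,
      fun h4 => puzzleGroup_eq_top h4 h hF.exists_rect_subset⟩
  · have h := hlink ⟨by rintro rfl; exact absurd hk2 (by decide), fun _ => hn⟩
    exact ⟨fun h8 => puzzleGroup_eq_altProd h8 h, fun h8 =>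
      ⟨puzzleGroup_eq_evenSymProd h8 h hF.exists_rect_subset, coe_evenSymProd F⟩⟩
  · obtain ⟨R, hR, hRF⟩ := hF.exists_isBasicRect
    have h1 := Finset.card_le_card hRF
    rw [hR.card_eq, hn] at h1
    -- The figure contains a rectangle, so k(k+1) ≤ 6.
    obtain rfl : k = 2 := by nlinarith
    have h2 := hF.isBasicRect_of_card hn
    exact ⟨h2.exists_equiv_map_eq_PGL25, h2.nonempty_mulEquiv_perm_five⟩
  · rintro rfl hn
    have h := hF.isBasicRect_of_card hn
    exact ⟨h.nonempty_mulEquiv_perm_six, fun x =>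
      ⟨h.orbit_eq x, h.card_orbit x, h.toPermHom_surjective x⟩⟩
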